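/- Let $n\ge 1$, $1<p<\infty$, $0<\theta<1$, and let $p_\theta$ be given by $$\frac1{p_\theta}=\frac{1-\theta}{1}+\frac{\theta}{p}.$$ Fix $b>1$ and $c>0$. Let $\Phi_1$ be the set of smooth functions $\phi:\mathbb R^n\to\mathbb C$ with support in the unit ball $B(0,1)$ and $\sup_x\|D\phi(x)\|\le c$ (operator norm of the real derivative), let $\phi_t(x)=t^{-n}\phi(x/t)$, and for locally integrable $f:\mathbb R^n\to\mathbb C$ put $$\mathcal Mf(x)=\sup_{\phi\in\Phi_1,\ t>0,\ |y-x|<bt}|f*\phi_t(y)|,\qquad \|f\|_{H^1}=\|\mathcal Mf\|_{L^1}.$$ The Hardy space $H^1=H^1(\mathbb R^n)$ consists of the locally integrable $f$ (modulo equality almost everywhere) with $\|f\|_{H^1}<\infty$. Let $\bar S=\{z\in\mathbb C:0\le\Re z\le1\}$ and $S=\{0<\Re z<1\}$. For a locally convex space $D\subseteq H^1+L^p$ (with its own topology), $\mathcal F(H^1,L^p,D)$ denotes the set of bounded functions $z\mapsto f_z$ from $\bar S$ to $D$ which are continuous on $\bar S$, holomorphic in $S$ (both with respect to the topology of $D$),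 and satisfy $(y\mapsto f_{iy})\in C_0(\mathbb R,H^1)$ and $(y\mapsto f_{1+iy})\in C_0(\mathbb R,L^p)$. Its norm is $$\|f_z\|_{\mathcal F(H^1,L^p)}=\max\Bigl\{\sup_{y\in\mathbb R}\|f_{iy}\|_{H^1},\ \sup_{y\in\mathbb R}\|f_{1+iy}\|_{L^p}\Bigr\},$$ and $\mathcal F(H^1,L^p)=\mathcal F(H^1,L^p,H^1+L^p)$, where $H^1+L^p$ carries the norm $\inf\{\|g\|_{H^1}+\|h\|_{L^p}: g+h=f\}$. The space $\mathcal S\cap H^1$ of Schwartz functions that belong to $H^1$ carries the topology of the Schwartz space $\mathcal S=\mathcal S(\mathbb R^n)$. Then there is a constant $C$, depending only on $n,p,\theta,b,c$, such that for every $f\in H^1(\mathbb R^n)\cap L^p(\mathbb R^n)$ with $\|f\|_{L^{p_\theta}}=1$ the following holds. 1. There exists $f_z\in\mathcal F(H^1,L^p)$ such that $f_\theta=f$ and $\|f_z\|_{\mathcal F(H^1,L^p)}\le C$. 2. If in addition $f\in\mathcal S(\mathbb R^n)$, then such an $f_z$ can be chosen in $\mathcal F(H^1,L^p,\mathcal S\cap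 H^1)$, with $f_\theta=f$ and $\|f_z\|_{\mathcal F(H^1,L^p)}\le C$. -/

import Mathlib

open MeasureTheory Set Filter Topology
open scoped ENNReal ContDiff SchwartzMap ZeroAtInfty

/-! ### Calderón's classes of analytic functions on the strip -/

/-- The open strip `0 < Re z < 1`. -/
def openStrip : Set ℂ := {z | 0 < z.re ∧ z.re < 1}

/-- The closed strip `0 ≤ Re z ≤ 1`. -/
def closedStrip : Set ℂ := {z | 0 ≤ z.re ∧ z.re ≤ 1}

section Couple

variable {V X₀ X₁ : Type*} [AddCommGroup V] [Module ℂ V]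
  [NormedAddCommGroup X₀] [NormedSpace ℂ X₀] [NormedAddCommGroup X₁] [NormedSpace ℂ X₁]

/-- For spaces `X₀`, `X₁` included in `V` by `i₀`, `i₁`: the map `(x₀, x₁) ↦ x₀ + x₁`. The product
carries the norm `‖x₀‖ + ‖x₁‖`. -/
noncomputable def sumMap (i₀ : X₀ →ₗ[ℂ] V) (i₁ : X₁ →ₗ[ℂ] V) : WithLp 1 (X₀ × X₁) →ₗ[ℂ] V :=
  (i₀.coprod i₁) ∘ₗ (WithLp.linearEquiv 1 ℂ (X₀ × X₁)).toLinearMap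

/-- The space `X₀ + X₁`, realized as the quotient of `X₀ × X₁` by the kernel of the sum map. Its
quotient norm is the usual one, `inf {‖x₀‖ + ‖x₁‖ : f = x₀ + x₁}`. -/
abbrev SumSpace (i₀ : X₀ →ₗ[ℂ] V) (i₁ : X₁ →ₗ[ℂ] V) : Type _ :=
  WithLp 1 (X₀ × X₁) ⧸ LinearMap.ker (sumMap i₀ i₁)

/-- The inclusion of `X₀ + X₁` into the ambient space `V`. -/
noncomputable def sumIncl (i₀ : X₀ →ₗ[ℂ] V) (i₁ : X₁ →ₗ[ℂ] V) : SumSpace i₀ i₁ →ₗ[ℂ] V :=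
  (LinearMap.ker (sumMap i₀ i₁)).liftQ (sumMap i₀ i₁) le_rfl

/-- The class `𝓕(X₀, X₁, D)`, where `X₀`, `X₁` and the topological vector space `D` are included
in `V` by the linear maps `i₀`, `i₁`, `j`: bounded functions from the closed strip to `D` that are
continuous there and complex differentiable (in the topology of `D`) in the open strip, with
boundary values `y ↦ f (k + i y)` in `C₀(ℝ, X_k)` for `k = 0, 1`. The values of `toFun` off the
closed strip carry no meaning. -/
structure CalderonFun (i₀ : X₀ →ₗ[ℂ] V) (i₁ : X₁ →ₗ[ℂ] V) {D : Type*} [AddCommGroup D]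
    [Module ℂ D] [TopologicalSpace D] (j : D →ₗ[ℂ] V) where
  toFun : ℂ → D
  continuousOn : ContinuousOn toFun closedStrip
  differentiable : ∀ z ∈ openStrip, ∃ d : D,
    Tendsto (fun w => (w - z)⁻¹ • (toFun w - toFun z)) (𝓝[≠] z) (𝓝 d)
  bounded : Bornology.IsVonNBounded ℂ (toFun '' closedStrip)
  bdry₀ : C₀(ℝ, X₀)
  bdry₁ : C₀(ℝ, X₁)
  bdry₀_eq : ∀ y : ℝ, i₀ (bdry₀ y) = j (toFun (y * Complex.I))
  bdry₁_eq : ∀ y : ℝ, i₁ (bdry₁ y) = j (toFun (1 + y * Complex.I))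

/-- The norm of `𝓕(X₀, X₁)`: the larger of the sup norms of the two boundary functions. -/
noncomputable def CalderonFun.norm {i₀ : X₀ →ₗ[ℂ] V} {i₁ : X₁ →ₗ[ℂ] V} {D : Type*}
    [AddCommGroup D] [Module ℂ D] [TopologicalSpace D] {j : D →ₗ[ℂ] V}
    (F : CalderonFun i₀ i₁ j) : ℝ :=
  max ‖F.bdry₀‖ ‖F.bdry₁‖

end Couple

/-! ### The Hardy space -/

/-- The parameters of the non-tangential grand maximal function: an aperture `b > 1` and a bound
`c > 0` for the `C¹`-seminorm of the test functions. -/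
structure MaximalParams where
  b : ℝ
  c : ℝ
  one_lt_b : 1 < b
  c_pos : 0 < c

/-- The space `ℝⁿ`. -/
abbrev Rn (n : ℕ) : Type := EuclideanSpace ℝ (Fin n)

/-- Measurable complex functions on `ℝⁿ` modulo equality almost everywhere. -/
abbrev FunRn (n : ℕ) : Type := Rn n →ₘ[(volume : Measure (Rn n))] ℂ

/-- Smooth functions supported in the unit ball with gradient bounded by `c`. -/
def testFunctions (n : ℕ) (P : MaximalParams) : Set (Rn n → ℂ) :=
  {φ | ContDiff ℝ ∞ φ ∧ tsupport φ ⊆ Metric.ball 0 1 ∧ ∀ x, ‖fderiv ℝ φ x‖ ≤ P.c}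

/-- `φ_t(x) = t⁻ⁿ φ(x / t)`. -/
noncomputable def dilate {n : ℕ} (φ : Rn n → ℂ) (t : ℝ) (x : Rn n) : ℂ :=
  ((t ^ n)⁻¹ : ℝ) • φ (t⁻¹ • x)

/-- The convolution `(f * φ_t)(y)`. -/
noncomputable def convDilate {n : ℕ} (f : Rn n → ℂ) (φ : Rn n → ℂ) (t : ℝ) (y : Rn n) : ℂ :=
  convolution f (dilate φ t) (ContinuousLinearMap.mul ℂ ℂ) volume y

/-- The non-tangential grand maximal function
`Mf(x) = sup {|f * φ_t (y)| : φ ∈ Φ₁, t > 0, |y - x| < b t}`. -/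
noncomputable def grandMaximal {n : ℕ} (P : MaximalParams) (f : Rn n → ℂ) (x : Rn n) : ℝ≥0∞ :=
  ⨆ φ ∈ testFunctions n P, ⨆ (t : ℝ) (_ : 0 < t) (y : Rn n) (_ : dist y x < P.b * t),
    ‖convDilate f φ t y‖ₑ

theorem convDilate_congr {n : ℕ} {f g : Rn n → ℂ} (h : f =ᵐ[volume] g) (φ : Rn n → ℂ) (t : ℝ)
    (y : Rn n) : convDilate f φ t y = convDilate g φ t y := by
  unfold convDilate convolution
  refine integral_congr_ae ?_
  filter_upwards [h] with u hu
  rw [hu]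

theorem grandMaximal_congr {n : ℕ} (P : MaximalParams) {f g : Rn n → ℂ} (h : f =ᵐ[volume] g) :
    grandMaximal P f = grandMaximal P g := by
  funext x
  simp only [grandMaximal, convDilate_congr h]

theorem continuous_dilate {n : ℕ} {φ : Rn n → ℂ} (hφ : Continuous φ) (t : ℝ) :
    Continuous (dilate φ t) := by
  unfold dilate
  fun_prop

theorem hasCompactSupport_dilate {n : ℕ} {φ : Rn n → ℂ} (hφ : HasCompactSupport φ) {t : ℝ}
    (ht : 0 < t) : HasCompactSupport (dilate φ t) :=
  (hφ.comp_smul (inv_ne_zero ht.ne')).smul_left (f := fun _ => (t ^ n)⁻¹)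

theorem testFunctions_compact {n : ℕ} {P : MaximalParams} {φ : Rn n → ℂ}
    (h : φ ∈ testFunctions n P) : HasCompactSupport φ :=
  HasCompactSupport.of_support_subset_isCompact (isCompact_closedBall (0 : Rn n) 1)
    ((subset_tsupport φ).trans (h.2.1.trans Metric.ball_subset_closedBall))

theorem convDilate_exists {n : ℕ} {P : MaximalParams} {f φ : Rn n → ℂ}
    (hf : LocallyIntegrable f) (h : φ ∈ testFunctions n P) {t : ℝ} (ht : 0 < t) (y : Rn n) :
    ConvolutionExistsAt f (dilate φ t) y (ContinuousLinearMap.mul ℂ ℂ) volume :=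
  (hasCompactSupport_dilate (testFunctions_compact h) ht).convolutionExists_right
    (ContinuousLinearMap.mul ℂ ℂ) hf (continuous_dilate h.1.continuous t) y

theorem le_grandMaximal {n : ℕ} {P : MaximalParams} (f : Rn n → ℂ) {φ : Rn n → ℂ}
    (h : φ ∈ testFunctions n P) {t : ℝ} (ht : 0 < t) {x y : Rn n} (hy : dist y x < P.b * t) :
    ‖convDilate f φ t y‖ₑ ≤ grandMaximal P f x := by
  unfold grandMaximal
  exact le_iSup₂_of_le φ h (le_iSup₂_of_le t ht (le_iSup₂_of_le y hy le_rfl))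

theorem grandMaximal_le {n : ℕ} {P : MaximalParams} {f : Rn n → ℂ} {x : Rn n} {a : ℝ≥0∞}
    (h : ∀ φ ∈ testFunctions n P, ∀ t : ℝ, 0 < t → ∀ y, dist y x < P.b * t →
      ‖convDilate f φ t y‖ₑ ≤ a) : grandMaximal P f x ≤ a := by
  unfold grandMaximal
  exact iSup₂_le fun φ hφ => iSup₂_le fun t ht => iSup₂_le fun y hy => h φ hφ t ht y hy

theorem lowerSemicontinuous_grandMaximal {n : ℕ} (P : MaximalParams) (f : Rn n → ℂ) :
    LowerSemicontinuous (grandMaximal P f) := by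
  intro x a ha
  unfold grandMaximal at ha
  simp only [lt_iSup_iff] at ha
  obtain ⟨φ, hφ, t, ht, y, hy, hlt⟩ := ha
  have : ∀ᶠ x' in 𝓝 x, dist y x' < P.b * t :=
    (continuous_const.dist continuous_id).continuousAt.eventually_lt_const hy
  filter_upwards [this] with x' hx'
  exact hlt.trans_le (le_grandMaximal f hφ ht hx')

theorem grandMaximal_add_le {n : ℕ} (P : MaximalParams) {f g : Rn n → ℂ}
    (hf : LocallyIntegrable f) (hg : LocallyIntegrable g) (x : Rn n) :
    grandMaximal P (f + g) x ≤ grandMaximal P f x + grandMaximal P g x := by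
  refine grandMaximal_le fun φ hφ t ht y hy => ?_
  have : convDilate (f + g) φ t y = convDilate f φ t y + convDilate g φ t y :=
    (convDilate_exists hf hφ ht y).add_distrib (convDilate_exists hg hφ ht y)
  rw [this]
  exact (enorm_add_le _ _).trans
    (add_le_add (le_grandMaximal f hφ ht hy) (le_grandMaximal g hφ ht hy))

theorem grandMaximal_smul {n : ℕ} (P : MaximalParams) (a : ℂ) (f : Rn n → ℂ) (x : Rn n) :
    grandMaximal P (a • f) x = ‖a‖ₑ * grandMaximal P f x := by
  have : ∀ φ t y, convDilate (a • f) φ t y = a • convDilate f φ t y := by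
    intro φ t y
    unfold convDilate
    rw [smul_convolution]
    rfl
  simp only [grandMaximal, this, enorm_smul, ENNReal.mul_iSup]

theorem grandMaximal_zero {n : ℕ} (P : MaximalParams) (x : Rn n) :
    grandMaximal P (0 : Rn n → ℂ) x = 0 := by
  simpa using grandMaximal_smul P 0 (0 : Rn n → ℂ) x

/-- The Hardy space `H¹(ℝⁿ)` as a subspace: the (locally integrable) functions `f` with
`‖Mf‖₁ < ∞`. -/
noncomputable def hardySubmodule (n : ℕ) (P : MaximalParams) : Submodule ℂ (FunRn n) where
  carrier := {f | LocallyIntegrable f ∧ ∫⁻ x, grandMaximal P f x < ⊤}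
  zero_mem' := by
    have h0 : ((0 : FunRn n) : Rn n → ℂ) =ᵐ[volume] (0 : Rn n → ℂ) := AEEqFun.coeFn_zero
    refine ⟨(locallyIntegrable_zero (μ := (volume : Measure (Rn n)))).congr h0.symm, ?_⟩
    simp [grandMaximal_congr P h0, grandMaximal_zero]
  add_mem' := by
    rintro f g ⟨hf, hf'⟩ ⟨hg, hg'⟩
    have h := AEEqFun.coeFn_add f g
    refine ⟨(hf.add hg).congr h.symm, ?_⟩
    rw [grandMaximal_congr P h]
    refine (lintegral_mono (grandMaximal_add_le P hf hg)).trans_lt ?_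
    rw [lintegral_add_left (lowerSemicontinuous_grandMaximal P f).measurable]
    exact ENNReal.add_lt_top.2 ⟨hf', hg'⟩
  smul_mem' := by
    rintro a f ⟨hf, hf'⟩
    have h := AEEqFun.coeFn_smul a f
    refine ⟨(hf.smul a).congr h.symm, ?_⟩
    rw [grandMaximal_congr P h]
    simp only [grandMaximal_smul]
    rw [lintegral_const_mul _ (lowerSemicontinuous_grandMaximal P f).measurable]
    exact ENNReal.mul_lt_top enorm_lt_top hf'

/-- The Hardy space `H¹(ℝⁿ)` as a type, to be normed by `‖f‖ = ‖Mf‖₁`. -/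
def HardySpace (n : ℕ) (P : MaximalParams) : Type := hardySubmodule n P

noncomputable instance (n : ℕ) (P : MaximalParams) : AddCommGroup (HardySpace n P) :=
  inferInstanceAs (AddCommGroup (hardySubmodule n P))

noncomputable instance (n : ℕ) (P : MaximalParams) : Module ℂ (HardySpace n P) :=
  inferInstanceAs (Module ℂ (hardySubmodule n P))

/-- The inclusion of `H¹(ℝⁿ)` into the measurable functions. -/
noncomputable def hardyIncl (n : ℕ) (P : MaximalParams) : HardySpace n P →ₗ[ℂ] FunRn n :=
  (hardySubmodule n P).subtype

noncomputable instance (n : ℕ) (P : MaximalParams) : Norm (HardySpace n P) :=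
  ⟨fun f => (∫⁻ x, grandMaximal P (hardyIncl n P f) x).toReal⟩

theorem ae_eq_zero_of_grandMaximal {n : ℕ} (P : MaximalParams) {f : Rn n → ℂ}
    (hf : LocallyIntegrable f) (h : ∫⁻ x, grandMaximal P f x = 0) : f =ᵐ[volume] 0 := by
  have hz : ∀ x, grandMaximal P f x = 0 := by
    have hae := (lintegral_eq_zero_iff (lowerSemicontinuous_grandMaximal P f).measurable).1 h
    have hopen : IsOpen {x | 0 < grandMaximal P f x} :=
      (lowerSemicontinuous_grandMaximal P f).isOpen_preimage 0
    have hnull : volume {x | 0 < grandMaximal P f x} = 0 := by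
      refine measure_mono_null ?_ (ae_iff.1 hae)
      intro x hx
      exact (ne_of_gt hx : grandMaximal P f x ≠ 0)
    have hemp := (hopen.measure_eq_zero_iff volume).1 hnull
    intro x
    by_contra hx
    have : x ∈ {x | 0 < grandMaximal P f x} := pos_iff_ne_zero.2 hx
    simp [hemp] at this
  refine ae_eq_zero_of_integral_contDiff_smul_eq_zero hf fun g hg hgc => ?_
  -- choose a radius `t` with `supp g ⊆ B(0, t)`
  obtain ⟨R, hR⟩ := hgc.isCompact.isBounded.subset_ball (0 : Rn n)
  set t : ℝ := max R 1 with ht_def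
  have ht : 0 < t := lt_of_lt_of_le one_pos (le_max_right _ _)
  have hsupp : tsupport g ⊆ Metric.ball (0 : Rn n) t :=
    hR.trans (Metric.ball_subset_ball (le_max_left _ _))
  set ψ : Rn n → ℂ := fun v => ((g (-(t • v)) : ℝ) : ℂ) with hψ
  have hψs : ContDiff ℝ ∞ ψ :=
    Complex.ofRealCLM.contDiff.comp (hg.comp (contDiff_id.const_smul t).neg)
  have hψt : tsupport ψ ⊆ Metric.ball 0 1 := by
    have hsub : tsupport ψ ⊆ (fun v : Rn n => -(t • v)) ⁻¹' tsupport g := by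
      refine closure_minimal (fun v hv => subset_tsupport g ?_)
        ((isClosed_tsupport g).preimage (by fun_prop))
      intro h0
      apply hv
      simp [hψ, h0]
    intro v hv
    have h1 := hsupp (hsub hv)
    simp only [mem_ball_zero_iff, norm_neg, norm_smul, Real.norm_eq_abs, abs_of_pos ht] at h1 ⊢
    nlinarith
  have hψc : HasCompactSupport ψ :=
    HasCompactSupport.of_support_subset_isCompact (isCompact_closedBall (0 : Rn n) 1)
      ((subset_tsupport ψ).trans (hψt.trans Metric.ball_subset_closedBall))
  obtain ⟨K, hK⟩ := (hψc.fderiv (𝕜 := ℝ)).exists_bound_of_continuous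
    (hψs.continuous_fderiv (by simp))
  have hK0 : 0 ≤ K := (norm_nonneg _).trans (hK 0)
  set s : ℝ := P.c / (K + 1) with hs
  have hs0 : 0 < s := div_pos P.c_pos (by linarith)
  have hmem : (fun v => s • ψ v) ∈ testFunctions n P := by
    refine ⟨hψs.const_smul s, (closure_mono ?_).trans hψt, fun x => ?_⟩
    · exact Function.support_const_smul_subset s ψ
    · rw [fderiv_fun_const_smul ((hψs.differentiable (by simp)) x), norm_smul, Real.norm_eq_abs,
        abs_of_pos hs0, hs, div_mul_eq_mul_div, div_le_iff₀ (by linarith)]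
      exact mul_le_mul_of_nonneg_left ((hK x).trans (by linarith)) P.c_pos.le
  have h0 : convDilate f (fun v => s • ψ v) t 0 = 0 := by
    have := le_grandMaximal (x := 0) (y := 0) f hmem ht
      (by simpa using mul_pos (one_pos.trans P.one_lt_b) ht)
    rw [hz 0] at this
    simpa using this
  have h1 : convDilate f (fun v => s • ψ v) t 0
      = (((t ^ n)⁻¹ * s : ℝ) : ℂ) * ∫ x, g x • f x := by
    unfold convDilate convolution
    rw [← integral_const_mul]
    refine integral_congr_ae (Eventually.of_forall fun x => ?_)
    simp [dilate, hψ, smul_smul, ht.ne']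
    ring
  rw [h1] at h0
  refine (mul_eq_zero.1 h0).resolve_left ?_
  have : (t ^ n)⁻¹ * s ≠ 0 := by positivity
  exact_mod_cast this

theorem hardyCore (n : ℕ) (P : MaximalParams) : NormedSpace.Core ℂ (HardySpace n P) where
  norm_nonneg f := ENNReal.toReal_nonneg
  norm_smul a f := by
    change (∫⁻ x, grandMaximal P (a • hardyIncl n P f : FunRn n) x).toReal = _
    rw [grandMaximal_congr P (AEEqFun.coeFn_smul a (hardyIncl n P f))]
    simp only [grandMaximal_smul]
    rw [lintegral_const_mul _ (lowerSemicontinuous_grandMaximal P _).measurable,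
      ENNReal.toReal_mul, toReal_enorm]
    rfl
  norm_triangle f g := by
    have hf : ∫⁻ x, grandMaximal P (hardyIncl n P f) x ≠ ⊤ := f.2.2.ne
    have hg : ∫⁻ x, grandMaximal P (hardyIncl n P g) x ≠ ⊤ := g.2.2.ne
    change (∫⁻ x, grandMaximal P (hardyIncl n P f + hardyIncl n P g : FunRn n) x).toReal
      ≤ (∫⁻ x, grandMaximal P (hardyIncl n P f) x).toReal
        + (∫⁻ x, grandMaximal P (hardyIncl n P g) x).toReal
    rw [grandMaximal_congr P (AEEqFun.coeFn_add (hardyIncl n P f) (hardyIncl n P g)),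
      ← ENNReal.toReal_add hf hg]
    refine ENNReal.toReal_mono (ENNReal.add_ne_top.2 ⟨hf, hg⟩) ?_
    rw [← lintegral_add_left (lowerSemicontinuous_grandMaximal P _).measurable]
    exact lintegral_mono (grandMaximal_add_le P f.2.1 g.2.1)
  norm_eq_zero_iff f := by
    constructor
    · intro h
      have h' : ∫⁻ x, grandMaximal P (hardyIncl n P f) x = 0 :=
        ((ENNReal.toReal_eq_zero_iff _).1 h).resolve_right f.2.2.ne
      apply Subtype.ext
      exact AEEqFun.ext ((ae_eq_zero_of_grandMaximal P f.2.1 h').trans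
        AEEqFun.coeFn_zero.symm)
    · rintro rfl
      change (∫⁻ x, grandMaximal P (hardyIncl n P 0) x).toReal = 0
      rw [map_zero, grandMaximal_congr P AEEqFun.coeFn_zero]
      simp [grandMaximal_zero]

noncomputable instance (n : ℕ) (P : MaximalParams) : NormedAddCommGroup (HardySpace n P) :=
  NormedAddCommGroup.ofCore (hardyCore n P)

noncomputable instance (n : ℕ) (P : MaximalParams) : NormedSpace ℂ (HardySpace n P) :=
  NormedSpace.ofCore (hardyCore n P)

/-! ### The other spaces of functions on `ℝⁿ` -/

/-- The inclusion of `L^p(ℝⁿ)` into the measurable functions. -/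
noncomputable def lpIncl (n : ℕ) (p : ℝ≥0∞) :
    Lp ℂ p (volume : Measure (Rn n)) →ₗ[ℂ] FunRn n where
  toFun f := f
  map_add' _ _ := rfl
  map_smul' _ _ := rfl

/-- The inclusion of the Schwartz space into the measurable functions. -/
noncomputable def schwartzIncl (n : ℕ) : 𝓢(Rn n, ℂ) →ₗ[ℂ] FunRn n where
  toFun f := AEEqFun.mk f f.continuous.aestronglyMeasurable
  map_add' _ _ := rfl
  map_smul' _ _ := rfl

/-- The space `𝓢 ∩ H¹` (the Schwartz functions whose class lies in `H¹`), a subspace of the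
Schwartz space carrying its Fréchet topology. -/
noncomputable abbrev SchwartzHardy (n : ℕ) (P : MaximalParams) : Submodule ℂ 𝓢(Rn n, ℂ) :=
  (hardySubmodule n P).comap (schwartzIncl n)

/-- The inclusion of `𝓢 ∩ H¹` into the measurable functions. -/
noncomputable def schwartzHardyIncl (n : ℕ) (P : MaximalParams) :
    SchwartzHardy n P →ₗ[ℂ] FunRn n :=
  schwartzIncl n ∘ₗ (SchwartzHardy n P).subtype

/-- The class `𝓕(H¹, L^p)`, i.e. `𝓕(H¹, L^p, H¹ + L^p)`. -/
abbrev CalderonHardyLp (n : ℕ) (P : MaximalParams) (p : ℝ≥0∞) [Fact (1 ≤ p)] : Type :=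
  CalderonFun (hardyIncl n P) (lpIncl n p) (sumIncl (hardyIncl n P) (lpIncl n p))

/-- The class `𝓕(H¹, L^p, 𝓢 ∩ H¹)`. -/
abbrev CalderonHardyLpSchwartz (n : ℕ) (P : MaximalParams) (p : ℝ≥0∞) [Fact (1 ≤ p)] : Type :=
  CalderonFun (hardyIncl n P) (lpIncl n p) (schwartzHardyIncl n P)

/-!
Write `q` for the intermediate exponent, so that `1 / q = (1 - θ) + θ / p`. For `L^p` couples the
analytic family through `f` is `|f| ^ α(z)` times the phase of `f`, with an affine `α`. This is not
available here, since powers of `|f|` lose the cancellation that membership in `H¹` requires.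
Instead `f` is cut into layers according to the size of a maximal function, each layer keeping its
cancellation, and each layer is multiplied by the appropriate power of its height:

  `f_z = exp (z² - θ²) * (∑ k, 2 ^ (k α(z)) u_k + r)`, with `α(z) = (1 - z)(q - 1) + z (q / p - 1)`.

The relation between the exponents says that `α(θ) = 0`, so that `f_θ = ∑ k, u_k + r = f`. The sum
is finite, so that analyticity and boundedness in any space `D` containing the layers are clear
(`exists_calderonFun_of_sum`), and the Gaussian factor makes the boundary values vanish at infinity.

The layers come from the Calderón–Zygmund decomposition over dyadic cubes. Let `M` be the dyadic
maximal function of `h` and `g_k` the good part of `h` at height `2 ^ k`, in which `h` is replaced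
by its mean on each maximal cube where the average of `|h|` exceeds `2 ^ k`. The layer
`u_k = g_{k + 1} - g_k` is bounded by a multiple of `2 ^ k`, vanishes outside `{M > 2 ^ k}` and has
mean zero on each of the cubes that make up this set. Hence it is a sum of atoms with
`‖u_k‖_{H¹} ≲ 2 ^ k |{M > 2 ^ k}|` (`exists_lintegral_grandMaximal_goodPart_sub_le`), and summing
geometric series gives

  `∑ k, 2 ^ (k (q - 1)) ‖u_k‖_{H¹} ≲ ∫ M ^ q` and `∑ k, 2 ^ (k (q / p - 1)) |u_k| ≲ M ^ (q / p)`,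

where `∫ M ^ q ≲ ∫ |h| ^ q` by the maximal theorem. These are the bounds of `f_z` in `H¹` on
`Re z = 0` and in `L^p` on `Re z = 1`; they are collected in `exists_isLayerDecomposition`.

To obtain finitely many layers, with the lowest good part equal to zero, the decomposition is
applied to `h = χ (f - c)`, where `χ` is a cutoff at a large scale `R` and `c` makes the mean of `h`
zero. The error `f - h` is small in `L^p` and also in `H¹`
(`eventually_lintegral_grandMaximal_sub_truncate_le`): smooth averages of `f` at scale `R` are
controlled by the value of the grand maximal function `𝓜f` at any point of `B(0, R)`, and at some
such point `𝓜f` is at most a constant times `R ^ (-n)` times a tail of its integral. The error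
joins the remainder `r`.

For Schwartz functions `h` is smooth, and the layers are mollified, which preserves all the bounds
(`exists_contDiff_isLayerDecomposition`). Then the layers are smooth with compact support, and `r`
is a Schwartz function.
-/

/-! ### Finite analytic sums in the Calderón class -/

section Couple

variable {V X₀ X₁ : Type*} [AddCommGroup V] [Module ℂ V]
  [NormedAddCommGroup X₀] [NormedSpace ℂ X₀] [NormedAddCommGroup X₁] [NormedSpace ℂ X₁]

/-- The function `y ↦ ∑ i, s i y • x i`, a finite sum with continuous scalar weights that vanish at
infinity. -/
noncomputable def weightedSumC0 {ι X : Type*} [Fintype ι] [NormedAddCommGroup X] [NormedSpace ℂ X]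
    (s : ι → ℝ → ℂ) (hs : ∀ i, Continuous (s i))
    (h0 : ∀ i, Tendsto (s i) (cocompact ℝ) (𝓝 0)) (x : ι → X) : C₀(ℝ, X) where
  toFun y := ∑ i, s i y • x i
  continuous_toFun := by fun_prop
  zero_at_infty' := by
    have : Tendsto (fun y => ∑ i, s i y • x i) (cocompact ℝ) (𝓝 (∑ i, (0 : ℂ) • x i)) :=
      tendsto_finsetSum _ fun i _ => (h0 i).smul_const _
    simpa using this

/-- A finite sum `z ↦ ∑ i, s i z • d i` with entire scalar weights which are bounded on the strip
and vanish at infinity on its two boundary lines belongs to Calderón's class as soon as every `d i`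
lies in both endpoint spaces. -/
theorem exists_calderonFun_of_sum {D : Type*} [AddCommGroup D] [Module ℂ D] [TopologicalSpace D]
    [IsTopologicalAddGroup D] [ContinuousSMul ℂ D]
    (i₀ : X₀ →ₗ[ℂ] V) (i₁ : X₁ →ₗ[ℂ] V) (j : D →ₗ[ℂ] V) {ι : Type*} [Fintype ι]
    (s : ι → ℂ → ℂ) (hs : ∀ i, Differentiable ℂ (s i))
    (hbdd : ∀ i, ∃ B, ∀ z ∈ closedStrip, ‖s i z‖ ≤ B)
    (h0 : ∀ i, Tendsto (fun y : ℝ => s i (y * Complex.I)) (cocompact ℝ) (𝓝 0))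
    (h1 : ∀ i, Tendsto (fun y : ℝ => s i (1 + y * Complex.I)) (cocompact ℝ) (𝓝 0))
    (d : ι → D) (x₀ : ι → X₀) (x₁ : ι → X₁)
    (hx₀ : ∀ i, i₀ (x₀ i) = j (d i)) (hx₁ : ∀ i, i₁ (x₁ i) = j (d i)) :
    ∃ F : CalderonFun i₀ i₁ j, (∀ z, F.toFun z = ∑ i, s i z • d i) ∧
      (∀ y : ℝ, F.bdry₀ y = ∑ i, s i (y * Complex.I) • x₀ i) ∧
      (∀ y : ℝ, F.bdry₁ y = ∑ i, s i (1 + y * Complex.I) • x₁ i) := by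
  let L : (ι → ℂ) →L[ℂ] D :=
    { toFun := fun c => ∑ i, c i • d i
      map_add' := fun a b => by simp [add_smul, Finset.sum_add_distrib]
      map_smul' := fun a b => by simp [Finset.smul_sum, smul_smul]
      cont := by fun_prop }
  have hL : ∀ c, L c = ∑ i, c i • d i := fun _ => rfl
  let σ : ℂ → ι → ℂ := fun z i => s i z
  have hσ : Differentiable ℂ σ := differentiable_pi.2 hs
  refine ⟨{
    toFun := fun z => L (σ z)
    continuousOn := (L.continuous.comp hσ.continuous).continuousOn
    differentiable := fun z _ => ?_
    bounded := ?_
    bdry₀ := weightedSumC0 (fun i (y : ℝ) => s i (y * Complex.I))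
      (fun i => (hs i).continuous.comp (by fun_prop)) h0 x₀
    bdry₁ := weightedSumC0 (fun i (y : ℝ) => s i (1 + y * Complex.I))
      (fun i => (hs i).continuous.comp (by fun_prop)) h1 x₁
    bdry₀_eq := fun y => ?_
    bdry₁_eq := fun y => ?_ }, fun z => rfl, fun y => rfl, fun y => rfl⟩
  · refine ⟨L (deriv σ z), ?_⟩
    have h := (hσ z).hasDerivAt.tendsto_slope
    refine ((L.continuous.tendsto _).comp h).congr fun w => ?_
    simp [slope_def_module]
  · rw [← image_image]
    refine Bornology.IsVonNBounded.image ?_ L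
    rw [NormedSpace.isVonNBounded_iff, isBounded_iff_forall_norm_le]
    choose B hB using hbdd
    refine ⟨∑ i, |B i|, ?_⟩
    rintro _ ⟨z, hz, rfl⟩
    rw [pi_norm_le_iff_of_nonneg (by positivity)]
    intro i
    exact ((hB i z hz).trans (le_abs_self _)).trans
      (Finset.single_le_sum (f := fun i => |B i|) (fun i _ => abs_nonneg _) (Finset.mem_univ i))
  · change i₀ (∑ i, _ • _) = _
    simp [hL, map_sum, hx₀, σ]
  · change i₁ (∑ i, _ • _) = _
    simp [hL, map_sum, hx₁, σ]

end Couple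

/-! ### Test functions and the grand maximal function -/

section TestFunctions

variable {n : ℕ} {P : MaximalParams}

theorem convDilate_eq_integral (f φ : Rn n → ℂ) (t : ℝ) (y : Rn n) :
    convDilate f φ t y = ∫ u, f u * dilate φ t (y - u) := rfl

/-- A test function vanishes at distance `2` from any point of the unit ball, so that the gradient
bound also bounds its values. In dimension zero there is no such point and the claim fails. -/
theorem norm_testFunction_le (hn : 0 < n) {φ : Rn n → ℂ} (h : φ ∈ testFunctions n P) (x : Rn n) :
    ‖φ x‖ ≤ 2 * P.c := by
  have : Nonempty (Fin n) := ⟨⟨0, hn⟩⟩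
  by_cases hx : x ∈ Metric.ball (0 : Rn n) 1
  · obtain ⟨v, hv⟩ := exists_norm_eq (Rn n) (c := 2) (by norm_num)
    have h0 : φ (x + v) = 0 := by
      refine image_eq_zero_of_notMem_tsupport fun hm => ?_
      have h1 := h.2.1 hm
      rw [mem_ball_zero_iff] at h1 hx
      have h2 := norm_sub_le (x + v) x
      rw [add_sub_cancel_left] at h2
      linarith
    have h1 := Convex.norm_image_sub_le_of_norm_fderiv_le (𝕜 := ℝ) (f := φ) (s := univ)
      (fun z _ => h.1.differentiable (by simp) z) (fun z _ => h.2.2 z) convex_univ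
      (mem_univ (x + v)) (mem_univ x)
    rw [h0, sub_zero, sub_add_cancel_left, norm_neg, hv] at h1
    linarith
  · rw [image_eq_zero_of_notMem_tsupport fun hm => hx (h.2.1 hm), norm_zero]
    linarith [P.c_pos]

/-- The kernel `u ↦ φ_t (y - u)` against which `f` is integrated in the grand maximal function. -/
noncomputable def testKernel (φ : Rn n → ℂ) (t : ℝ) (y u : Rn n) : ℂ := dilate φ t (y - u)

theorem contDiff_testKernel {φ : Rn n → ℂ} (h : φ ∈ testFunctions n P) (t : ℝ) (y : Rn n) :
    ContDiff ℝ ∞ (testKernel φ t y) := by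
  unfold testKernel dilate
  have := h.1
  fun_prop

theorem support_testKernel_subset {φ : Rn n → ℂ} (h : φ ∈ testFunctions n P) {t : ℝ} (ht : 0 < t)
    (y : Rn n) : tsupport (testKernel φ t y) ⊆ Metric.ball y t := by
  have hsub : tsupport (testKernel φ t y) ⊆ (fun u : Rn n => t⁻¹ • (y - u)) ⁻¹' tsupport φ := by
    refine closure_minimal (fun v hv => subset_tsupport φ ?_)
      ((isClosed_tsupport φ).preimage (by fun_prop))
    intro h0
    apply hv
    simp [testKernel, dilate, h0]
  intro v hv
  have h1 := h.2.1 (hsub hv)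
  rw [mem_ball_zero_iff, norm_smul, norm_inv, Real.norm_of_nonneg ht.le, inv_mul_lt_one₀ ht] at h1
  rwa [Metric.mem_ball, dist_comm, dist_eq_norm]

theorem norm_testKernel_le (hn : 0 < n) {φ : Rn n → ℂ} (h : φ ∈ testFunctions n P) {t : ℝ}
    (ht : 0 < t) (y u : Rn n) : ‖testKernel φ t y u‖ ≤ 2 * P.c / t ^ n := by
  have h1 := norm_testFunction_le hn h (t⁻¹ • (y - u))
  rw [testKernel, dilate, norm_smul, Real.norm_of_nonneg (by positivity), inv_mul_eq_div]
  gcongr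

theorem norm_fderiv_testKernel_le {φ : Rn n → ℂ} (h : φ ∈ testFunctions n P) {t : ℝ}
    (ht : 0 < t) (y u : Rn n) : ‖fderiv ℝ (testKernel φ t y) u‖ ≤ P.c / t ^ (n + 1) := by
  have h2 : HasFDerivAt (fun u : Rn n => t⁻¹ • (y - u))
      (t⁻¹ • (-ContinuousLinearMap.id ℝ (Rn n))) u :=
    ((hasFDerivAt_id u).const_sub y).const_smul t⁻¹
  have h3 := (((h.1.differentiable (by simp) (t⁻¹ • (y - u))).hasFDerivAt.comp u h2).const_smul
    ((t ^ n)⁻¹ : ℝ))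
  have h4 : HasFDerivAt (testKernel φ t y) _ u := h3
  rw [h4.fderiv]
  have h5 : ‖(t⁻¹ • (-ContinuousLinearMap.id ℝ (Rn n)))‖ ≤ t⁻¹ := by
    rw [norm_smul, norm_neg, Real.norm_of_nonneg (by positivity)]
    exact mul_le_of_le_one_right (by positivity) ContinuousLinearMap.norm_id_le
  calc _ ≤ (t ^ n)⁻¹ * (P.c * t⁻¹) := by
        rw [norm_smul, Real.norm_of_nonneg (by positivity)]
        gcongr
        exact (ContinuousLinearMap.opNorm_comp_le _ _).trans
          (mul_le_mul (h.2.2 _) h5 (norm_nonneg _) P.c_pos.le)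
    _ = P.c / t ^ (n + 1) := by rw [pow_succ]; field_simp

theorem integrable_mul_testKernel {f φ : Rn n → ℂ} (hf : LocallyIntegrable f)
    (h : φ ∈ testFunctions n P) {t : ℝ} (ht : 0 < t) (y : Rn n) :
    Integrable (fun u => f u * testKernel φ t y u) :=
  convDilate_exists hf h ht y

/-- Any smooth bump adapted to a ball is a multiple of a test function, so that its pairing with
`f` is controlled by the grand maximal function at every nearby point. -/
theorem enorm_integral_mul_le_grandMaximal (f : Rn n → ℂ) {ψ : Rn n → ℂ} (hψ : ContDiff ℝ ∞ ψ)
    {y₀ : Rn n} {ρ A : ℝ} (hρ : 0 < ρ) (hA : 0 < A) (hsupp : tsupport ψ ⊆ Metric.ball y₀ ρ)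
    (hder : ∀ x, ‖fderiv ℝ ψ x‖ ≤ A / ρ ^ (n + 1)) {x' : Rn n} (hx' : dist y₀ x' < P.b * ρ) :
    ‖∫ u, f u * ψ u‖ₑ ≤ ENNReal.ofReal (A / P.c) * grandMaximal P f x' := by
  have hc := P.c_pos
  set s : ℝ := ρ ^ n * (P.c / A) with hs
  have hs0 : 0 < s := by positivity
  set φ : Rn n → ℂ := fun v => s • ψ (y₀ - ρ • v) with hφ
  have hmem : φ ∈ testFunctions n P := by
    refine ⟨by fun_prop, ?_, fun v => ?_⟩
    · have hsub : tsupport φ ⊆ (fun v : Rn n => y₀ - ρ • v) ⁻¹' tsupport ψ := by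
        refine closure_minimal (fun v hv => subset_tsupport ψ ?_)
          ((isClosed_tsupport ψ).preimage (by fun_prop))
        intro h0
        apply hv
        simp [hφ, h0]
      intro v hv
      have h1 := hsupp (hsub hv)
      rw [Metric.mem_ball, dist_eq_norm, sub_sub_cancel_left, norm_neg, norm_smul,
        Real.norm_of_nonneg hρ.le] at h1
      rw [mem_ball_zero_iff]
      nlinarith
    · have h2 : HasFDerivAt (fun v : Rn n => y₀ - ρ • v)
          (-(ρ • ContinuousLinearMap.id ℝ (Rn n))) v :=
        ((hasFDerivAt_id v).const_smul ρ).const_sub y₀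
      have h3 := (((hψ.differentiable (by simp) (y₀ - ρ • v)).hasFDerivAt.comp v h2).const_smul s)
      have h4 : HasFDerivAt φ _ v := h3
      rw [h4.fderiv]
      have h5 : ‖(-(ρ • ContinuousLinearMap.id ℝ (Rn n)))‖ ≤ ρ := by
        rw [norm_neg, norm_smul, Real.norm_of_nonneg hρ.le]
        exact mul_le_of_le_one_right hρ.le ContinuousLinearMap.norm_id_le
      calc _ ≤ s * (A / ρ ^ (n + 1) * ρ) := by
            rw [norm_smul, Real.norm_of_nonneg hs0.le]
            gcongr
            exact (ContinuousLinearMap.opNorm_comp_le _ _).trans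
              (mul_le_mul (hder _) h5 (norm_nonneg _) (by positivity))
        _ = P.c := by rw [hs, pow_succ]; field_simp
  have h1 := le_grandMaximal f hmem hρ hx'
  have h2 : convDilate f φ ρ y₀ = ((P.c / A : ℝ) : ℂ) * ∫ u, f u * ψ u := by
    rw [convDilate_eq_integral, ← integral_const_mul]
    refine integral_congr_ae (Eventually.of_forall fun u => ?_)
    have : y₀ - ρ • ρ⁻¹ • (y₀ - u) = u := by
      rw [smul_smul, mul_inv_cancel₀ hρ.ne', one_smul, sub_sub_cancel]
    have h3 : (ρ ^ n)⁻¹ * s = P.c / A := by rw [hs]; field_simp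
    change f u * ((ρ ^ n)⁻¹ • (s • ψ (y₀ - ρ • ρ⁻¹ • (y₀ - u)))) = _
    rw [this, smul_smul, h3, Complex.real_smul]
    ring
  rw [h2, enorm_mul] at h1
  have h3 : ‖((P.c / A : ℝ) : ℂ)‖ₑ = ENNReal.ofReal (P.c / A) := by
    rw [← ofReal_norm, Complex.norm_of_nonneg (by positivity)]
  have h4 : ENNReal.ofReal (A / P.c) * ENNReal.ofReal (P.c / A) = 1 := by
    rw [← ENNReal.ofReal_mul (by positivity), ← ENNReal.ofReal_one]
    congr 1
    field_simp
  calc ‖∫ u, f u * ψ u‖ₑ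
      = ENNReal.ofReal (A / P.c) * (ENNReal.ofReal (P.c / A) * ‖∫ u, f u * ψ u‖ₑ) := by
        rw [← mul_assoc, h4, one_mul]
    _ ≤ _ := by rw [← h3]; gcongr

/-- The grand maximal function is countably subadditive. -/
theorem grandMaximal_tsum_le (hn : 0 < n) {ι : Type*} [Countable ι] {a : ι → Rn n → ℂ}
    {u : Rn n → ℂ} (ha : ∀ i, AEStronglyMeasurable (a i) volume)
    (hsum : ∑' i, ∫⁻ x, ‖a i x‖ₑ ≠ ⊤) (hu : u =ᵐ[volume] fun x => ∑' i, a i x) (x : Rn n) :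
    grandMaximal P u x ≤ ∑' i, grandMaximal P (a i) x := by
  refine grandMaximal_le fun φ hφ t ht y hy => ?_
  have h1 : convDilate u φ t y = ∑' i, convDilate (a i) φ t y := by
    rw [convDilate_congr hu]
    simp only [convDilate_eq_integral]
    rw [← integral_tsum]
    · simp_rw [tsum_mul_right]
    · intro i
      exact (ha i).mul ((contDiff_testKernel hφ t y).continuous.aestronglyMeasurable)
    · have h2 : ∀ i, ∫⁻ v, ‖a i v * dilate φ t (y - v)‖ₑ
          ≤ ENNReal.ofReal (2 * P.c / t ^ n) * ∫⁻ v, ‖a i v‖ₑ := by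
        intro i
        rw [← lintegral_const_mul'' _ (ha i).enorm]
        refine lintegral_mono fun v => ?_
        rw [enorm_mul, mul_comm]
        gcongr
        rw [← ofReal_norm]
        exact ENNReal.ofReal_le_ofReal (norm_testKernel_le hn hφ ht y v)
      refine ((ENNReal.tsum_le_tsum h2).trans_lt ?_).ne
      rw [ENNReal.tsum_mul_left]
      exact ENNReal.mul_lt_top ENNReal.ofReal_lt_top (lt_top_iff_ne_top.2 hsum)
  rw [h1]
  exact (enorm_tsum_le_tsum_enorm).trans
    (ENNReal.tsum_le_tsum fun i => le_grandMaximal (a i) hφ ht hy)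

end TestFunctions

/-! ### Atoms -/

section Atoms

variable {n : ℕ} {P : MaximalParams}

/-- The weight `(1 + |x - x₀| / ρ)^{-(n+1)}`, which governs the decay of the grand maximal function
of a function with mean zero supported in `B(x₀, ρ)`. -/
noncomputable def decayWeight (x₀ : Rn n) (ρ : ℝ) (x : Rn n) : ℝ :=
  ((1 + dist x x₀ / ρ) ^ (n + 1))⁻¹

theorem decayWeight_nonneg (x₀ : Rn n) {ρ : ℝ} (hρ : 0 < ρ) (x : Rn n) :
    0 ≤ decayWeight x₀ ρ x := by
  unfold decayWeight
  positivity

theorem measurable_decayWeight (x₀ : Rn n) (ρ : ℝ) : Measurable (decayWeight x₀ ρ) := by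
  unfold decayWeight
  fun_prop

theorem lintegral_decayWeight (n : ℕ) : ∃ W : ℝ≥0∞, W ≠ ⊤ ∧ ∀ (x₀ : Rn n) (ρ : ℝ), 0 < ρ →
    ∫⁻ x, ENNReal.ofReal (decayWeight x₀ ρ x) = ENNReal.ofReal (ρ ^ n) * W := by
  refine ⟨∫⁻ x : Rn n, ENNReal.ofReal (decayWeight 0 1 x), ?_, fun x₀ ρ hρ => ?_⟩
  · have h := finite_integral_one_add_norm (E := Rn n) (μ := volume) (r := n + 1) (by simp)
    refine (lt_of_le_of_lt (lintegral_mono fun x => ?_) h).ne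
    refine ENNReal.ofReal_le_ofReal (le_of_eq ?_)
    rw [decayWeight, Real.rpow_neg (by positivity), div_one, dist_zero_right,
      ← Nat.cast_add_one, Real.rpow_natCast]
  · set G : Rn n → ℝ≥0∞ := fun x => ENNReal.ofReal (decayWeight 0 1 x) with hG
    have hGm : Measurable G := (measurable_decayWeight 0 1).ennreal_ofReal
    have h1 : ∀ x, ENNReal.ofReal (decayWeight x₀ ρ x) = G (ρ⁻¹ • (x - x₀)) := by
      intro x
      simp only [hG, decayWeight, div_one, dist_eq_norm, sub_zero]
      rw [norm_smul, norm_inv, Real.norm_of_nonneg hρ.le, inv_mul_eq_div]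
    simp_rw [h1]
    rw [lintegral_sub_right_eq_self (fun x => G (ρ⁻¹ • x)),
      ← lintegral_map (f := G) (g := fun x => ρ⁻¹ • x) hGm (by fun_prop),
      Measure.map_addHaar_smul _ (inv_ne_zero hρ.ne'), lintegral_smul_measure]
    simp [abs_of_pos hρ]

theorem one_le_decayWeight {x₀ x : Rn n} {ρ : ℝ} (hρ : 0 < ρ) (h : dist x x₀ ≤ 2 * ρ) :
    1 ≤ 3 ^ (n + 1) * decayWeight x₀ ρ x := by
  rw [decayWeight, ← div_eq_mul_inv, one_le_div (by positivity)]
  gcongr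
  have : dist x x₀ / ρ ≤ 2 := by rwa [div_le_iff₀ hρ]
  linarith

theorem div_pow_le_decayWeight {x₀ x : Rn n} {ρ t : ℝ} (hρ : 0 < ρ) (ht : 0 < t)
    (h : 2 * ρ ≤ dist x x₀) (h' : dist x x₀ ≤ 2 * (P.b + 1) * t) :
    (ρ / t) ^ (n + 1) ≤ (3 * (P.b + 1)) ^ (n + 1) * decayWeight x₀ ρ x := by
  rw [decayWeight, ← div_eq_mul_inv, ← div_pow]
  have hb := P.one_lt_b
  refine pow_le_pow_left₀ (by positivity) ?_ _
  rw [div_le_div_iff₀ ht (by positivity), mul_add, mul_div_cancel₀ _ hρ.ne']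
  linarith

/-- Far from its support, a function only sees test functions of large scale. -/
theorem dist_le_of_testKernel_ne_zero {φ : Rn n → ℂ} (h : φ ∈ testFunctions n P) {t ρ : ℝ}
    (ht : 0 < t) {x x₀ y u : Rn n} (hy : dist y x < P.b * t) (hu : dist u x₀ ≤ ρ)
    (hx : 2 * ρ ≤ dist x x₀) (hne : testKernel φ t y u ≠ 0) :
    dist x x₀ ≤ 2 * (P.b + 1) * t := by
  have h1 : dist u y < t := support_testKernel_subset h ht y (subset_tsupport _ hne)
  have h2 := dist_triangle4 x y u x₀
  rw [dist_comm x y, dist_comm y u] at h2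
  linarith

theorem norm_testKernel_sub_le {φ : Rn n → ℂ} (h : φ ∈ testFunctions n P) {t : ℝ}
    (ht : 0 < t) (y u v : Rn n) :
    ‖testKernel φ t y u - testKernel φ t y v‖ ≤ P.c / t ^ (n + 1) * dist u v := by
  rw [dist_eq_norm]
  exact Convex.norm_image_sub_le_of_norm_fderiv_le (𝕜 := ℝ) (s := univ)
    (fun z _ => (contDiff_testKernel h t y).differentiable (by simp) z)
    (fun z _ => norm_fderiv_testKernel_le h ht y z) convex_univ (mem_univ v) (mem_univ u)

theorem norm_integral_le_of_support_closedBall {g : Rn n → ℂ} {B ρ : ℝ} {x₀ : Rn n} (hρ : 0 < ρ)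
    (hB : ∀ᵐ u, ‖g u‖ ≤ B) (hg : ∀ u, u ∉ Metric.closedBall x₀ ρ → g u = 0) :
    ‖∫ u, g u‖ ≤ B * (ρ ^ n * (volume (Metric.ball (0 : Rn n) 1)).toReal) := by
  rw [← setIntegral_eq_integral_of_forall_compl_eq_zero hg]
  refine (norm_setIntegral_le_of_norm_le_const_ae measure_closedBall_lt_top
    (ae_restrict_of_ae hB)).trans (le_of_eq ?_)
  rw [measureReal_def, Measure.addHaar_closedBall _ _ hρ.le, ENNReal.toReal_mul,
    ENNReal.toReal_ofReal (by positivity), finrank_euclideanSpace_fin]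

theorem norm_integral_mul_testKernel_le (hn : 0 < n) {a φ : Rn n → ℂ} {A : ℝ} (hA : 0 ≤ A)
    (ha : ∀ᵐ u, ‖a u‖ ≤ A) (h : φ ∈ testFunctions n P) {t : ℝ} (ht : 0 < t) (y : Rn n) :
    ‖∫ u, a u * testKernel φ t y u‖
      ≤ A * (2 * P.c * (volume (Metric.ball (0 : Rn n) 1)).toReal) := by
  have h1 : ∀ᵐ u, ‖a u * testKernel φ t y u‖ ≤ A * (2 * P.c / t ^ n) := by
    filter_upwards [ha] with u hu
    rw [norm_mul]
    exact mul_le_mul hu (norm_testKernel_le hn h ht y u) (norm_nonneg _) hA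
  refine (norm_integral_le_of_support_closedBall ht h1 (x₀ := y) fun u hu => ?_).trans
    (le_of_eq (by field_simp))
  rw [image_eq_zero_of_notMem_tsupport fun hm =>
    hu (Metric.ball_subset_closedBall (support_testKernel_subset h ht y hm)), mul_zero]

/-- A bounded function is dominated by its sup bound under the grand maximal function. -/
theorem grandMaximal_le_of_bound (hn : 0 < n) {a : Rn n → ℂ} {A : ℝ} (hA : 0 ≤ A)
    (ha : ∀ᵐ u, ‖a u‖ ≤ A) (x : Rn n) : grandMaximal P a x
      ≤ ENNReal.ofReal (A * (2 * P.c * (volume (Metric.ball (0 : Rn n) 1)).toReal)) := by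
  refine grandMaximal_le fun φ hφ t ht y _ => ?_
  rw [← ofReal_norm]
  exact ENNReal.ofReal_le_ofReal (norm_integral_mul_testKernel_le hn hA ha hφ ht y)

/-- **Atoms lie in the Hardy space.** A bounded function with mean zero supported in a ball of
radius `ρ` has `H¹` norm at most a constant times `ρⁿ` times its sup norm. -/
theorem exists_lintegral_grandMaximal_atom_le (hn : 0 < n) (P : MaximalParams) :
    ∃ C : ℝ≥0∞, C ≠ ⊤ ∧ ∀ (a : Rn n → ℂ) (x₀ : Rn n) (ρ A : ℝ), 0 < ρ → 0 ≤ A →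
      AEStronglyMeasurable a volume → (∀ᵐ u, ‖a u‖ ≤ A) →
      (∀ u, u ∉ Metric.closedBall x₀ ρ → a u = 0) → ∫ u, a u = 0 →
      ∫⁻ x, grandMaximal P a x ≤ C * ENNReal.ofReal (A * ρ ^ n) := by
  obtain ⟨W, hW, hWi⟩ := lintegral_decayWeight n
  have hc := P.c_pos
  have hb := P.one_lt_b
  set v : ℝ := (volume (Metric.ball (0 : Rn n) 1)).toReal with hv
  have hv0 : 0 ≤ v := ENNReal.toReal_nonneg
  set K : ℝ := 2 * P.c * v * (3 * (P.b + 1)) ^ (n + 1) with hK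
  have hK0 : 0 ≤ K := by positivity
  refine ⟨ENNReal.ofReal K * W, ENNReal.mul_ne_top ENNReal.ofReal_ne_top hW,
    fun a x₀ ρ A hρ hA ham ha hsupp hmean => ?_⟩
  have hpt : ∀ x, grandMaximal P a x ≤ ENNReal.ofReal (A * K * decayWeight x₀ ρ x) := by
    intro x
    have hw := decayWeight_nonneg x₀ hρ x
    -- near the support the sup bound suffices; far away the mean zero property yields the decay
    rcases le_total (dist x x₀) (2 * ρ) with hx | hx
    · refine (grandMaximal_le_of_bound hn hA ha x).trans (ENNReal.ofReal_le_ofReal ?_)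
      have h1 : 1 ≤ (3 * (P.b + 1)) ^ (n + 1) * decayWeight x₀ ρ x := by
        refine (one_le_decayWeight hρ hx).trans ?_
        gcongr
        linarith
      calc A * (2 * P.c * v) = A * (2 * P.c * v) * 1 := by ring
        _ ≤ A * (2 * P.c * v) * ((3 * (P.b + 1)) ^ (n + 1) * decayWeight x₀ ρ x) := by gcongr
        _ = A * K * decayWeight x₀ ρ x := by rw [hK]; ring
    · refine grandMaximal_le fun φ hφ t ht y hy => ?_
      rw [← ofReal_norm]
      refine ENNReal.ofReal_le_ofReal ?_
      by_cases hne : ∃ u, dist u x₀ ≤ ρ ∧ testKernel φ t y u ≠ 0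
      · obtain ⟨u₀, hu₀, hne⟩ := hne
        have hfar := dist_le_of_testKernel_ne_zero hφ ht hy hu₀ hx hne
        have hai : Integrable a := by
          rw [← integrableOn_iff_integrable_of_support_subset (s := Metric.closedBall x₀ ρ)
            (fun u hu => by_contra fun h => hu (hsupp u h))]
          exact Measure.integrableOn_of_bounded measure_closedBall_lt_top.ne ham
            (ae_restrict_of_ae ha)
        -- subtract the value of the kernel at the centre, using that `a` has mean zero
        have h1 : convDilate a φ t y
            = ∫ u, a u * (testKernel φ t y u - testKernel φ t y x₀) := by
          simp_rw [mul_sub]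
          rw [integral_sub (integrable_mul_testKernel hai.locallyIntegrable hφ ht y)
            (hai.mul_const _), integral_mul_const, hmean, zero_mul, sub_zero]
          rfl
        have h2 : ∀ᵐ u, ‖a u * (testKernel φ t y u - testKernel φ t y x₀)‖
            ≤ A * (P.c / t ^ (n + 1) * ρ) := by
          filter_upwards [ha] with u hu
          by_cases hmem : u ∈ Metric.closedBall x₀ ρ
          · rw [norm_mul]
            refine mul_le_mul hu ((norm_testKernel_sub_le hφ ht y u x₀).trans ?_)
              (norm_nonneg _) hA
            gcongr
            exact hmem
          · rw [hsupp u hmem, zero_mul, norm_zero]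
            positivity
        rw [h1]
        refine (norm_integral_le_of_support_closedBall hρ h2 (x₀ := x₀) fun u hu => by
          rw [hsupp u hu, zero_mul]).trans ?_
        calc A * (P.c / t ^ (n + 1) * ρ) * (ρ ^ n * v)
            = A * (P.c * v) * (ρ / t) ^ (n + 1) := by rw [div_pow]; ring
          _ ≤ A * (P.c * v) * ((3 * (P.b + 1)) ^ (n + 1) * decayWeight x₀ ρ x) := by
            gcongr
            exact div_pow_le_decayWeight hρ ht hx hfar
          _ ≤ A * K * decayWeight x₀ ρ x := by
            have : 0 ≤ A * (P.c * v) * ((3 * (P.b + 1)) ^ (n + 1) * decayWeight x₀ ρ x) := by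
              positivity
            rw [hK]
            linarith
      · push Not at hne
        have h1 : convDilate a φ t y = 0 := by
          rw [convDilate_eq_integral]
          refine integral_eq_zero_of_ae (Eventually.of_forall fun u => ?_)
          by_cases hmem : u ∈ Metric.closedBall x₀ ρ
          · have := hne u hmem
            rw [testKernel] at this
            simp [this]
          · simp [hsupp u hmem]
        rw [h1, norm_zero]
        positivity
  calc ∫⁻ x, grandMaximal P a x
      ≤ ∫⁻ x, ENNReal.ofReal (A * K) * ENNReal.ofReal (decayWeight x₀ ρ x) :=
        lintegral_mono fun x => (hpt x).trans_eq (ENNReal.ofReal_mul (by positivity))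
    _ = ENNReal.ofReal (A * K) * (ENNReal.ofReal (ρ ^ n) * W) := by
        rw [lintegral_const_mul _ (measurable_decayWeight x₀ ρ).ennreal_ofReal, hWi x₀ ρ hρ]
    _ = _ := by
        rw [ENNReal.ofReal_mul hA, ENNReal.ofReal_mul hA]
        ring

end Atoms

/-! ### Truncation to a ball -/

section Truncation

variable {n : ℕ} {P : MaximalParams}

/-- `χ` is a smooth cutoff at scale `R`: it lives in `B(0, R)`, equals one on `B(0, R / 2)` and has
gradient at most `K / R`. -/
structure IsCutoff (K R : ℝ) (χ : Rn n → ℝ) : Prop where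
  contDiff : ContDiff ℝ ∞ χ
  tsupport_subset : tsupport χ ⊆ Metric.ball 0 R
  nonneg : ∀ x, 0 ≤ χ x
  le_one : ∀ x, χ x ≤ 1
  eq_one : ∀ x ∈ Metric.closedBall (0 : Rn n) (R / 2), χ x = 1
  norm_fderiv_le : ∀ x, ‖fderiv ℝ χ x‖ ≤ K / R

theorem exists_isCutoff (n : ℕ) :
    ∃ K : ℝ, 0 < K ∧ ∀ R : ℝ, 0 < R → ∃ χ : Rn n → ℝ, IsCutoff K R χ := by
  let χ₁ : ContDiffBump (0 : Rn n) := ⟨1 / 2, 3 / 4, by norm_num, by norm_num⟩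
  obtain ⟨K, hK⟩ := (χ₁.hasCompactSupport.fderiv (𝕜 := ℝ)).exists_bound_of_continuous
    (χ₁.contDiff.continuous_fderiv (n := ∞) (by simp))
  refine ⟨|K| + 1, by positivity, fun R hR => ⟨fun x => χ₁ (R⁻¹ • x), ?_, ?_, fun x => χ₁.nonneg,
    fun x => χ₁.le_one, fun x hx => ?_, fun x => ?_⟩⟩
  · exact χ₁.contDiff.comp (contDiff_id.const_smul R⁻¹)
  · have hsub : tsupport (fun x => χ₁ (R⁻¹ • x)) ⊆ (fun v : Rn n => R⁻¹ • v) ⁻¹' tsupport χ₁ := by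
      refine closure_minimal (fun v hv => subset_tsupport χ₁ hv)
        ((isClosed_tsupport χ₁).preimage (by fun_prop))
    intro v hv
    have h1 := hsub hv
    rw [mem_preimage, χ₁.tsupport_eq, mem_closedBall_zero_iff, norm_smul, norm_inv,
      Real.norm_of_nonneg hR.le, inv_mul_le_iff₀ hR] at h1
    rw [mem_ball_zero_iff]
    change _ ≤ R * (3 / 4) at h1
    linarith
  · refine χ₁.one_of_mem_closedBall ?_
    rw [mem_closedBall_zero_iff] at hx ⊢
    rw [norm_smul, norm_inv, Real.norm_of_nonneg hR.le, inv_mul_le_iff₀ hR]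
    change _ ≤ R * (1 / 2)
    linarith
  · have h2 : HasFDerivAt (fun v : Rn n => R⁻¹ • v) (R⁻¹ • ContinuousLinearMap.id ℝ (Rn n)) x :=
      (hasFDerivAt_id x).const_smul R⁻¹
    have h3 := ((χ₁.contDiff (n := 1)).differentiable (by simp) (R⁻¹ • x)).hasFDerivAt.comp x h2
    have h4 : HasFDerivAt (fun x => χ₁ (R⁻¹ • x)) _ x := h3
    rw [h4.fderiv]
    have h5 : ‖(R⁻¹ • ContinuousLinearMap.id ℝ (Rn n))‖ ≤ R⁻¹ := by
      rw [norm_smul, Real.norm_of_nonneg (by positivity)]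
      exact mul_le_of_le_one_right (by positivity) ContinuousLinearMap.norm_id_le
    refine (ContinuousLinearMap.opNorm_comp_le _ _).trans ?_
    rw [div_eq_mul_inv]
    exact mul_le_mul ((hK _).trans (by linarith [le_abs_self K])) h5 (norm_nonneg _) (by positivity)

/-- The mean of `f` with respect to the weight `χ`. -/
noncomputable def cutoffMean (χ : Rn n → ℝ) (f : Rn n → ℂ) : ℂ :=
  (∫ u, f u * χ u) / (∫ u, χ u : ℝ)

/-- The truncation `χ (f - c)` of `f`, with the constant `c` chosen to make its mean zero. -/
noncomputable def truncate (χ : Rn n → ℝ) (f : Rn n → ℂ) (u : Rn n) : ℂ :=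
  χ u * (f u - cutoffMean χ f)

namespace IsCutoff

variable {K R : ℝ} {χ : Rn n → ℝ}

theorem eq_zero (h : IsCutoff K R χ) {u : Rn n} (hu : u ∉ Metric.ball 0 R) : χ u = 0 :=
  image_eq_zero_of_notMem_tsupport fun hm => hu (h.tsupport_subset hm)

theorem hasCompactSupport (h : IsCutoff K R χ) : HasCompactSupport χ :=
  HasCompactSupport.of_support_subset_isCompact (isCompact_closedBall (0 : Rn n) R)
    ((subset_tsupport χ).trans (h.tsupport_subset.trans Metric.ball_subset_closedBall))

theorem norm_le_one (h : IsCutoff K R χ) (u : Rn n) : ‖(χ u : ℂ)‖ ≤ 1 := by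
  rw [Complex.norm_of_nonneg (h.nonneg u)]
  exact h.le_one u

theorem contDiff_ofReal (h : IsCutoff K R χ) : ContDiff ℝ ∞ fun u => (χ u : ℂ) :=
  Complex.ofRealCLM.contDiff.comp h.contDiff

theorem integrable_mul (h : IsCutoff K R χ) {f g : Rn n → ℂ} (hf : LocallyIntegrable f)
    (hg : Continuous g) : Integrable fun u => f u * (χ u * g u) := by
  have h1 : HasCompactSupport fun u => (χ u : ℂ) * g u :=
    (h.hasCompactSupport.comp_left (g := ((↑) : ℝ → ℂ)) Complex.ofReal_zero).mul_right
  have h2 := hf.integrable_smul_left_of_hasCompactSupport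
    (h.contDiff_ofReal.continuous.mul hg) h1
  refine h2.congr (Eventually.of_forall fun u => ?_)
  simp only [smul_eq_mul, Pi.mul_apply]
  ring

theorem integral_pos (h : IsCutoff K R χ) (hR : 0 < R) :
    (R / 2) ^ n * (volume (Metric.ball (0 : Rn n) 1)).toReal ≤ ∫ u, χ u := by
  have h1 : Integrable χ := h.contDiff.continuous.integrable_of_hasCompactSupport
    h.hasCompactSupport
  calc _ = ∫ u in Metric.closedBall (0 : Rn n) (R / 2), (1 : ℝ) := by
        rw [setIntegral_const, smul_eq_mul, mul_one, measureReal_def,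
          Measure.addHaar_closedBall _ _ (by positivity), ENNReal.toReal_mul,
          ENNReal.toReal_ofReal (by positivity), finrank_euclideanSpace_fin]
    _ = ∫ u in Metric.closedBall (0 : Rn n) (R / 2), χ u :=
        setIntegral_congr_fun measurableSet_closedBall fun u hu => (h.eq_one u hu).symm
    _ ≤ ∫ u, χ u := setIntegral_le_integral h1 (Eventually.of_forall h.nonneg)

theorem norm_fderiv_mul_le (h : IsCutoff K R χ) (hK : 0 ≤ K) (hR : 0 < R) {g : Rn n → ℂ}
    (hg : ContDiff ℝ ∞ g) {B B' : ℝ} (hB0 : 0 ≤ B) (hB0' : 0 ≤ B')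
    (hB : ∀ u ∈ Metric.ball (0 : Rn n) R, ‖g u‖ ≤ B)
    (hB' : ∀ u ∈ Metric.ball (0 : Rn n) R, ‖fderiv ℝ g u‖ ≤ B') (u : Rn n) :
    ‖fderiv ℝ (fun u => (χ u : ℂ) * g u) u‖ ≤ B' + K / R * B := by
  by_cases hu : u ∈ tsupport χ
  · have hu' := h.tsupport_subset hu
    have h1 : (fun u => (χ u : ℂ) * g u) = fun u => χ u • g u := by
      ext u
      rw [Complex.real_smul]
    rw [h1, fderiv_fun_smul (h.contDiff.differentiable (by simp) u) (hg.differentiable (by simp) u)]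
    refine (norm_add_le _ _).trans (add_le_add ?_ ?_)
    · rw [norm_smul, Real.norm_of_nonneg (h.nonneg u)]
      calc χ u * ‖fderiv ℝ g u‖ ≤ 1 * B' :=
            mul_le_mul (h.le_one u) (hB' u hu') (norm_nonneg _) zero_le_one
        _ = B' := one_mul _
    · rw [ContinuousLinearMap.norm_smulRight_apply]
      exact mul_le_mul (h.norm_fderiv_le u) (hB u hu') (norm_nonneg _) (by positivity)
  · have h1 : fderiv ℝ (fun u => (χ u : ℂ) * g u) u = 0 := by
      have h2 : (fun u => (χ u : ℂ) * g u) =ᶠ[𝓝 u] fun _ => 0 := by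
        filter_upwards [(isClosed_tsupport χ).isOpen_compl.mem_nhds hu] with v hv
        rw [image_eq_zero_of_notMem_tsupport hv]
        simp
      rw [h2.fderiv_eq]
      simp
    rw [h1, norm_zero]
    positivity

theorem contDiff_mul (h : IsCutoff K R χ) {g : Rn n → ℂ} (hg : ContDiff ℝ ∞ g) :
    ContDiff ℝ ∞ fun u => (χ u : ℂ) * g u :=
  h.contDiff_ofReal.mul hg

/-- Pairing `f` with a smooth function cut off at scale `R` is controlled by the grand maximal
function of `f` at every point of `B(0, R)`. -/
theorem enorm_integral_mul_le (h : IsCutoff K R χ) (hK : 0 ≤ K) (hR : 0 < R) (f : Rn n → ℂ)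
    {g : Rn n → ℂ} (hg : ContDiff ℝ ∞ g) {B B' : ℝ} (hB0 : 0 ≤ B) (hB0' : 0 < B')
    (hB : ∀ u ∈ Metric.ball (0 : Rn n) R, ‖g u‖ ≤ B)
    (hB' : ∀ u ∈ Metric.ball (0 : Rn n) R, ‖fderiv ℝ g u‖ ≤ B') {x' : Rn n} (hx' : ‖x'‖ < R) :
    ‖∫ u, f u * (χ u * g u)‖ₑ
      ≤ ENNReal.ofReal (R ^ (n + 1) * (B' + K / R * B) / P.c) * grandMaximal P f x' := by
  refine enorm_integral_mul_le_grandMaximal f (h.contDiff_mul hg) (y₀ := 0) hR (by positivity)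
    ?_ (fun u => ?_) ?_
  · refine (closure_mono fun u hu => ?_).trans h.tsupport_subset
    intro h0
    exact hu (by simp [h0])
  · rw [mul_div_cancel_left₀ _ (by positivity)]
    exact h.norm_fderiv_mul_le hK hR hg hB0 hB0'.le hB hB' u
  · rw [dist_zero_left]
    nlinarith [P.one_lt_b]

/-- The weighted mean is a pairing of `f` with a normalized bump at scale `R`. -/
theorem enorm_cutoffMean_le (h : IsCutoff K R χ) (hK : 0 < K) (hR : 0 < R)
    (f : Rn n → ℂ) {x' : Rn n} (hx' : ‖x'‖ < R) :
    ‖cutoffMean χ f‖ₑ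
      ≤ ENNReal.ofReal (2 ^ (n + 1) * K / (P.c * (volume (Metric.ball (0 : Rn n) 1)).toReal))
        * grandMaximal P f x' := by
  have hc := P.c_pos
  set v : ℝ := (volume (Metric.ball (0 : Rn n) 1)).toReal with hv
  have hv0 : 0 < v := ENNReal.toReal_pos (Metric.measure_ball_pos _ _ one_pos).ne'
    measure_ball_lt_top.ne
  have h1 := h.enorm_integral_mul_le (P := P) hK.le hR f (g := fun _ => 1) contDiff_const (B := 1)
    (B' := K / R) zero_le_one (by positivity) (by simp)
    (fun u _ => by simpa using (by positivity : 0 ≤ K / R)) hx'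
  simp only [mul_one] at h1
  have h2 := h.integral_pos hR
  have h3 : 0 < ∫ u, χ u := lt_of_lt_of_le (by positivity) h2
  rw [cutoffMean, div_eq_mul_inv, enorm_mul]
  have h4 : ‖((∫ u, χ u : ℝ) : ℂ)⁻¹‖ₑ ≤ ENNReal.ofReal ((R / 2) ^ n * v)⁻¹ := by
    rw [← ofReal_norm, norm_inv, Complex.norm_of_nonneg h3.le]
    exact ENNReal.ofReal_le_ofReal (inv_anti₀ (by positivity) h2)
  calc _ ≤ ENNReal.ofReal (R ^ (n + 1) * (K / R + K / R) / P.c) * grandMaximal P f x'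
        * ENNReal.ofReal ((R / 2) ^ n * v)⁻¹ := mul_le_mul' h1 h4
    _ = ENNReal.ofReal (R ^ (n + 1) * (K / R + K / R) / P.c * ((R / 2) ^ n * v)⁻¹)
        * grandMaximal P f x' := by
        rw [ENNReal.ofReal_mul (by positivity)]
        ring
    _ = _ := by
        congr 2
        rw [div_pow]
        field_simp
        ring

theorem integral_truncate (h : IsCutoff K R χ) (hR : 0 < R) {f : Rn n → ℂ}
    (hf : LocallyIntegrable f) : ∫ u, truncate χ f u = 0 := by
  have hv0 : 0 < (volume (Metric.ball (0 : Rn n) 1)).toReal :=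
    ENNReal.toReal_pos (Metric.measure_ball_pos _ _ one_pos).ne' measure_ball_lt_top.ne
  have h3 : 0 < ∫ u, χ u := lt_of_lt_of_le (by positivity) (h.integral_pos hR)
  have h1 := h.integrable_mul hf (g := fun _ => 1) continuous_const
  have h2 := h.integrable_mul (f := fun _ => cutoffMean χ f) (g := fun _ => 1)
    (locallyIntegrable_const _) continuous_const
  simp only [mul_one] at h1 h2
  have h4 : ∀ u, truncate χ f u = f u * χ u - cutoffMean χ f * χ u := fun u => by
    rw [truncate]
    ring
  simp_rw [h4]
  have h5 : ∫ u, (χ u : ℂ) = ((∫ u, χ u : ℝ) : ℂ) := integral_ofReal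
  rw [integral_sub h1 h2, integral_const_mul, h5, cutoffMean, div_mul_cancel₀,
    sub_self]
  exact_mod_cast h3.ne'

/-- The pairing of the truncation with `g`, in terms of a pairing of `f` with a cut off function. -/
theorem integral_truncate_mul (h : IsCutoff K R χ) {f : Rn n → ℂ} (hf : LocallyIntegrable f)
    {g : Rn n → ℂ} (hg : Continuous g) : Integrable (fun u => truncate χ f u * g u) ∧
      ∫ u, truncate χ f u * g u
        = (∫ u, f u * (χ u * g u)) - ∫ u, cutoffMean χ f * χ u * g u := by
  have h1 := h.integrable_mul hf hg
  have h2 := h.integrable_mul (f := fun _ => cutoffMean χ f) (locallyIntegrable_const _) hg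
  simp only [← mul_assoc] at h2
  have h3 : (fun u => truncate χ f u * g u)
      = fun u => f u * (χ u * g u) - cutoffMean χ f * χ u * g u := by
    ext u
    rw [truncate]
    ring
  rw [h3]
  exact ⟨h1.sub h2, integral_sub h1 h2⟩

end IsCutoff

end Truncation

/-! ### The grand maximal function of a truncation -/

section TruncationBounds

variable {n : ℕ} {P : MaximalParams} {K R : ℝ} {χ : Rn n → ℝ}

namespace IsCutoff

/-- The contribution of the constant subtracted in the truncation. -/
theorem enorm_integral_mean_mul_testKernel_le (hn : 0 < n) (h : IsCutoff K R χ) (hK : 0 < K)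
    (hR : 0 < R) (f : Rn n → ℂ) {φ : Rn n → ℂ} (hφ : φ ∈ testFunctions n P) {t : ℝ} (ht : 0 < t)
    (y : Rn n) {x' : Rn n} (hx' : ‖x'‖ < R) :
    ‖∫ u, cutoffMean χ f * χ u * testKernel φ t y u‖ₑ
      ≤ ENNReal.ofReal (2 ^ (n + 2) * K) * grandMaximal P f x' := by
  have hc := P.c_pos
  set v : ℝ := (volume (Metric.ball (0 : Rn n) 1)).toReal with hv
  have hv0 : 0 < v := ENNReal.toReal_pos (Metric.measure_ball_pos _ _ one_pos).ne'
    measure_ball_lt_top.ne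
  have h1 := norm_integral_mul_testKernel_le hn (a := fun u => cutoffMean χ f * χ u)
    (norm_nonneg (cutoffMean χ f)) (Eventually.of_forall fun u => by
      rw [norm_mul]
      exact mul_le_of_le_one_right (norm_nonneg _) (h.norm_le_one u)) hφ ht y
  calc _ ≤ ENNReal.ofReal (‖cutoffMean χ f‖ * (2 * P.c * v)) := by
        rw [← ofReal_norm]
        exact ENNReal.ofReal_le_ofReal h1
    _ = ‖cutoffMean χ f‖ₑ * ENNReal.ofReal (2 * P.c * v) := by
        rw [ENNReal.ofReal_mul (norm_nonneg _), ofReal_norm]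
    _ ≤ ENNReal.ofReal (2 ^ (n + 1) * K / (P.c * v)) * grandMaximal P f x'
        * ENNReal.ofReal (2 * P.c * v) := by
        gcongr
        exact h.enorm_cutoffMean_le hK hR f hx'
    _ = ENNReal.ofReal (2 ^ (n + 1) * K / (P.c * v) * (2 * P.c * v)) * grandMaximal P f x' := by
        rw [ENNReal.ofReal_mul (p := 2 ^ (n + 1) * K / (P.c * v)) (by positivity)]
        ring
    _ = _ := by
        congr 2
        field_simp
        ring

/-- Test functions of scale at least comparable to `R` see the cut off function `χ f` as a multiple
of a single test function of scale `R`. -/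
theorem enorm_integral_cutoff_mul_testKernel_le_of_scale (hn : 0 < n) (h : IsCutoff K R χ)
    (hK : 0 < K) (hR : 0 < R) (f : Rn n → ℂ) {φ : Rn n → ℂ} (hφ : φ ∈ testFunctions n P) {t L : ℝ}
    (ht : 0 < t) (hL : 1 ≤ L) (hRt : R ≤ L * t) (y : Rn n) {x' : Rn n} (hx' : ‖x'‖ < R) :
    ‖∫ u, f u * (χ u * testKernel φ t y u)‖ₑ
      ≤ ENNReal.ofReal (L ^ (n + 1) * (1 + 2 * K)) * grandMaximal P f x' := by
  have hc := P.c_pos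
  refine (h.enorm_integral_mul_le (P := P) hK.le hR f (contDiff_testKernel hφ t y)
    (B := 2 * P.c / t ^ n) (B' := P.c / t ^ (n + 1)) (by positivity) (by positivity)
    (fun u _ => norm_testKernel_le hn hφ ht y u) (fun u _ => norm_fderiv_testKernel_le hφ ht y u)
    hx').trans ?_
  gcongr
  have h1 : R / t ≤ L := by rwa [div_le_iff₀ ht]
  calc R ^ (n + 1) * (P.c / t ^ (n + 1) + K / R * (2 * P.c / t ^ n)) / P.c
      = (R / t) ^ (n + 1) + 2 * K * (R / t) ^ n := by
        rw [div_pow, div_pow, pow_succ, pow_succ]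
        field_simp
    _ ≤ L ^ (n + 1) + 2 * K * L ^ (n + 1) := by
        have h2 : (R / t) ^ n ≤ L ^ (n + 1) :=
          (pow_le_pow_left₀ (by positivity) h1 n).trans (pow_le_pow_right₀ hL (by simp))
        gcongr
    _ = _ := by ring

/-- The product of the cutoff with a test function of scale `t ≤ R` is a multiple of a test function
of the same scale, which gives the term with `x`; larger scales give the term with `x'`. -/
theorem enorm_integral_cutoff_mul_testKernel_le (hn : 0 < n) (h : IsCutoff K R χ)
    (hK : 0 < K) (hR : 0 < R) (f : Rn n → ℂ) {φ : Rn n → ℂ} (hφ : φ ∈ testFunctions n P) {t : ℝ}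
    (ht : 0 < t) {x y : Rn n} (hy : dist y x < P.b * t) {x' : Rn n} (hx' : ‖x'‖ < R) :
    ‖∫ u, f u * (χ u * testKernel φ t y u)‖ₑ
      ≤ ENNReal.ofReal (1 + 2 * K) * (grandMaximal P f x + grandMaximal P f x') := by
  have hc := P.c_pos
  rw [mul_add]
  rcases le_total t R with htR | htR
  · refine le_trans ?_ le_self_add
    have h1 : ∀ u, ‖fderiv ℝ (fun u => (χ u : ℂ) * testKernel φ t y u) u‖
        ≤ P.c * (1 + 2 * K) / t ^ (n + 1) := by
      intro u
      refine (h.norm_fderiv_mul_le hK.le hR (contDiff_testKernel hφ t y)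
        (B := 2 * P.c / t ^ n) (B' := P.c / t ^ (n + 1)) (by positivity) (by positivity)
        (fun u _ => norm_testKernel_le hn hφ ht y u)
        (fun u _ => norm_fderiv_testKernel_le hφ ht y u) u).trans ?_
      calc P.c / t ^ (n + 1) + K / R * (2 * P.c / t ^ n)
          ≤ P.c / t ^ (n + 1) + K / t * (2 * P.c / t ^ n) := by gcongr
        _ = _ := by
            rw [pow_succ]
            field_simp
    refine (enorm_integral_mul_le_grandMaximal f (h.contDiff_mul (contDiff_testKernel hφ t y))
      ht (by positivity) ((closure_mono fun u hu => ?_).trans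
        (support_testKernel_subset hφ ht y)) h1 hy).trans_eq ?_
    · intro h0
      exact hu (by simp [h0])
    · rw [mul_div_cancel_left₀ _ hc.ne']
  · refine le_trans ?_ le_add_self
    simpa using h.enorm_integral_cutoff_mul_testKernel_le_of_scale hn hK hR f hφ ht le_rfl
      (by simpa using htR) y hx'

theorem grandMaximal_truncate_le (hn : 0 < n) (h : IsCutoff K R χ) (hK : 0 < K) (hR : 0 < R)
    {f : Rn n → ℂ} (hf : LocallyIntegrable f) (x : Rn n) {x' : Rn n} (hx' : ‖x'‖ < R) :
    grandMaximal P (truncate χ f) x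
      ≤ ENNReal.ofReal (1 + 2 * K) * (grandMaximal P f x + grandMaximal P f x')
        + ENNReal.ofReal (2 ^ (n + 2) * K) * grandMaximal P f x' := by
  refine grandMaximal_le fun φ hφ t ht y hy => ?_
  rw [convDilate_eq_integral]
  change ‖∫ u, truncate χ f u * testKernel φ t y u‖ₑ ≤ _
  rw [(h.integral_truncate_mul hf (contDiff_testKernel hφ t y).continuous).2]
  exact enorm_sub_le.trans
    (add_le_add (h.enorm_integral_cutoff_mul_testKernel_le hn hK hR f hφ ht hy hx')
      (h.enorm_integral_mean_mul_testKernel_le hn hK hR f hφ ht y hx'))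

/-- Away from its support the truncation decays like an atom, since it has mean zero. -/
theorem grandMaximal_truncate_le_of_far (h : IsCutoff K R χ) (hK : 0 < K)
    (hR : 0 < R) {f : Rn n → ℂ} (hf : LocallyIntegrable f) {x : Rn n} (hx : 2 * R ≤ ‖x‖)
    {x' : Rn n} (hx' : ‖x'‖ < R) :
    grandMaximal P (truncate χ f) x
      ≤ ENNReal.ofReal ((1 + K + 2 ^ (n + 1) * K) * (3 * (P.b + 1)) ^ (n + 1)
        * decayWeight 0 R x) * grandMaximal P f x' := by
  have hc := P.c_pos
  have hx2 : 2 * R ≤ dist x 0 := by rwa [dist_zero_right]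
  set v : ℝ := (volume (Metric.ball (0 : Rn n) 1)).toReal with hv
  have hv0 : 0 < v := ENNReal.toReal_pos (Metric.measure_ball_pos _ _ one_pos).ne'
    measure_ball_lt_top.ne
  refine grandMaximal_le fun φ hφ t ht y hy => ?_
  rw [convDilate_eq_integral]
  change ‖∫ u, truncate χ f u * testKernel φ t y u‖ₑ ≤ _
  by_cases hne : ∃ u, dist u 0 ≤ R ∧ testKernel φ t y u ≠ 0
  · obtain ⟨u₀, hu₀, hne⟩ := hne
    have hfar := div_pow_le_decayWeight hR ht hx2
      (dist_le_of_testKernel_ne_zero hφ ht hy hu₀ hx2 hne)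
    set g : Rn n → ℂ := fun u => testKernel φ t y u - testKernel φ t y 0 with hg
    have hgs : ContDiff ℝ ∞ g := (contDiff_testKernel hφ t y).sub contDiff_const
    have hgB : ∀ u ∈ Metric.ball (0 : Rn n) R, ‖g u‖ ≤ P.c / t ^ (n + 1) * R := by
      intro u hu
      refine (norm_testKernel_sub_le hφ ht y u 0).trans ?_
      gcongr
      exact (Metric.mem_ball.1 hu).le
    have hgB' : ∀ u ∈ Metric.ball (0 : Rn n) R, ‖fderiv ℝ g u‖ ≤ P.c / t ^ (n + 1) := by
      intro u _
      rw [hg, fderiv_sub_const]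
      exact norm_fderiv_testKernel_le hφ ht y u
    -- since the truncation has mean zero, a constant may be subtracted from the kernel
    have h1 : ∫ u, truncate χ f u * testKernel φ t y u = ∫ u, truncate χ f u * g u := by
      simp_rw [hg, mul_sub]
      have h2 := (h.integral_truncate_mul hf (g := fun _ => 1) continuous_const).1
      simp only [mul_one] at h2
      rw [integral_sub (h.integral_truncate_mul hf (contDiff_testKernel hφ t y).continuous).1
        (h2.mul_const _), integral_mul_const, h.integral_truncate hR hf, zero_mul, sub_zero]
    rw [h1, (h.integral_truncate_mul hf hgs.continuous).2]
    have h3 := h.enorm_integral_mul_le (P := P) hK.le hR f hgs (by positivity) (by positivity)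
      hgB hgB' hx'
    have h4 : ‖∫ u, cutoffMean χ f * χ u * g u‖
        ≤ ‖cutoffMean χ f‖ * (P.c / t ^ (n + 1) * R) * (R ^ n * v) := by
      refine norm_integral_le_of_support_closedBall hR (x₀ := 0)
        (Eventually.of_forall fun u => ?_) fun u hu => ?_
      · by_cases hu : u ∈ Metric.ball 0 R
        · rw [norm_mul, norm_mul]
          refine mul_le_mul ?_ (hgB u hu) (norm_nonneg _) (norm_nonneg _)
          exact mul_le_of_le_one_right (norm_nonneg _) (h.norm_le_one u)
        · rw [h.eq_zero hu]
          simp only [Complex.ofReal_zero, mul_zero, zero_mul, norm_zero]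
          positivity
      · rw [h.eq_zero fun hu' => hu (Metric.ball_subset_closedBall hu')]
        simp
    have h5 : ‖∫ u, cutoffMean χ f * χ u * g u‖ₑ
        ≤ ENNReal.ofReal (2 ^ (n + 1) * K * (R / t) ^ (n + 1)) * grandMaximal P f x' := by
      calc _ ≤ ENNReal.ofReal (‖cutoffMean χ f‖ * (P.c * v * (R / t) ^ (n + 1))) := by
            rw [← ofReal_norm]
            refine ENNReal.ofReal_le_ofReal (h4.trans_eq ?_)
            rw [div_pow]
            ring
        _ = ‖cutoffMean χ f‖ₑ * ENNReal.ofReal (P.c * v * (R / t) ^ (n + 1)) := by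
            rw [ENNReal.ofReal_mul (norm_nonneg _), ofReal_norm]
        _ ≤ ENNReal.ofReal (2 ^ (n + 1) * K / (P.c * v)) * grandMaximal P f x'
            * ENNReal.ofReal (P.c * v * (R / t) ^ (n + 1)) := by
            gcongr
            exact h.enorm_cutoffMean_le hK hR f hx'
        _ = ENNReal.ofReal (2 ^ (n + 1) * K / (P.c * v) * (P.c * v * (R / t) ^ (n + 1)))
            * grandMaximal P f x' := by
            rw [ENNReal.ofReal_mul (p := 2 ^ (n + 1) * K / (P.c * v)) (by positivity)]
            ring
        _ = _ := by
            congr 2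
            field_simp
    calc _ ≤ _ := enorm_sub_le
      _ ≤ _ := add_le_add h3 h5
      _ = ENNReal.ofReal ((1 + K + 2 ^ (n + 1) * K) * (R / t) ^ (n + 1))
          * grandMaximal P f x' := by
          rw [← add_mul, ← ENNReal.ofReal_add (by positivity) (by positivity)]
          congr 2
          rw [div_pow]
          field_simp
      _ ≤ _ := by
          rw [mul_assoc (1 + K + 2 ^ (n + 1) * K)]
          gcongr
  · push Not at hne
    have h1 : ∫ u, truncate χ f u * testKernel φ t y u = 0 := by
      refine integral_eq_zero_of_ae (Eventually.of_forall fun u => ?_)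
      by_cases hmem : u ∈ Metric.closedBall 0 R
      · simp [hne u hmem]
      · simp [truncate, h.eq_zero fun hu' => hmem (Metric.ball_subset_closedBall hu')]
    rw [h1, enorm_zero]
    exact zero_le

/-- Well inside the ball where `f` and its truncation differ by a constant, test functions of scale
less than a multiple of `R` only see that constant. -/
theorem grandMaximal_sub_truncate_le_of_near (hn : 0 < n) (h : IsCutoff K R χ) (hK : 0 < K)
    (hR : 0 < R) {f : Rn n → ℂ} (hf : LocallyIntegrable f) {x : Rn n} (hx : ‖x‖ < R / 4)
    {x' : Rn n} (hx' : ‖x'‖ < R) :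
    grandMaximal P (f - truncate χ f) x
      ≤ ENNReal.ofReal ((6 * (P.b + 1)) ^ (n + 1) + (4 * (P.b + 1)) ^ (n + 1) * (1 + 2 * K)
        + 2 ^ (n + 2) * K) * grandMaximal P f x' := by
  have hc := P.c_pos
  have hb := P.one_lt_b
  refine grandMaximal_le fun φ hφ t ht y hy => ?_
  have hθ := contDiff_testKernel hφ t y
  have h1 : convDilate (f - truncate χ f) φ t y
      = ((∫ u, f u * testKernel φ t y u) - ∫ u, f u * (χ u * testKernel φ t y u))
        + ∫ u, cutoffMean χ f * χ u * testKernel φ t y u := by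
    rw [sub_add, ← (h.integral_truncate_mul hf hθ.continuous).2, ← integral_sub
      (integrable_mul_testKernel hf hφ ht y) (h.integral_truncate_mul hf hθ.continuous).1]
    refine integral_congr_ae (Eventually.of_forall fun u => ?_)
    simp only [ContinuousLinearMap.mul_apply', Pi.sub_apply, testKernel]
    ring
  rw [h1, ENNReal.ofReal_add (by positivity) (by positivity), add_mul]
  refine (enorm_add_le _ _).trans (add_le_add ?_
    (h.enorm_integral_mean_mul_testKernel_le hn hK hR f hφ ht y hx'))
  have hyn : ‖y‖ < P.b * t + R / 4 := by
    have h2 := dist_triangle y x 0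
    rw [dist_zero_right, dist_zero_right] at h2
    linarith
  -- test functions of small scale are supported where the cutoff is one
  rcases le_total ((P.b + 1) * t) (R / 4) with hsmall | hlarge
  · have h2 : ∫ u, f u * testKernel φ t y u = ∫ u, f u * (χ u * testKernel φ t y u) := by
      refine integral_congr_ae (Eventually.of_forall fun u => ?_)
      by_cases hu : testKernel φ t y u = 0
      · simp [hu]
      · have h3 : dist u y < t := support_testKernel_subset hφ ht y (subset_tsupport _ hu)
        have h4 := dist_triangle u y 0
        rw [dist_zero_right, dist_zero_right] at h4
        have h5 : χ u = 1 := h.eq_one u (by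
          rw [mem_closedBall_zero_iff]
          linarith)
        simp [h5]
    rw [h2, sub_self, enorm_zero]
    exact zero_le
  · rw [ENNReal.ofReal_add (by positivity) (by positivity), add_mul]
    refine enorm_sub_le.trans (add_le_add ?_
      (h.enorm_integral_cutoff_mul_testKernel_le_of_scale hn hK hR f hφ ht (by linarith)
        (by linarith) y hx'))
    have h2 := enorm_integral_mul_le_grandMaximal (P := P) f hθ (y₀ := y)
      (ρ := 6 * (P.b + 1) * t) (A := P.c * (6 * (P.b + 1)) ^ (n + 1)) (by positivity)
      (by positivity) ((support_testKernel_subset hφ ht y).trans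
        (Metric.ball_subset_ball (by nlinarith)))
      (fun u => (norm_fderiv_testKernel_le hφ ht y u).trans_eq (by
        rw [mul_pow (6 * (P.b + 1)) t]
        field_simp)) (x' := x') (by
        have h3 := dist_triangle y 0 x'
        rw [dist_zero_right, dist_zero_left] at h3
        have h4 : 6 * (P.b + 1) * t ≤ P.b * (6 * (P.b + 1) * t) :=
          le_mul_of_one_le_left (by positivity) hb.le
        nlinarith)
    rwa [mul_div_cancel_left₀ _ hc.ne'] at h2

end IsCutoff

/-- The truncation error in `H¹`: it is controlled by the part of the grand maximal function of `f`
that lives away from the origin. -/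
theorem exists_lintegral_grandMaximal_sub_truncate_le (hn : 0 < n) (P : MaximalParams) {K : ℝ}
    (hK : 0 < K) : ∃ C : ℝ≥0∞, C ≠ ⊤ ∧ ∀ (f : Rn n → ℂ), LocallyIntegrable f →
      ∀ (R : ℝ) (χ : Rn n → ℝ), 0 < R → IsCutoff K R χ → ∀ x' : Rn n, ‖x'‖ < R →
      ∫⁻ x, grandMaximal P (f - truncate χ f) x
        ≤ C * (∫⁻ x in {x | R / 4 ≤ ‖x‖}, grandMaximal P f x)
          + C * (ENNReal.ofReal (R ^ n) * grandMaximal P f x') := by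
  obtain ⟨W, hW, hWi⟩ := lintegral_decayWeight n
  have hb := P.one_lt_b
  set a₁ : ℝ := (6 * (P.b + 1)) ^ (n + 1) + (4 * (P.b + 1)) ^ (n + 1) * (1 + 2 * K)
        + 2 ^ (n + 2) * K with ha₁
  set a₂ : ℝ := 1 + 2 * K + 2 ^ (n + 2) * K with ha₂
  set a₃ : ℝ := (1 + K + 2 ^ (n + 1) * K) * (3 * (P.b + 1)) ^ (n + 1) with ha₃
  have ha₁0 : 0 ≤ a₁ := by positivity
  have ha₂0 : 0 ≤ a₂ := by positivity
  have ha₃0 : 0 ≤ a₃ := by positivity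
  set a : ℝ := 3 ^ (n + 1) * a₁ + 3 ^ (n + 1) * a₂ + a₃ with ha
  have ha0 : 0 ≤ a := by positivity
  refine ⟨ENNReal.ofReal (1 + a₂) + ENNReal.ofReal a * W,
    ENNReal.add_ne_top.2 ⟨ENNReal.ofReal_ne_top, ENNReal.mul_ne_top ENNReal.ofReal_ne_top hW⟩,
    fun f hf R χ hR h x' hx' => ?_⟩
  set m := grandMaximal P f x' with hm
  set S : Set (Rn n) := {x | R / 4 ≤ ‖x‖} with hS
  have hSm : MeasurableSet S := measurableSet_le measurable_const measurable_norm
  have htrunc : LocallyIntegrable (truncate χ f) := by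
    have := (h.integral_truncate_mul hf (g := fun _ => 1) continuous_const).1
    simp only [mul_one] at this
    exact this.locallyIntegrable
  have hsub : ∀ x, grandMaximal P (f - truncate χ f) x
      ≤ grandMaximal P f x + grandMaximal P (truncate χ f) x := by
    intro x
    have h1 := grandMaximal_add_le P hf (htrunc.smul (-1 : ℂ)) x
    rw [grandMaximal_smul] at h1
    simpa [sub_eq_add_neg] using h1
  -- the three regions `‖x‖ < R / 4`, `R / 4 ≤ ‖x‖ < 2 * R` and `2 * R ≤ ‖x‖`
  have hpt : ∀ x, grandMaximal P (f - truncate χ f) x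
      ≤ ENNReal.ofReal (1 + a₂) * S.indicator (grandMaximal P f) x
        + ENNReal.ofReal a * ENNReal.ofReal (decayWeight 0 R x) * m := by
    intro x
    have hw := decayWeight_nonneg 0 hR x
    rw [← ENNReal.ofReal_mul ha0]
    rcases lt_or_ge ‖x‖ (R / 4) with hx | hx
    · refine le_trans (h.grandMaximal_sub_truncate_le_of_near hn hK hR hf hx hx') ?_
      refine le_trans ?_ le_add_self
      gcongr
      have h1 := one_le_decayWeight (x₀ := (0 : Rn n)) (x := x) hR (by
        rw [dist_zero_right]
        linarith)
      have h2 : a₁ * 1 ≤ a₁ * (3 ^ (n + 1) * decayWeight 0 R x) := by gcongr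
      have h3 : 0 ≤ (3 ^ (n + 1) * a₂ + a₃) * decayWeight 0 R x := by positivity
      rw [ha, ← ha₁]
      linarith
    · have hxS : x ∈ S := hx
      rw [indicator_of_mem hxS]
      refine (hsub x).trans ?_
      rcases lt_or_ge ‖x‖ (2 * R) with hx2 | hx2
      · refine (add_le_add_right (h.grandMaximal_truncate_le hn hK hR hf x hx') _).trans ?_
        have h1 := one_le_decayWeight (x₀ := (0 : Rn n)) (x := x) hR (by
          rw [dist_zero_right]
          exact hx2.le)
        have h2 : a₂ * 1 ≤ a₂ * (3 ^ (n + 1) * decayWeight 0 R x) := by gcongr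
        have h3 : 0 ≤ (3 ^ (n + 1) * a₁ + a₃) * decayWeight 0 R x := by positivity
        calc grandMaximal P f x + (ENNReal.ofReal (1 + 2 * K) * (grandMaximal P f x + m)
              + ENNReal.ofReal (2 ^ (n + 2) * K) * m)
            = (1 + ENNReal.ofReal (1 + 2 * K)) * grandMaximal P f x
              + (ENNReal.ofReal (1 + 2 * K) + ENNReal.ofReal (2 ^ (n + 2) * K)) * m := by ring
          _ ≤ ENNReal.ofReal (1 + a₂) * grandMaximal P f x
              + ENNReal.ofReal (a * decayWeight 0 R x) * m := by
              rw [← ENNReal.ofReal_one, ← ENNReal.ofReal_add (by positivity) (by positivity),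
                ← ENNReal.ofReal_add (by positivity) (by positivity)]
              gcongr
              · have : 0 ≤ 2 ^ (n + 2) * K := by positivity
                linarith
              · rw [← ha₂, ha]
                linarith
      · refine add_le_add ?_ ((h.grandMaximal_truncate_le_of_far hK hR hf hx2 hx').trans ?_)
        · refine le_mul_of_one_le_left (zero_le) ?_
          rw [← ENNReal.ofReal_one]
          exact ENNReal.ofReal_le_ofReal (by linarith)
        · gcongr
          rw [ha, ← ha₃]
          have : 0 ≤ 3 ^ (n + 1) * a₁ + 3 ^ (n + 1) * a₂ := by positivity
          linarith
  have hMm := (lowerSemicontinuous_grandMaximal P f).measurable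
  have hwm := (measurable_decayWeight (0 : Rn n) R).ennreal_ofReal
  calc _ ≤ _ := lintegral_mono hpt
    _ = ENNReal.ofReal (1 + a₂) * (∫⁻ x in S, grandMaximal P f x)
        + ENNReal.ofReal a * (ENNReal.ofReal (R ^ n) * W) * m := by
        rw [lintegral_add_left ((hMm.indicator hSm).const_mul _), lintegral_const_mul _
          (hMm.indicator hSm), lintegral_indicator hSm, lintegral_mul_const _ (hwm.const_mul _),
          lintegral_const_mul _ hwm, hWi 0 R hR]
    _ = ENNReal.ofReal (1 + a₂) * (∫⁻ x in S, grandMaximal P f x)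
        + ENNReal.ofReal a * W * (ENNReal.ofReal (R ^ n) * m) := by ring
    _ ≤ _ := by
        gcongr
        · exact le_self_add
        · exact le_add_self

end TruncationBounds

/-! ### Convergence of truncations -/

section TruncationLimit

variable {n : ℕ} {P : MaximalParams} {K : ℝ}

theorem tendsto_setLIntegral_norm_ge {g : Rn n → ℝ≥0∞} (hg : AEMeasurable g)
    (hfin : ∫⁻ x, g x ≠ ⊤) :
    Tendsto (fun R : ℝ => ∫⁻ x in {x | R / 4 ≤ ‖x‖}, g x) atTop (𝓝 0) := by
  have hS : ∀ R : ℝ, MeasurableSet {x : Rn n | R / 4 ≤ ‖x‖} := fun R =>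
    measurableSet_le measurable_const measurable_norm
  wlog hgm : Measurable g generalizing g
  · have h1 := hg.ae_eq_mk
    have h2 := this hg.measurable_mk.aemeasurable (by rwa [← lintegral_congr_ae h1])
      hg.measurable_mk
    exact h2.congr fun R => lintegral_congr_ae (ae_restrict_of_ae h1.symm)
  simp_rw [← lintegral_indicator (hS _)]
  have h := tendsto_lintegral_filter_of_dominated_convergence (μ := (volume : Measure (Rn n)))
    (l := atTop) (F := fun (R : ℝ) x => {x : Rn n | R / 4 ≤ ‖x‖}.indicator g x) (f := fun _ => 0) g
    (Eventually.of_forall fun R => hgm.indicator (hS R))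
    (Eventually.of_forall fun R => Eventually.of_forall fun x => indicator_le_self _ _ _) hfin
    (Eventually.of_forall fun x => ?_)
  · simpa using h
  · refine tendsto_const_nhds.congr' ?_
    filter_upwards [eventually_gt_atTop (4 * ‖x‖)] with R hR
    rw [indicator_of_notMem]
    simp only [mem_ofPred_eq, not_le]
    linarith

/-- At some point of `B(0, R)` the grand maximal function is at most its average over the annulus
`R / 4 ≤ ‖x‖ < R`. -/
theorem exists_grandMaximal_le_average (hn : 0 < n) (P : MaximalParams) :
    ∃ C : ℝ≥0∞, C ≠ ⊤ ∧ ∀ (f : Rn n → ℂ) (R : ℝ), 0 < R → ∫⁻ x, grandMaximal P f x ≠ ⊤ →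
      ∃ x' : Rn n, ‖x'‖ < R ∧ ENNReal.ofReal (R ^ n) * grandMaximal P f x'
        ≤ C * ∫⁻ x in {x | R / 4 ≤ ‖x‖}, grandMaximal P f x := by
  have : Nonempty (Fin n) := ⟨⟨0, hn⟩⟩
  set A : Set (Rn n) := {x | 1 / 4 ≤ ‖x‖ ∧ ‖x‖ < 1} with hA
  have hAm : MeasurableSet A := (measurableSet_le measurable_const measurable_norm).inter
    (measurableSet_lt measurable_norm measurable_const)
  have hA0 : volume A ≠ 0 := by
    obtain ⟨w, hw⟩ := exists_norm_eq (Rn n) (c := 1 / 2) (by norm_num)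
    have hopen : IsOpen {x : Rn n | 1 / 4 < ‖x‖ ∧ ‖x‖ < 1} :=
      (isOpen_lt continuous_const continuous_norm).inter
        (isOpen_lt continuous_norm continuous_const)
    have hsub : {x : Rn n | 1 / 4 < ‖x‖ ∧ ‖x‖ < 1} ⊆ A := fun x hx => ⟨le_of_lt hx.1, hx.2⟩
    refine ((hopen.measure_pos volume ⟨w, ?_⟩).trans_le (measure_mono hsub)).ne'
    constructor <;> rw [hw] <;> norm_num
  have hAtop : volume A ≠ ⊤ := ((measure_mono (fun x hx => by
    rw [mem_ball_zero_iff]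
    exact hx.2)).trans_lt (measure_ball_lt_top (x := (0 : Rn n)) (r := 1))).ne
  refine ⟨(volume A)⁻¹, ENNReal.inv_ne_top.2 hA0, fun f R hR hfin => ?_⟩
  set AR : Set (Rn n) := (fun x => R⁻¹ • x) ⁻¹' A with hAR
  have hvol : volume AR = ENNReal.ofReal (R ^ n) * volume A := by
    rw [hAR, Measure.addHaar_preimage_smul _ (inv_ne_zero hR.ne')]
    simp [abs_of_pos hR]
  have hRn : ENNReal.ofReal (R ^ n) ≠ 0 := by
    rw [ne_eq, ENNReal.ofReal_eq_zero, not_le]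
    positivity
  have hmemAR : ∀ x ∈ AR, R / 4 ≤ ‖x‖ ∧ ‖x‖ < R := by
    rintro x ⟨h1, h2⟩
    simp only [norm_smul, norm_inv, Real.norm_of_nonneg hR.le] at h1 h2
    rw [inv_mul_lt_one₀ hR] at h2
    rw [le_inv_mul_iff₀ hR] at h1
    exact ⟨by linarith, h2⟩
  have hfin' : ∫⁻ x in AR, grandMaximal P f x ≠ ⊤ :=
    ((setLIntegral_le_lintegral _ _).trans_lt (lt_top_iff_ne_top.2 hfin)).ne
  have hvol0 : volume AR ≠ 0 := by
    rw [hvol]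
    exact mul_ne_zero hRn hA0
  obtain ⟨x', hx', hle⟩ := exists_le_setLAverage hvol0 (by
    rw [hvol]
    exact ENNReal.mul_ne_top ENNReal.ofReal_ne_top hAtop)
    (lowerSemicontinuous_grandMaximal P f).measurable.aemeasurable
  refine ⟨x', (hmemAR x' hx').2, ?_⟩
  rw [setLAverage_eq, hvol] at hle
  calc ENNReal.ofReal (R ^ n) * grandMaximal P f x'
      ≤ ENNReal.ofReal (R ^ n) * ((∫⁻ x in AR, grandMaximal P f x)
        / (ENNReal.ofReal (R ^ n) * volume A)) := by gcongr
    _ = (volume A)⁻¹ * ∫⁻ x in AR, grandMaximal P f x := by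
        rw [div_eq_mul_inv, ENNReal.mul_inv (Or.inl hRn) (Or.inl ENNReal.ofReal_ne_top)]
        calc _ = (ENNReal.ofReal (R ^ n) * (ENNReal.ofReal (R ^ n))⁻¹)
              * ((volume A)⁻¹ * ∫⁻ x in AR, grandMaximal P f x) := by ring
          _ = _ := by rw [ENNReal.mul_inv_cancel hRn ENNReal.ofReal_ne_top, one_mul]
    _ ≤ _ := by
        gcongr
        intro x hx
        exact (hmemAR x hx).1

/-- Truncations of a function in `H¹` converge to it in `H¹` as the cutoff scale grows. -/
theorem eventually_lintegral_grandMaximal_sub_truncate_le (hn : 0 < n) (hK : 0 < K)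
    {f : Rn n → ℂ} (hf : LocallyIntegrable f) (hfin : ∫⁻ x, grandMaximal P f x ≠ ⊤)
    {ε : ℝ≥0∞} (hε : 0 < ε) : ∀ᶠ R : ℝ in atTop, ∀ χ : Rn n → ℝ, IsCutoff K R χ →
      ∫⁻ x, grandMaximal P (f - truncate χ f) x ≤ ε := by
  obtain ⟨C₁, hC₁, h₁⟩ := exists_lintegral_grandMaximal_sub_truncate_le hn P hK
  obtain ⟨C₂, hC₂, h₂⟩ := exists_grandMaximal_le_average hn P
  have h := tendsto_setLIntegral_norm_ge
    (lowerSemicontinuous_grandMaximal P f).measurable.aemeasurable hfin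
  have h' := (ENNReal.Tendsto.const_mul h (a := C₁ + C₁ * C₂)
    (Or.inr (ENNReal.add_ne_top.2 ⟨hC₁, ENNReal.mul_ne_top hC₁ hC₂⟩)))
  rw [mul_zero] at h'
  filter_upwards [h'.eventually_lt_const hε, eventually_gt_atTop 0] with R hR hR0 χ hχ
  obtain ⟨x', hx', hle⟩ := h₂ f R hR0 hfin
  calc _ ≤ _ := h₁ f hf R χ hR0 hχ x' hx'
    _ ≤ C₁ * (∫⁻ x in {x | R / 4 ≤ ‖x‖}, grandMaximal P f x)
        + C₁ * (C₂ * ∫⁻ x in {x | R / 4 ≤ ‖x‖}, grandMaximal P f x) := by gcongr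
    _ = (C₁ + C₁ * C₂) * ∫⁻ x in {x | R / 4 ≤ ‖x‖}, grandMaximal P f x := by ring
    _ ≤ ε := hR.le

/-- Truncations of a function in `H¹ ∩ L^r` converge to it in `L^r` as the cutoff scale grows. -/
theorem eventually_eLpNorm_sub_truncate_le (hn : 0 < n) (hK : 0 < K)
    {f : Rn n → ℂ} {r : ℝ≥0∞} (hr : 1 ≤ r) (hr' : r ≠ ⊤) (hf : MemLp f r)
    (hfin : ∫⁻ x, grandMaximal P f x ≠ ⊤)
    {ε : ℝ≥0∞} (hε : 0 < ε) : ∀ᶠ R : ℝ in atTop, ∀ χ : Rn n → ℝ, IsCutoff K R χ →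
      eLpNorm (f - truncate χ f) r volume ≤ ε := by
  have : Nonempty (Fin n) := ⟨⟨0, hn⟩⟩
  obtain ⟨C₂, hC₂, h₂⟩ := exists_grandMaximal_le_average hn P
  have hr0 : r ≠ 0 := (zero_lt_one.trans_le hr).ne'
  have hr1 : 1 ≤ r.toReal := by
    rw [← ENNReal.toReal_one]
    exact ENNReal.toReal_mono hr' hr
  set v : ℝ≥0∞ := volume (Metric.ball (0 : Rn n) 1) with hv
  set D : ℝ≥0∞ := ENNReal.ofReal (2 ^ (n + 1) * K / (P.c * v.toReal)) with hD
  have h := tendsto_setLIntegral_norm_ge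
    (lowerSemicontinuous_grandMaximal P f).measurable.aemeasurable hfin
  have hE : D * C₂ * v ^ (1 / r.toReal) ≠ ⊤ :=
    ENNReal.mul_ne_top (ENNReal.mul_ne_top ENNReal.ofReal_ne_top hC₂)
      (ENNReal.rpow_ne_top_of_nonneg (by positivity) measure_ball_lt_top.ne)
  have h' := (ENNReal.Tendsto.const_mul h (a := D * C₂ * v ^ (1 / r.toReal)) (Or.inr hE))
  rw [mul_zero] at h'
  have hfr : ∫⁻ x, ‖f x‖ₑ ^ r.toReal ≠ ⊤ :=
    (lintegral_rpow_enorm_lt_top_of_eLpNorm_lt_top hr0 hr' hf.2).ne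
  have h'' := (ENNReal.continuous_rpow_const (y := 1 / r.toReal)).tendsto 0 |>.comp
    (tendsto_setLIntegral_norm_ge (hf.1.enorm.pow_const r.toReal) hfr)
  rw [ENNReal.zero_rpow_of_pos (by positivity)] at h''
  have hε2 : 0 < ε / 2 := ENNReal.half_pos hε.ne'
  filter_upwards [h'.eventually_lt_const hε2, h''.eventually_lt_const hε2,
    eventually_ge_atTop 1] with R hR₁ hR₂ hR0 χ hχ
  have hRpos : 0 < R := by linarith
  obtain ⟨x', hx', hle⟩ := h₂ f R hRpos hfin
  have hSm : MeasurableSet {x : Rn n | R / 4 ≤ ‖x‖} :=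
    measurableSet_le measurable_const measurable_norm
  -- the first term tends to zero by dominated convergence, and the constant in the second one is
  -- `o(R ^ (-n))` by the bound for the mean at a good point of `B(0, R)`
  have hdec : f - truncate χ f
      = (fun u => ((1 - χ u : ℝ) : ℂ) * f u) + fun u => χ u * cutoffMean χ f := by
    ext u
    simp only [Pi.sub_apply, Pi.add_apply, truncate]
    push_cast
    ring
  have hχc : Continuous fun u => (χ u : ℂ) := hχ.contDiff_ofReal.continuous
  have hpart₁ : eLpNorm (fun u => ((1 - χ u : ℝ) : ℂ) * f u) r volume ≤ ε / 2 := by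
    refine le_trans (eLpNorm_mono_enorm (g := {x : Rn n | R / 4 ≤ ‖x‖}.indicator f)
      fun u => ?_) ?_
    · by_cases hu : u ∈ {x : Rn n | R / 4 ≤ ‖x‖}
      · rw [indicator_of_mem hu, enorm_mul]
        refine mul_le_of_le_one_left zero_le ?_
        rw [← ofReal_norm, Complex.norm_of_nonneg (by linarith [hχ.le_one u]),
          ← ENNReal.ofReal_one]
        exact ENNReal.ofReal_le_ofReal (by linarith [hχ.nonneg u])
      · have hu' : χ u = 1 := hχ.eq_one u (by
          rw [mem_closedBall_zero_iff]
          simp only [mem_ofPred_eq, not_le] at hu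
          linarith)
        simp [hu']
    · rw [eLpNorm_indicator_eq_eLpNorm_restrict hSm,
        eLpNorm_eq_lintegral_rpow_enorm_toReal hr0 hr']
      exact hR₂.le
  have hpart₂ : eLpNorm (fun u => χ u * cutoffMean χ f) r volume ≤ ε / 2 := by
    refine le_trans (eLpNorm_mono_enorm
      (g := (Metric.ball (0 : Rn n) R).indicator fun _ => cutoffMean χ f) fun u => ?_) ?_
    · by_cases hu : u ∈ Metric.ball (0 : Rn n) R
      · rw [indicator_of_mem hu, enorm_mul]
        refine mul_le_of_le_one_left zero_le ?_
        rw [← ofReal_norm, ← ENNReal.ofReal_one]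
        exact ENNReal.ofReal_le_ofReal (hχ.norm_le_one u)
      · simp [hχ.eq_zero hu]
    · rw [eLpNorm_indicator_const measurableSet_ball hr0 hr',
        Measure.addHaar_ball _ _ hRpos.le, finrank_euclideanSpace_fin,
        ENNReal.mul_rpow_of_nonneg _ _ (by positivity)]
      have h3 : ENNReal.ofReal (R ^ n) ^ (1 / r.toReal) ≤ ENNReal.ofReal (R ^ n) := by
        conv_rhs => rw [← ENNReal.rpow_one (ENNReal.ofReal (R ^ n))]
        refine ENNReal.rpow_le_rpow_of_exponent_le ?_ ?_
        · rw [← ENNReal.ofReal_one]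
          exact ENNReal.ofReal_le_ofReal (one_le_pow₀ hR0)
        · rw [div_le_one (by positivity)]
          exact hr1
      calc ‖cutoffMean χ f‖ₑ * (ENNReal.ofReal (R ^ n) ^ (1 / r.toReal) * v ^ (1 / r.toReal))
          ≤ D * grandMaximal P f x' * (ENNReal.ofReal (R ^ n) * v ^ (1 / r.toReal)) := by
            gcongr
            exact hχ.enorm_cutoffMean_le hK hRpos f hx'
        _ = D * v ^ (1 / r.toReal) * (ENNReal.ofReal (R ^ n) * grandMaximal P f x') := by ring
        _ ≤ D * v ^ (1 / r.toReal)
            * (C₂ * ∫⁻ x in {x | R / 4 ≤ ‖x‖}, grandMaximal P f x) := by gcongr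
        _ = D * C₂ * v ^ (1 / r.toReal) * ∫⁻ x in {x | R / 4 ≤ ‖x‖}, grandMaximal P f x := by
            ring
        _ ≤ ε / 2 := hR₁.le
  rw [hdec]
  calc _ ≤ _ := eLpNorm_add_le (((Complex.continuous_ofReal.comp (continuous_const.sub
          hχ.contDiff.continuous)).aestronglyMeasurable).mul hf.1)
          (hχc.aestronglyMeasurable.mul_const _) hr
    _ ≤ ε / 2 + ε / 2 := add_le_add hpart₁ hpart₂
    _ = ε := ENNReal.add_halves ε

end TruncationLimit

/-! ### Dyadic heights and geometric sums -/

section DyadicLevels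

/-- The heights `2 ^ k`, `k ∈ ℤ`, as extended nonnegative reals. -/
noncomputable def dyadicLevel (k : ℤ) : ℝ≥0∞ := 2 ^ (k : ℝ)

theorem dyadicLevel_pos (k : ℤ) : 0 < dyadicLevel k :=
  ENNReal.rpow_pos two_pos (by norm_num)

theorem dyadicLevel_ne_top (k : ℤ) : dyadicLevel k ≠ ⊤ := by
  exact ENNReal.rpow_ne_top_of_ne_zero two_ne_zero (by norm_num)

theorem dyadicLevel_succ (k : ℤ) : dyadicLevel (k + 1) = 2 * dyadicLevel k := by
  rw [dyadicLevel, Int.cast_add, Int.cast_one, ENNReal.rpow_add _ _ two_ne_zero (by norm_num),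
    ENNReal.rpow_one, mul_comm, dyadicLevel]

theorem dyadicLevel_mono : Monotone dyadicLevel := fun _ _ h =>
  ENNReal.rpow_le_rpow_of_exponent_le one_le_two (by exact_mod_cast h)

theorem exists_dyadicLevel_lt_le {t : ℝ≥0∞} (h0 : t ≠ 0) (ht : t ≠ ⊤) :
    ∃ k : ℤ, dyadicLevel k < t ∧ t ≤ dyadicLevel (k + 1) := by
  obtain ⟨k, hk⟩ := ENNReal.exists_mem_Ioc_zpow h0 ht (y := 2) (by norm_num) (by norm_num)
  refine ⟨k, ?_, ?_⟩
  · rw [dyadicLevel, ENNReal.rpow_intCast]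
    exact hk.1
  · rw [dyadicLevel, ENNReal.rpow_intCast]
    exact hk.2

theorem exists_lt_dyadicLevel (k : ℤ) {t : ℝ≥0∞} (ht : t ≠ ⊤) :
    ∃ N : ℕ, t < dyadicLevel (k + N) := by
  obtain ⟨j, hj⟩ := exists_dyadicLevel_lt_le (t := t + 1) (by simp) (by simp [ht])
  refine ⟨(j + 1 - k).toNat, (ENNReal.lt_add_right ht one_ne_zero).trans_le
    (hj.2.trans (dyadicLevel_mono ?_))⟩
  omega

/-- The dyadic sum `∑ 2 ^ (k s)` over all `k` with `2 ^ k < t`, which is comparable to `t ^ s`. -/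
noncomputable def dyadicSum (s : ℝ) (t : ℝ≥0∞) : ℝ≥0∞ :=
  ∑' k : ℤ, (Iio t).indicator (fun a => a ^ s) (dyadicLevel k)

theorem dyadicSum_le {s : ℝ} (hs : 0 < s) :
    ∃ C : ℝ≥0∞, C ≠ ⊤ ∧ ∀ t, dyadicSum s t ≤ C * t ^ s := by
  set ρ : ℝ≥0∞ := 2 ^ (-s) with hρ
  have hρ1 : ρ < 1 := by
    rw [hρ, ENNReal.rpow_neg, ENNReal.inv_lt_one]
    exact ENNReal.one_lt_rpow (by norm_num) hs
  have hC : (1 - ρ)⁻¹ ≠ ⊤ := ENNReal.inv_ne_top.2 (tsub_pos_of_lt hρ1).ne'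
  refine ⟨(1 - ρ)⁻¹, hC, fun t => ?_⟩
  rcases eq_or_ne t 0 with rfl | h0
  · simp [dyadicSum]
  rcases eq_or_ne t ⊤ with rfl | ht
  · rw [ENNReal.top_rpow_of_pos hs, ENNReal.mul_top (ENNReal.inv_ne_zero.2 (by simp))]
    exact le_top
  obtain ⟨K, hK, hK'⟩ := exists_dyadicLevel_lt_le h0 ht
  have hinj : Function.Injective (fun j : ℕ => K - (j : ℤ)) := fun a b hab => by
    simpa using hab
  have hsupp : Function.support
      (fun k : ℤ => (Iio t).indicator (fun a => a ^ s) (dyadicLevel k))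
      ⊆ range (fun j : ℕ => K - (j : ℤ)) := by
    intro k hk
    have hkt : dyadicLevel k < t := by
      by_contra hcon
      exact hk (indicator_of_notMem hcon _)
    have : k < K + 1 := by
      by_contra hcon
      exact absurd (hK'.trans (dyadicLevel_mono (not_lt.1 hcon))) (not_le.2 hkt)
    exact ⟨(K - k).toNat, by simp only; omega⟩
  rw [dyadicSum, ← hinj.tsum_eq hsupp]
  have hterm : ∀ j : ℕ, (Iio t).indicator (fun a => a ^ s) (dyadicLevel (K - j))
      ≤ t ^ s * ρ ^ j := by
    intro j
    refine (indicator_le_self _ _ _).trans ?_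
    have h1 : dyadicLevel (K - j) = dyadicLevel K * 2 ^ (-(j : ℝ)) := by
      rw [dyadicLevel, dyadicLevel, ← ENNReal.rpow_add _ _ two_ne_zero (by norm_num)]
      push_cast
      rw [sub_eq_add_neg]
    have h2 : (2 ^ (-(j : ℝ)) : ℝ≥0∞) ^ s = ρ ^ j := by
      rw [hρ, ← ENNReal.rpow_natCast, ← ENNReal.rpow_mul, ← ENNReal.rpow_mul]
      congr 1
      ring
    rw [h1, ENNReal.mul_rpow_of_nonneg _ _ hs.le, h2]
    gcongr
  refine (ENNReal.tsum_le_tsum hterm).trans_eq ?_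
  rw [ENNReal.tsum_mul_left, ENNReal.tsum_geometric, mul_comm]

theorem rpow_le_dyadicSum {s : ℝ} (hs : 0 < s) (t : ℝ≥0∞) : t ^ s ≤ 2 ^ s * dyadicSum s t := by
  rcases eq_or_ne t 0 with rfl | h0
  · simp [hs]
  rcases eq_or_ne t ⊤ with rfl | ht
  · have h1 : dyadicSum s ⊤ = ⊤ := by
      refine top_unique ?_
      have hinj : Function.Injective (fun j : ℕ => (j : ℤ)) := Nat.cast_injective
      calc (⊤ : ℝ≥0∞) = ∑' _ : ℕ, (1 : ℝ≥0∞) :=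
            (ENNReal.tsum_const_eq_top_of_ne_zero one_ne_zero).symm
        _ ≤ ∑' j : ℕ, (Iio ⊤).indicator (fun a => a ^ s) (dyadicLevel j) := by
            refine ENNReal.tsum_le_tsum fun j => ?_
            rw [indicator_of_mem (mem_Iio.2 (lt_top_iff_ne_top.2 (dyadicLevel_ne_top _)))]
            refine ENNReal.one_le_rpow ?_ hs
            have h2 : dyadicLevel 0 = 1 := by simp [dyadicLevel]
            exact h2 ▸ dyadicLevel_mono (Int.natCast_nonneg j)
        _ ≤ _ := ENNReal.tsum_comp_le_tsum_of_injective hinj _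
    rw [h1, ENNReal.mul_top (ENNReal.rpow_pos two_pos (by norm_num)).ne']
    exact le_top
  obtain ⟨K, hK, hK'⟩ := exists_dyadicLevel_lt_le h0 ht
  calc t ^ s ≤ (2 * dyadicLevel K) ^ s := by
        rw [← dyadicLevel_succ]
        gcongr
    _ = 2 ^ s * dyadicLevel K ^ s := ENNReal.mul_rpow_of_nonneg _ _ hs.le
    _ ≤ _ := by
        gcongr
        rw [dyadicSum]
        refine le_trans ?_ (ENNReal.le_tsum K)
        rw [indicator_of_mem (mem_Iio.2 hK)]

/-- A discrete layer-cake formula. -/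
theorem lintegral_dyadicSum {X : Type*} [MeasurableSpace X] {μ : Measure X} {M : X → ℝ≥0∞}
    (hM : Measurable M) (s : ℝ) : ∫⁻ x, dyadicSum s (M x) ∂μ
      = ∑' k : ℤ, dyadicLevel k ^ s * μ {x | dyadicLevel k < M x} := by
  have hset : ∀ k, MeasurableSet {x | dyadicLevel k < M x} := fun k =>
    measurableSet_lt measurable_const hM
  have h1 : ∀ k x, (Iio (M x)).indicator (fun a => a ^ s) (dyadicLevel k)
      = {x | dyadicLevel k < M x}.indicator (fun _ => dyadicLevel k ^ s) x := fun k x => rfl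
  simp_rw [dyadicSum, h1]
  rw [lintegral_tsum fun k => (measurable_const.indicator (hset k)).aemeasurable]
  simp_rw [lintegral_indicator_const (hset _)]

end DyadicLevels

/-! ### Stopping times on nested partitions -/

section Stopping

variable {X ι : Type*} [MeasurableSpace X]

/-- A nested sequence of partitions of `X`: the cells of generation `m` are the fibres of `π m`.
The ratio of the measure of a cell to that of any of its children is at most `D`. -/
structure NestedPartition (μ : Measure X) (π : ℕ → X → ι) (D : ℝ≥0∞) : Prop where
  measurableSet_cell : ∀ m J, MeasurableSet (π m ⁻¹' {J})
  nested : ∀ m x y, π (m + 1) x = π (m + 1) y → π m x = π m y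
  pos : ∀ m x, μ (π m ⁻¹' {π m x}) ≠ 0
  ne_top : ∀ m x, μ (π m ⁻¹' {π m x}) ≠ ⊤
  doubling : ∀ m x, μ (π m ⁻¹' {π m x}) ≤ D * μ (π (m + 1) ⁻¹' {π (m + 1) x})

variable (μ : Measure X) (π : ℕ → X → ι) (h : X → ℂ)

/-- The average of `|h|` over the cell of generation `m` containing `x`. -/
noncomputable def cellAvg (m : ℕ) (x : X) : ℝ≥0∞ :=
  (∫⁻ y in π m ⁻¹' {π m x}, ‖h y‖ₑ ∂μ) / μ (π m ⁻¹' {π m x})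

/-- The mean of `h` over the cell of generation `m` containing `x`. -/
noncomputable def cellMean (m : ℕ) (x : X) : ℂ := ⨍ y in π m ⁻¹' {π m x}, h y ∂μ

/-- The maximal function of `h` over the cells. -/
noncomputable def cellMaximal (x : X) : ℝ≥0∞ := ⨆ m, cellAvg μ π h m x

/-- The points at which the averages of `|h|` first exceed the height `l` in generation `m`. -/
def stopSet (l : ℝ≥0∞) (m : ℕ) : Set X :=
  {x | l < cellAvg μ π h m x ∧ ∀ m' < m, cellAvg μ π h m' x ≤ l}

/-- The part of the cell with label `i.2` of generation `i.1` on which the averages stop there. It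
is either empty or the full cell, and in the latter case it is a cell selected at height `l`. -/
def stopCell (l : ℝ≥0∞) (i : ℕ × ι) : Set X := π i.1 ⁻¹' {i.2} ∩ stopSet μ π h l i.1

open Classical in
/-- The good part of `h` at height `l`: on the selected cells `h` is replaced by its mean. -/
noncomputable def goodPart (l : ℝ≥0∞) (x : X) : ℂ :=
  if hx : ∃ m, l < cellAvg μ π h m x then cellMean μ π h (Nat.find hx) x else h x

variable {μ π h} {D : ℝ≥0∞}

theorem lt_cellMaximal_iff {l : ℝ≥0∞} {x : X} :
    l < cellMaximal μ π h x ↔ ∃ m, l < cellAvg μ π h m x := lt_iSup_iff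

theorem goodPart_of_mem {l : ℝ≥0∞} {m : ℕ} {x : X} (hx : x ∈ stopSet μ π h l m) :
    goodPart μ π h l x = cellMean μ π h m x := by
  classical
  have hex : ∃ m, l < cellAvg μ π h m x := ⟨m, hx.1⟩
  have hfind : Nat.find hex = m :=
    (Nat.find_eq_iff hex).2 ⟨hx.1, fun k hk => not_lt.2 (hx.2 k hk)⟩
  rw [goodPart, dif_pos hex]
  congr

theorem goodPart_of_le {l : ℝ≥0∞} {x : X} (hx : cellMaximal μ π h x ≤ l) :
    goodPart μ π h l x = h x := by
  rw [goodPart, dif_neg]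
  rw [← lt_cellMaximal_iff]
  exact not_lt.2 hx

theorem exists_mem_stopSet {l : ℝ≥0∞} {x : X} (hx : l < cellMaximal μ π h x) :
    ∃ m, x ∈ stopSet μ π h l m := by
  classical
  have hex := lt_cellMaximal_iff.1 hx
  exact ⟨Nat.find hex, Nat.find_spec hex, fun m' hm' => not_lt.1 (Nat.find_min hex hm')⟩

theorem stopSet_subset {l : ℝ≥0∞} {m : ℕ} {x : X} (hx : x ∈ stopSet μ π h l m) :
    l < cellMaximal μ π h x := lt_cellMaximal_iff.2 ⟨m, hx.1⟩

theorem iUnion_stopCell (l : ℝ≥0∞) :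
    ⋃ i : ℕ × ι, stopCell μ π h l i = {x | l < cellMaximal μ π h x} := by
  ext x
  simp only [mem_iUnion]
  constructor
  · rintro ⟨i, hi⟩
    exact stopSet_subset hi.2
  · intro hx
    obtain ⟨m, hm⟩ := exists_mem_stopSet hx
    exact ⟨(m, π m x), rfl, hm⟩

theorem eq_of_mem_stopSet {l : ℝ≥0∞} {m m' : ℕ} {x : X} (hx : x ∈ stopSet μ π h l m)
    (hx' : x ∈ stopSet μ π h l m') : m = m' := by
  rcases lt_trichotomy m m' with hlt | heq | hlt
  · exact absurd hx.1 (not_lt.2 (hx'.2 m hlt))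
  · exact heq
  · exact absurd hx'.1 (not_lt.2 (hx.2 m' hlt))

theorem pairwise_disjoint_stopCell (l : ℝ≥0∞) :
    Pairwise (Function.onFun Disjoint (stopCell μ π h l)) := by
  intro i j hij
  refine Set.disjoint_left.2 fun x hxi hxj => hij ?_
  have h1 := eq_of_mem_stopSet hxi.2 hxj.2
  refine Prod.ext h1 ?_
  have h2 : π i.1 x = i.2 := hxi.1
  have h3 : π j.1 x = j.2 := hxj.1
  rw [← h2, ← h3, h1]

theorem cellAvg_congr {m : ℕ} {x y : X} (hxy : π m x = π m y) :
    cellAvg μ π h m x = cellAvg μ π h m y := by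
  rw [cellAvg, cellAvg, hxy]

namespace NestedPartition

variable (N : NestedPartition μ π D)
include N

theorem eq_of_le {m m' : ℕ} (hm : m ≤ m') {x y : X} (hxy : π m' x = π m' y) : π m x = π m y := by
  induction m', hm using Nat.le_induction with
  | base => exact hxy
  | succ k _ ih => exact ih (N.nested k x y hxy)

theorem mem_stopSet_congr {l : ℝ≥0∞} {m : ℕ} {x y : X} (hxy : π m x = π m y) :
    x ∈ stopSet μ π h l m ↔ y ∈ stopSet μ π h l m := by
  have h1 : ∀ m' ≤ m, cellAvg μ π h m' x = cellAvg μ π h m' y := fun m' hm' =>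
    cellAvg_congr (N.eq_of_le hm' hxy)
  simp only [stopSet, mem_ofPred_eq, h1 m le_rfl]
  refine and_congr_right fun _ => forall₂_congr fun m' hm' => ?_
  rw [h1 m' hm'.le]

/-- A nonempty selected set is the full cell. -/
theorem stopCell_eq {l : ℝ≥0∞} {i : ℕ × ι} {x : X} (hx : x ∈ stopCell μ π h l i) :
    stopCell μ π h l i = π i.1 ⁻¹' {π i.1 x} := by
  have h1 : π i.1 x = i.2 := hx.1
  rw [h1]
  refine inter_eq_left.2 fun y hy => ?_
  have hy' : π i.1 y = i.2 := hy
  exact (N.mem_stopSet_congr (h1.trans hy'.symm)).1 hx.2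

/-- The cells selected at a larger height are contained in the ones selected at a smaller
height. -/
theorem stopCell_inter {l l' : ℝ≥0∞} (hl : l ≤ l') (i j : ℕ × ι) :
    stopCell μ π h l i ∩ stopCell μ π h l' j = ∅ ∨ stopCell μ π h l' j ⊆ stopCell μ π h l i := by
  rcases eq_empty_or_nonempty (stopCell μ π h l i ∩ stopCell μ π h l' j) with h0 | ⟨x, hxi, hxj⟩
  · exact Or.inl h0
  right
  intro z hz
  rw [N.stopCell_eq hxj] at hz
  have hle : i.1 ≤ j.1 := by
    by_contra hlt
    exact absurd (hl.trans_lt hxj.2.1) (not_lt.2 (hxi.2.2 j.1 (not_le.1 hlt)))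
  rw [N.stopCell_eq hxi]
  exact N.eq_of_le hle hz

theorem measurable_comp [Countable ι] {β : Type*} [MeasurableSpace β] (m : ℕ) (F : ι → β) :
    Measurable fun x => F (π m x) := by
  intro s _
  have : (fun x => F (π m x)) ⁻¹' s = ⋃ J ∈ F ⁻¹' s, π m ⁻¹' {J} := by
    ext x
    simp
  rw [this]
  exact MeasurableSet.biUnion (to_countable _) fun J _ => N.measurableSet_cell m J

theorem measurable_cellAvg [Countable ι] (m : ℕ) : Measurable (cellAvg μ π h m) :=
  N.measurable_comp m fun J => (∫⁻ y in π m ⁻¹' {J}, ‖h y‖ₑ ∂μ) / μ (π m ⁻¹' {J})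

theorem measurable_cellMean [Countable ι] (m : ℕ) : Measurable (cellMean μ π h m) :=
  N.measurable_comp m fun J => ⨍ y in π m ⁻¹' {J}, h y ∂μ

theorem measurable_cellMaximal [Countable ι] : Measurable (cellMaximal μ π h) :=
  Measurable.iSup fun m => N.measurable_cellAvg m

theorem measurableSet_stopSet [Countable ι] (l : ℝ≥0∞) (m : ℕ) :
    MeasurableSet (stopSet μ π h l m) := by
  have : stopSet μ π h l m = {x | l < cellAvg μ π h m x}
      ∩ ⋂ m' ∈ Iio m, {x | cellAvg μ π h m' x ≤ l} := by
    ext x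
    simp [stopSet]
  rw [this]
  exact (measurableSet_lt measurable_const (N.measurable_cellAvg m)).inter
    (MeasurableSet.biInter (to_countable _) fun m' _ =>
      measurableSet_le (N.measurable_cellAvg m') measurable_const)

theorem measurableSet_stopCell [Countable ι] (l : ℝ≥0∞) (i : ℕ × ι) :
    MeasurableSet (stopCell μ π h l i) :=
  (N.measurableSet_cell _ _).inter (N.measurableSet_stopSet l _)

theorem measurableSet_lt_cellMaximal [Countable ι] (l : ℝ≥0∞) :
    MeasurableSet {x | l < cellMaximal μ π h x} :=
  measurableSet_lt measurable_const N.measurable_cellMaximal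

theorem measurable_goodPart [Countable ι] (hm : Measurable h) (l : ℝ≥0∞) :
    Measurable (goodPart μ π h l) := by
  obtain ⟨g, hg, hgeq⟩ := exists_measurable_piecewise (stopSet μ π h l)
    (N.measurableSet_stopSet l) (cellMean μ π h) N.measurable_cellMean (by
      intro i j hij x hx
      exact absurd (eq_of_mem_stopSet hx.1 hx.2) hij)
  classical
  have : goodPart μ π h l = {x | l < cellMaximal μ π h x}.piecewise g h := by
    ext x
    by_cases hx : l < cellMaximal μ π h x
    · rw [piecewise_eq_of_mem _ _ _ (by exact hx)]
      obtain ⟨m, hm⟩ := exists_mem_stopSet hx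
      rw [goodPart_of_mem hm, hgeq m hm]
    · rw [piecewise_eq_of_notMem _ _ _ (by exact hx), goodPart_of_le (not_lt.1 hx)]
  rw [this]
  exact hg.piecewise (N.measurableSet_lt_cellMaximal l) hm

/-- The weak type estimate for the maximal function over the cells. -/
theorem mul_measure_lt_cellMaximal_le [Countable ι] (l : ℝ≥0∞) :
    l * μ {x | l < cellMaximal μ π h x} ≤ ∫⁻ x in {x | l < cellMaximal μ π h x}, ‖h x‖ₑ ∂μ := by
  rw [← iUnion_stopCell, lintegral_iUnion (N.measurableSet_stopCell l)
    (pairwise_disjoint_stopCell l), measure_iUnion (pairwise_disjoint_stopCell l)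
    (N.measurableSet_stopCell l), ← ENNReal.tsum_mul_left]
  refine ENNReal.tsum_le_tsum fun i => ?_
  rcases eq_empty_or_nonempty (stopCell μ π h l i) with h0 | ⟨x, hx⟩
  · simp [h0]
  · have h1 := hx.2.1
    rw [N.stopCell_eq hx]
    rw [cellAvg] at h1
    exact ((ENNReal.lt_div_iff_mul_lt (Or.inl (N.pos _ _)) (Or.inl (N.ne_top _ _))).1 h1).le

theorem measure_lt_cellMaximal_ne_top [Countable ι] (hint : ∫⁻ x, ‖h x‖ₑ ∂μ ≠ ⊤) {l : ℝ≥0∞}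
    (hl : l ≠ 0) : μ {x | l < cellMaximal μ π h x} ≠ ⊤ := by
  intro htop
  have h1 := (N.mul_measure_lt_cellMaximal_le (h := h) l).trans (setLIntegral_le_lintegral _ _)
  rw [htop, ENNReal.mul_top hl] at h1
  exact hint (top_unique h1)

/-- The weak type estimate after removal of the part of `h` with `|h| ≤ l`, which contributes at
most `l` to each average. -/
theorem mul_measure_lt_cellMaximal_le' [Countable ι] (hm : Measurable h)
    (hint : ∫⁻ x, ‖h x‖ₑ ∂μ ≠ ⊤) {l : ℝ≥0∞} (hl : l ≠ 0) (hl' : l ≠ ⊤) :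
    l * μ {x | 2 * l < cellMaximal μ π h x} ≤ ∫⁻ x in {x | l < ‖h x‖ₑ}, ‖h x‖ₑ ∂μ := by
  set S := {x | 2 * l < cellMaximal μ π h x} with hS
  have hfin : l * μ S ≠ ⊤ := ENNReal.mul_ne_top hl'
    (N.measure_lt_cellMaximal_ne_top hint (mul_ne_zero two_ne_zero hl))
  have hmS : MeasurableSet {x | l < ‖h x‖ₑ} := measurableSet_lt measurable_const hm.enorm
  have h1 : 2 * l * μ S ≤ (∫⁻ x in {x | l < ‖h x‖ₑ}, ‖h x‖ₑ ∂μ) + l * μ S := by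
    refine (N.mul_measure_lt_cellMaximal_le (h := h) (2 * l)).trans ?_
    rw [← lintegral_inter_add_sdiff _ S hmS]
    refine add_le_add (lintegral_mono_set inter_subset_right) ?_
    calc ∫⁻ x in S \ {x | l < ‖h x‖ₑ}, ‖h x‖ₑ ∂μ ≤ ∫⁻ x in S \ {x | l < ‖h x‖ₑ}, l ∂μ :=
          setLIntegral_mono' ((N.measurableSet_lt_cellMaximal _).diff hmS)
            fun x hx => not_lt.1 hx.2
      _ ≤ l * μ S := by
          rw [setLIntegral_const]
          gcongr
          exact sdiff_subset
  rw [mul_assoc, two_mul] at h1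
  exact (ENNReal.add_le_add_iff_right hfin).1 h1

end NestedPartition

end Stopping

/-! ### The maximal theorem and the good parts -/

section GoodPart

variable {X ι : Type*} [MeasurableSpace X] {μ : Measure X} {π : ℕ → X → ι} {h : X → ℂ} {D : ℝ≥0∞}

/-- The maximal theorem for the maximal function over the cells, by summing the weak type estimates
over all dyadic heights. -/
theorem exists_lintegral_cellMaximal_rpow_le [Countable ι] {r : ℝ} (hr : 1 < r) :
    ∃ C : ℝ≥0∞, C ≠ ⊤ ∧ ∀ (π : ℕ → X → ι) (D : ℝ≥0∞), NestedPartition μ π D → ∀ h : X → ℂ,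
      Measurable h → ∫⁻ x, ‖h x‖ₑ ∂μ ≠ ⊤ →
        ∫⁻ x, cellMaximal μ π h x ^ r ∂μ ≤ C * ∫⁻ x, ‖h x‖ₑ ^ r ∂μ := by
  have hr0 : 0 < r := by linarith
  obtain ⟨C, hC, hCle⟩ := dyadicSum_le (s := r - 1) (by linarith)
  refine ⟨2 ^ r * (2 ^ r * C), ENNReal.mul_ne_top (by simp)
    (ENNReal.mul_ne_top (by simp) hC), fun π D N h hm hint => ?_⟩
  have hM := N.measurable_cellMaximal (h := h)
  have hset : ∀ k : ℤ, MeasurableSet {x | dyadicLevel k < ‖h x‖ₑ} := fun k =>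
    measurableSet_lt measurable_const hm.enorm
  have hterm : ∀ k : ℤ, dyadicLevel (k + 1) ^ r * μ {x | dyadicLevel (k + 1) < cellMaximal μ π h x}
      ≤ 2 ^ r * (dyadicLevel k ^ (r - 1)
        * ∫⁻ x in {x | dyadicLevel k < ‖h x‖ₑ}, ‖h x‖ₑ ∂μ) := by
    intro k
    have h0 := dyadicLevel_pos k
    have h1 := N.mul_measure_lt_cellMaximal_le' hm hint h0.ne' (dyadicLevel_ne_top k)
    have h2 : dyadicLevel k ^ r = dyadicLevel k ^ (r - 1) * dyadicLevel k := by
      conv_rhs => rw [← ENNReal.rpow_one (dyadicLevel k), ← ENNReal.rpow_mul, one_mul]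
      rw [← ENNReal.rpow_add _ _ h0.ne' (dyadicLevel_ne_top k)]
      congr 1
      ring
    rw [dyadicLevel_succ, ENNReal.mul_rpow_of_nonneg _ _ hr0.le, h2, mul_assoc, mul_assoc]
    gcongr
  calc ∫⁻ x, cellMaximal μ π h x ^ r ∂μ
      ≤ ∫⁻ x, 2 ^ r * dyadicSum r (cellMaximal μ π h x) ∂μ :=
        lintegral_mono fun x => rpow_le_dyadicSum hr0 _
    _ = 2 ^ r * ∑' k : ℤ, dyadicLevel k ^ r * μ {x | dyadicLevel k < cellMaximal μ π h x} := by
        rw [lintegral_const_mul' _ _ (by simp), lintegral_dyadicSum hM]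
    _ = 2 ^ r * ∑' k : ℤ, dyadicLevel (k + 1) ^ r
          * μ {x | dyadicLevel (k + 1) < cellMaximal μ π h x} := by
        rw [← (Equiv.addRight (1 : ℤ)).tsum_eq]
        rfl
    _ ≤ 2 ^ r * ∑' k : ℤ, 2 ^ r * (dyadicLevel k ^ (r - 1)
          * ∫⁻ x in {x | dyadicLevel k < ‖h x‖ₑ}, ‖h x‖ₑ ∂μ) := by
        exact mul_le_mul' le_rfl (ENNReal.tsum_le_tsum hterm)
    _ = 2 ^ r * (2 ^ r * ∫⁻ x, ‖h x‖ₑ * dyadicSum (r - 1) ‖h x‖ₑ ∂μ) := by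
        rw [ENNReal.tsum_mul_left]
        congr 2
        simp_rw [dyadicSum, ← ENNReal.tsum_mul_left]
        have h1 : ∀ (k : ℤ) x,
            ‖h x‖ₑ * (Iio ‖h x‖ₑ).indicator (fun a => a ^ (r - 1)) (dyadicLevel k)
            = dyadicLevel k ^ (r - 1)
              * {x | dyadicLevel k < ‖h x‖ₑ}.indicator (fun x => ‖h x‖ₑ) x := by
          intro k x
          by_cases hx : dyadicLevel k < ‖h x‖ₑ
          · rw [indicator_of_mem (mem_Iio.2 hx), indicator_of_mem (by exact hx), mul_comm]
          · rw [indicator_of_notMem (by simpa using hx), indicator_of_notMem (by exact hx),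
              mul_zero, mul_zero]
        simp_rw [h1]
        rw [lintegral_tsum fun k => ((hm.enorm.indicator (hset k)).const_mul _).aemeasurable]
        congr 1
        ext k
        rw [lintegral_const_mul _ (hm.enorm.indicator (hset k)), lintegral_indicator (hset k)]
    _ ≤ 2 ^ r * (2 ^ r * ∫⁻ x, C * ‖h x‖ₑ ^ r ∂μ) := by
        refine mul_le_mul' le_rfl (mul_le_mul' le_rfl (lintegral_mono fun x => ?_))
        calc ‖h x‖ₑ * dyadicSum (r - 1) ‖h x‖ₑ ≤ ‖h x‖ₑ * (C * ‖h x‖ₑ ^ (r - 1)) := by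
              gcongr
              exact hCle _
          _ = C * (‖h x‖ₑ ^ (1 : ℝ) * ‖h x‖ₑ ^ (r - 1)) := by
              rw [ENNReal.rpow_one]
              ring
          _ = C * ‖h x‖ₑ ^ r := by
              rw [← ENNReal.rpow_add_of_nonneg _ _ zero_le_one (by linarith)]
              congr 2
              ring
    _ = _ := by
        rw [lintegral_const_mul' _ _ hC]
        ring

theorem enorm_cellMean_le (m : ℕ) (x : X) : ‖cellMean μ π h m x‖ₑ ≤ cellAvg μ π h m x := by
  rw [cellMean, cellAvg, setAverage_eq, enorm_smul, div_eq_mul_inv, mul_comm]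
  refine mul_le_mul' (enorm_integral_le_lintegral_enorm _) ?_
  rcases eq_or_ne (μ (π m ⁻¹' {π m x})) 0 with h0 | h0
  · simp [h0]
  rcases eq_or_ne (μ (π m ⁻¹' {π m x})) ⊤ with ht | ht
  · simp [measureReal_def, ht]
  rw [enorm_inv (by simp [measureReal_def, ENNReal.toReal_eq_zero_iff, h0, ht]), measureReal_def,
    Real.enorm_of_nonneg ENNReal.toReal_nonneg, ENNReal.ofReal_toReal ht]

theorem goodPart_sub_eq_zero {l l' : ℝ≥0∞} (hl : l ≤ l') {x : X}
    (hx : cellMaximal μ π h x ≤ l) : goodPart μ π h l' x - goodPart μ π h l x = 0 := by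
  rw [goodPart_of_le hx, goodPart_of_le (hx.trans hl), sub_self]

namespace NestedPartition

variable (N : NestedPartition μ π D)
include N

/-- The doubling condition bounds the average over a cell by that over its parent. -/
theorem cellAvg_succ_le (m : ℕ) (x : X) :
    cellAvg μ π h (m + 1) x ≤ D * cellAvg μ π h m x := by
  have h1 : (μ (π (m + 1) ⁻¹' {π (m + 1) x}))⁻¹ ≤ D * (μ (π m ⁻¹' {π m x}))⁻¹ := by
    rw [← div_eq_mul_inv, ENNReal.le_div_iff_mul_le (Or.inl (N.pos m x)) (Or.inl (N.ne_top m x)),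
      mul_comm, ← div_eq_mul_inv, ENNReal.div_le_iff (N.pos _ x) (N.ne_top _ x)]
    exact N.doubling m x
  calc cellAvg μ π h (m + 1) x
      ≤ (∫⁻ y in π m ⁻¹' {π m x}, ‖h y‖ₑ ∂μ) * (D * (μ (π m ⁻¹' {π m x}))⁻¹) := by
        rw [cellAvg, div_eq_mul_inv]
        gcongr
        intro y hy
        exact N.nested m y x hy
    _ = D * cellAvg μ π h m x := by
        rw [cellAvg, div_eq_mul_inv]
        ring

/-- The parent of a selected cell was not selected, so that its average is at most `l`; for cells
of generation zero this is replaced by the hypothesis `h0`. -/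
theorem enorm_goodPart_le {l : ℝ≥0∞} (h0 : ∀ x, cellAvg μ π h 0 x ≤ D * l) {x : X}
    (hx : l < cellMaximal μ π h x) : ‖goodPart μ π h l x‖ₑ ≤ D * l := by
  obtain ⟨m, hm⟩ := exists_mem_stopSet hx
  rw [goodPart_of_mem hm]
  refine (enorm_cellMean_le m x).trans ?_
  cases m with
  | zero => exact h0 x
  | succ m =>
    refine (N.cellAvg_succ_le m x).trans ?_
    gcongr
    exact hm.2 m (Nat.lt_succ_self m)

theorem integrable_sub_goodPart [Countable ι] (hm : Measurable h) (hint : Integrable h μ)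
    {l : ℝ≥0∞} (hl : l ≠ 0) (hDl : D * l ≠ ⊤) (h0 : ∀ x, cellAvg μ π h 0 x ≤ D * l) :
    Integrable (fun x => h x - goodPart μ π h l x) μ := by
  have hint' : ∫⁻ x, ‖h x‖ₑ ∂μ ≠ ⊤ := hint.2.ne
  have hΩ := N.measurableSet_lt_cellMaximal (h := h) l
  refine ⟨(hm.sub (N.measurable_goodPart hm l)).aestronglyMeasurable, ?_⟩
  calc ∫⁻ x, ‖h x - goodPart μ π h l x‖ₑ ∂μ
      ≤ ∫⁻ x, ‖h x‖ₑ + {x | l < cellMaximal μ π h x}.indicator (fun _ => D * l) x ∂μ := by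
        refine lintegral_mono fun x => ?_
        by_cases hx : l < cellMaximal μ π h x
        · rw [indicator_of_mem (by exact hx)]
          exact enorm_sub_le.trans (add_le_add le_rfl (N.enorm_goodPart_le h0 hx))
        · rw [goodPart_of_le (not_lt.1 hx), sub_self, enorm_zero]
          exact zero_le
    _ < ⊤ := by
        rw [lintegral_add_left hm.enorm, lintegral_indicator_const hΩ]
        exact ENNReal.add_lt_top.2 ⟨hint.2, ENNReal.mul_lt_top (lt_top_iff_ne_top.2 hDl)
          (lt_top_iff_ne_top.2 (N.measure_lt_cellMaximal_ne_top hint' hl))⟩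

theorem setIntegral_stopCell_sub_goodPart (hint : Integrable h μ) (l : ℝ≥0∞) (i : ℕ × ι) :
    ∫ x in stopCell μ π h l i, (h x - goodPart μ π h l x) ∂μ = 0 := by
  rcases eq_empty_or_nonempty (stopCell μ π h l i) with h0 | ⟨x, hx⟩
  · simp [h0]
  have hQ := N.stopCell_eq hx
  have hQm : MeasurableSet (stopCell μ π h l i) := by
    rw [hQ]
    exact N.measurableSet_cell _ _
  have h1 : ∀ y ∈ stopCell μ π h l i, h y - goodPart μ π h l y = h y - cellMean μ π h i.1 x := by
    intro y hy
    have h2 : π i.1 y = π i.1 x := by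
      rw [hQ] at hy
      exact hy
    rw [goodPart_of_mem hy.2, cellMean, cellMean, h2]
  rw [setIntegral_congr_fun hQm h1, hQ]
  have hfin : IsFiniteMeasure (μ.restrict (π i.1 ⁻¹' {π i.1 x})) :=
    ⟨by rw [Measure.restrict_apply_univ]; exact lt_top_iff_ne_top.2 (N.ne_top _ _)⟩
  have hne : μ.real (π i.1 ⁻¹' {π i.1 x}) ≠ 0 := by
    simp [measureReal_def, ENNReal.toReal_eq_zero_iff, N.pos, N.ne_top]
  rw [integral_sub hint.integrableOn (integrable_const _), setIntegral_const, cellMean,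
    setAverage_eq, smul_smul, mul_inv_cancel₀ hne, one_smul, sub_self]

/-- The bad part has mean zero over any set which is compatible with the selected cells. -/
theorem setIntegral_sub_goodPart_eq_zero [Countable ι] (hint : Integrable h μ) {l : ℝ≥0∞}
    (hb : Integrable (fun x => h x - goodPart μ π h l x) μ) {B : Set X} (hB : MeasurableSet B)
    (hcompat : ∀ j, B ∩ stopCell μ π h l j = ∅ ∨ stopCell μ π h l j ⊆ B) :
    ∫ x in B, (h x - goodPart μ π h l x) ∂μ = 0 := by
  have hΩ := N.measurableSet_lt_cellMaximal (h := h) l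
  have h1 : ∫ x in B, (h x - goodPart μ π h l x) ∂μ
      = ∫ x in ⋃ j, B ∩ stopCell μ π h l j, (h x - goodPart μ π h l x) ∂μ := by
    rw [← inter_iUnion, iUnion_stopCell]
    refine setIntegral_eq_of_subset_of_forall_sdiff_eq_zero (E := ℂ) hB inter_subset_left
      fun x hx => ?_
    have hx' : ¬ l < cellMaximal μ π h x := fun hcon => hx.2 ⟨hx.1, hcon⟩
    rw [goodPart_of_le (not_lt.1 hx'), sub_self]
  rw [h1, integral_iUnion (fun j => hB.inter (N.measurableSet_stopCell l j))
    (fun i j hij => (pairwise_disjoint_stopCell l hij).mono inter_subset_right inter_subset_right)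
    hb.integrableOn]
  refine (tsum_congr fun j => ?_).trans tsum_zero
  rcases hcompat j with h0 | h0
  · simp [h0]
  · rw [inter_eq_right.2 h0]
    exact N.setIntegral_stopCell_sub_goodPart hint l j

/-- The difference of the good parts at two heights has mean zero over each cell selected at the
smaller height. -/
theorem setIntegral_stopCell_goodPart_sub [Countable ι] (hint : Integrable h μ) {l l' : ℝ≥0∞}
    (hl : l ≤ l') (hb : Integrable (fun x => h x - goodPart μ π h l x) μ)
    (hb' : Integrable (fun x => h x - goodPart μ π h l' x) μ) (i : ℕ × ι) :
    ∫ x in stopCell μ π h l i, (goodPart μ π h l' x - goodPart μ π h l x) ∂μ = 0 := by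
  have h1 := N.setIntegral_sub_goodPart_eq_zero hint hb (N.measurableSet_stopCell l i)
    (N.stopCell_inter le_rfl i)
  have h2 := N.setIntegral_sub_goodPart_eq_zero hint hb' (N.measurableSet_stopCell l i)
    (N.stopCell_inter hl i)
  have h3 := integral_sub hb.integrableOn hb'.integrableOn
    (μ := μ.restrict (stopCell μ π h l i))
  rw [h1, h2, sub_zero] at h3
  rw [← h3]
  refine integral_congr_ae (Eventually.of_forall fun x => ?_)
  simp

theorem enorm_goodPart_sub_le (hD : 1 ≤ D) {l l' : ℝ≥0∞} (hl : l ≤ l')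
    (h0 : ∀ x, cellAvg μ π h 0 x ≤ D * l) {x : X} (hx : ‖h x‖ₑ ≤ cellMaximal μ π h x) :
    ‖goodPart μ π h l' x - goodPart μ π h l x‖ₑ
      ≤ {x | l < cellMaximal μ π h x}.indicator (fun _ => D * (l' + l)) x := by
  by_cases hlx : l < cellMaximal μ π h x
  · rw [indicator_of_mem (by exact hlx), mul_add]
    refine enorm_sub_le.trans (add_le_add ?_ (N.enorm_goodPart_le h0 hlx))
    by_cases hlx' : l' < cellMaximal μ π h x
    · exact N.enorm_goodPart_le (fun x => (h0 x).trans (by gcongr)) hlx'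
    · rw [goodPart_of_le (not_lt.1 hlx')]
      exact (hx.trans (not_lt.1 hlx')).trans (le_mul_of_one_le_left zero_le hD)
  · rw [goodPart_sub_eq_zero hl (not_lt.1 hlx), enorm_zero]
    exact zero_le

theorem cellMaximal_eq_zero {J : ι} (hsupp : ∀ x, π 0 x ≠ J → h x = 0) {x : X}
    (hx : π 0 x ≠ J) : cellMaximal μ π h x = 0 := by
  refine le_antisymm (iSup_le fun m => ?_) zero_le
  have h2 : ∫⁻ y in π m ⁻¹' {π m x}, ‖h y‖ₑ ∂μ = 0 := by
    rw [setLIntegral_congr_fun (g := fun _ => 0) (N.measurableSet_cell _ _), lintegral_zero]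
    intro y hy
    have h3 : π 0 y = π 0 x := N.eq_of_le (Nat.zero_le m) hy
    simp [hsupp y (h3 ▸ hx)]
  rw [cellAvg, h2, ENNReal.zero_div]

/-- If all of the mass of `h` lies in one cell of generation zero, over which `h` has mean zero,
then the good part vanishes at all heights below the average of `|h|` over this cell. -/
theorem goodPart_eq_zero {J : ι} (hsupp : ∀ x, π 0 x ≠ J → h x = 0)
    (hmean : ∫ x in π 0 ⁻¹' {J}, h x ∂μ = 0) {l : ℝ≥0∞}
    (hl : ∀ x, π 0 x = J → l < cellAvg μ π h 0 x) (x : X) : goodPart μ π h l x = 0 := by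
  by_cases hx : π 0 x = J
  · have h1 : x ∈ stopSet μ π h l 0 := ⟨hl x hx, fun m' hm' => absurd hm' (Nat.not_lt_zero _)⟩
    rw [goodPart_of_mem h1, cellMean, hx, setAverage_eq, hmean, smul_zero]
  · rw [goodPart_of_le (by simp [N.cellMaximal_eq_zero hsupp hx]), hsupp x hx]

end NestedPartition

end GoodPart

/-! ### Dyadic cubes -/

section DyadicCubes

variable {n : ℕ}

/-- The label of the dyadic cube of generation `m` that contains `x`. The cubes of generation `m`
have side `2 R / 2 ^ m`, and the one with label `0` in generation zero is `[-R, R)ⁿ`. -/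
noncomputable def cubeIndex (R : ℝ) (m : ℕ) (x : Rn n) : Fin n → ℤ :=
  fun i => ⌊2 ^ m * ((x i + R) / (2 * R))⌋

theorem cubeIndex_preimage {R : ℝ} (hR : 0 < R) (m : ℕ) (J : Fin n → ℤ) :
    cubeIndex R m ⁻¹' {J} = (WithLp.ofLp : Rn n → Fin n → ℝ) ⁻¹' univ.pi fun i =>
      Ico (2 * R / 2 ^ m * J i - R) (2 * R / 2 ^ m * J i - R + 2 * R / 2 ^ m) := by
  ext x
  simp only [mem_preimage, mem_singleton_iff, Set.mem_pi, mem_univ, forall_const, mem_Ico,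
    funext_iff, cubeIndex, Int.floor_eq_iff]
  refine forall_congr' fun i => ?_
  have h1 : 2 ^ m * ((x i + R) / (2 * R)) = (x i + R) / (2 * R / 2 ^ m) := by field_simp
  rw [h1, le_div_iff₀ (by positivity), div_lt_iff₀ (by positivity)]
  constructor <;> rintro ⟨h2, h3⟩ <;> constructor <;> linarith

theorem measurableSet_cube {R : ℝ} (hR : 0 < R) (m : ℕ) (J : Fin n → ℤ) :
    MeasurableSet (cubeIndex R m ⁻¹' {J}) := by
  rw [cubeIndex_preimage hR]
  exact (PiLp.volume_preserving_ofLp (Fin n)).measurable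
    (MeasurableSet.univ_pi fun i => measurableSet_Ico)

theorem volume_cube {R : ℝ} (hR : 0 < R) (m : ℕ) (J : Fin n → ℤ) :
    volume (cubeIndex R m ⁻¹' {J}) = ENNReal.ofReal ((2 * R / 2 ^ m) ^ n) := by
  rw [cubeIndex_preimage hR, (PiLp.volume_preserving_ofLp (Fin n)).measure_preimage
    (MeasurableSet.univ_pi fun i => measurableSet_Ico).nullMeasurableSet, volume_pi_pi]
  simp [ENNReal.ofReal_pow (by positivity : 0 ≤ 2 * R / 2 ^ m)]

theorem nestedPartition_cubeIndex (n : ℕ) {R : ℝ} (hR : 0 < R) :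
    NestedPartition (volume : Measure (Rn n)) (cubeIndex R) (2 ^ n) where
  measurableSet_cell := measurableSet_cube hR
  nested m x y hxy := by
    have h1 : ∀ a : ℝ, ⌊2 ^ m * a⌋ = ⌊2 ^ (m + 1) * a⌋ / 2 := by
      intro a
      have h2 := Int.floor_div_natCast (2 ^ (m + 1) * a) 2
      rw [← Nat.cast_two (R := ℤ), ← h2]
      congr 1
      rw [pow_succ]
      push_cast
      ring
    funext i
    rw [cubeIndex, cubeIndex, h1, h1]
    exact congrArg (· / 2) (congrFun hxy i)
  pos m x := by
    rw [volume_cube hR, ne_eq, ENNReal.ofReal_eq_zero, not_le]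
    positivity
  ne_top m x := by
    rw [volume_cube hR]
    exact ENNReal.ofReal_ne_top
  doubling m x := by
    rw [volume_cube hR, volume_cube hR, ← ENNReal.ofReal_ofNat, ← ENNReal.ofReal_pow (by simp),
      ← ENNReal.ofReal_mul (by positivity), ← mul_pow]
    refine ENNReal.ofReal_le_ofReal (le_of_eq ?_)
    congr 1
    rw [pow_succ]
    field_simp

theorem dist_le_of_cubeIndex_eq {R : ℝ} (hR : 0 < R) {m : ℕ} {x y : Rn n}
    (hxy : cubeIndex R m x = cubeIndex R m y) : dist x y ≤ n * (2 * R / 2 ^ m) := by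
  have h1 : ∀ i, dist (x i) (y i) ≤ 2 * R / 2 ^ m := by
    have hx : x ∈ cubeIndex R m ⁻¹' {cubeIndex R m y} := hxy
    have hy : y ∈ cubeIndex R m ⁻¹' {cubeIndex R m y} := rfl
    rw [cubeIndex_preimage hR] at hx hy
    intro i
    have hxi := hx i (mem_univ i)
    have hyi := hy i (mem_univ i)
    rw [Real.dist_eq, abs_sub_le_iff]
    constructor <;> linarith [hxi.1, hxi.2, hyi.1, hyi.2]
  rw [EuclideanSpace.dist_eq, Real.sqrt_le_left (by positivity)]
  calc ∑ i, dist (x i) (y i) ^ 2 ≤ ∑ _i : Fin n, (2 * R / 2 ^ m) ^ 2 :=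
        Finset.sum_le_sum fun i _ => pow_le_pow_left₀ dist_nonneg (h1 i) 2
    _ = n * (2 * R / 2 ^ m) ^ 2 := by simp
    _ ≤ (n : ℝ) ^ 2 * (2 * R / 2 ^ m) ^ 2 := by
        gcongr
        exact_mod_cast Nat.le_self_pow two_ne_zero n
    _ = _ := by ring

/-- By Lebesgue's differentiation theorem a function is dominated by its dyadic maximal
function. -/
theorem ae_enorm_le_cellMaximal (hn : 0 < n) {R : ℝ} (hR : 0 < R) {h : Rn n → ℂ}
    (hh : LocallyIntegrable h) :
    ∀ᵐ x, ‖h x‖ₑ ≤ cellMaximal volume (cubeIndex R) h x := by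
  have hn' : (0 : ℝ) < n := by exact_mod_cast hn
  filter_upwards [(IsUnifLocDoublingMeasure.vitaliFamily (volume : Measure (Rn n))
    1).ae_tendsto_lintegral_enorm_sub_div hh] with x hx
  set δ : ℕ → ℝ := fun m => n * (2 * R / 2 ^ m) with hδ
  have hδ0 : ∀ m, 0 < δ m := fun m => by positivity
  have hδlim : Tendsto δ atTop (𝓝[>] 0) := by
    refine tendsto_nhdsWithin_iff.2 ⟨?_, Eventually.of_forall hδ0⟩
    have h1 : Tendsto (fun m : ℕ => (n * (2 * R)) * (1 / 2 : ℝ) ^ m) atTop (𝓝 (n * (2 * R) * 0)) :=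
      (tendsto_pow_atTop_nhds_zero_of_lt_one (by norm_num) (by norm_num)).const_mul _
    rw [mul_zero] at h1
    refine h1.congr fun m => ?_
    rw [hδ]
    simp only [one_div, inv_pow]
    ring
  have h1 := hx.comp (IsUnifLocDoublingMeasure.tendsto_closedBall_filterAt volume (K := 1)
    (fun _ => x) δ hδlim (Eventually.of_forall fun m =>
      Metric.mem_closedBall_self (by simpa using (hδ0 m).le)))
  set κ : ℝ≥0∞ := ENNReal.ofReal ((n : ℝ) ^ n) * volume (Metric.ball (0 : Rn n) 1) with hκ
  have hκ' : κ ≠ ⊤ := ENNReal.mul_ne_top ENNReal.ofReal_ne_top measure_ball_lt_top.ne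
  have h2 := (ENNReal.Tendsto.const_mul h1 (Or.inr hκ')).const_add
    (cellMaximal volume (cubeIndex R) h x)
  rw [mul_zero, add_zero] at h2
  refine ge_of_tendsto h2 (Eventually.of_forall fun m => ?_)
  have N := nestedPartition_cubeIndex n hR
  set Q := cubeIndex R m ⁻¹' {cubeIndex R m x} with hQ
  have hQ0 : volume Q ≠ 0 := N.pos m x
  have hQt : volume Q ≠ ⊤ := N.ne_top m x
  have hball : volume (Metric.closedBall x (δ m)) = κ * volume Q := by
    rw [Measure.addHaar_closedBall _ _ (hδ0 m).le, hQ, volume_cube hR, hκ,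
      finrank_euclideanSpace_fin, hδ, mul_pow, ENNReal.ofReal_mul (by positivity)]
    ring
  have hκ0 : κ ≠ 0 := mul_ne_zero (by
    rw [ne_eq, ENNReal.ofReal_eq_zero, not_le]
    positivity) (Metric.measure_ball_pos _ _ one_pos).ne'
  have hsub : Q ⊆ Metric.closedBall x (δ m) := fun y hy => dist_le_of_cubeIndex_eq hR hy
  have h3 : ‖h x‖ₑ * volume Q ≤ (∫⁻ y in Q, ‖h y‖ₑ)
      + ∫⁻ y in Metric.closedBall x (δ m), ‖h y - h x‖ₑ := by
    rw [← setLIntegral_const]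
    calc ∫⁻ _ in Q, ‖h x‖ₑ ≤ ∫⁻ y in Q, ‖h y‖ₑ + ‖h y - h x‖ₑ := by
          refine lintegral_mono fun y => ?_
          calc ‖h x‖ₑ = ‖h y - (h y - h x)‖ₑ := by rw [sub_sub_cancel]
            _ ≤ _ := enorm_sub_le
      _ = (∫⁻ y in Q, ‖h y‖ₑ) + ∫⁻ y in Q, ‖h y - h x‖ₑ :=
          lintegral_add_left' hh.aestronglyMeasurable.enorm.restrict _
      _ ≤ _ := add_le_add le_rfl (lintegral_mono_set hsub)
  simp only [Function.comp_apply]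
  rw [hball]
  calc ‖h x‖ₑ ≤ ((∫⁻ y in Q, ‖h y‖ₑ)
      + ∫⁻ y in Metric.closedBall x (δ m), ‖h y - h x‖ₑ) / volume Q :=
        (ENNReal.le_div_iff_mul_le (Or.inl hQ0) (Or.inl hQt)).2 h3
    _ = cellAvg volume (cubeIndex R) h m x
        + (∫⁻ y in Metric.closedBall x (δ m), ‖h y - h x‖ₑ) / volume Q := by
        rw [ENNReal.add_div]
        rfl
    _ ≤ _ := by
        refine add_le_add (le_iSup (fun m => cellAvg volume (cubeIndex R) h m x) m) (le_of_eq ?_)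
        rw [div_eq_mul_inv, div_eq_mul_inv, ENNReal.mul_inv (Or.inl hκ0) (Or.inl hκ')]
        rw [mul_comm κ, mul_assoc, mul_comm _ κ, ← mul_assoc κ, ENNReal.mul_inv_cancel hκ0 hκ',
          one_mul]

end DyadicCubes

/-! ### Differences of good parts as sums of atoms -/

section HardyGoodPart

variable {n : ℕ}

/-- The difference of the good parts of `h` at the heights `2 l` and `l` is a sum of atoms supported
in the cubes selected at height `l`. -/
theorem exists_lintegral_grandMaximal_goodPart_sub_le (hn : 0 < n) (P : MaximalParams) :
    ∃ C : ℝ≥0∞, C ≠ ⊤ ∧ ∀ (R : ℝ) (h : Rn n → ℂ) (l : ℝ≥0∞), 0 < R → Measurable h →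
      Integrable h → l ≠ 0 → l ≠ ⊤ → (∀ x, cellAvg volume (cubeIndex R) h 0 x ≤ 2 ^ n * l) →
      ∫⁻ x, grandMaximal P (goodPart volume (cubeIndex R) h (2 * l)
          - goodPart volume (cubeIndex R) h l) x
        ≤ C * (l * volume {x | l < cellMaximal volume (cubeIndex R) h x}) := by
  obtain ⟨C, hC, hatom⟩ := exists_lintegral_grandMaximal_atom_le hn P
  refine ⟨C * (2 ^ n * 3) * ENNReal.ofReal ((n : ℝ) ^ n), ENNReal.mul_ne_top
    (ENNReal.mul_ne_top hC (ENNReal.mul_ne_top (by simp) (by simp)))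
    ENNReal.ofReal_ne_top, fun R h l hR hm hint hl hl' h0 => ?_⟩
  have N := nestedPartition_cubeIndex n hR
  have hn' : (0 : ℝ) < n := by exact_mod_cast hn
  set μ : Measure (Rn n) := volume
  set π : ℕ → Rn n → Fin n → ℤ := cubeIndex R
  have hle : l ≤ 2 * l := le_mul_of_one_le_left zero_le one_le_two
  have hD : (1 : ℝ≥0∞) ≤ 2 ^ n := one_le_pow₀ one_le_two
  have h0' : ∀ x, cellAvg μ π h 0 x ≤ 2 ^ n * (2 * l) := fun x => (h0 x).trans (by gcongr)
  have hb := N.integrable_sub_goodPart hm hint hl (ENNReal.mul_ne_top (by simp) hl') h0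
  have hb' := N.integrable_sub_goodPart hm hint (mul_ne_zero two_ne_zero hl)
    (ENNReal.mul_ne_top (by simp) (ENNReal.mul_ne_top (by simp) hl')) h0'
  set u : Rn n → ℂ := goodPart μ π h (2 * l) - goodPart μ π h l with hu
  have hum : Measurable u := (N.measurable_goodPart hm _).sub (N.measurable_goodPart hm _)
  set A : ℝ≥0∞ := 2 ^ n * 3 * l with hA
  have hAtop : A ≠ ⊤ := ENNReal.mul_ne_top (ENNReal.mul_ne_top (by simp) (by simp)) hl'
  have hubd : ∀ᵐ x, ‖u x‖ₑ ≤ A := by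
    filter_upwards [ae_enorm_le_cellMaximal hn hR hint.locallyIntegrable] with x hx
    refine (N.enorm_goodPart_sub_le hD hle h0 hx).trans ((indicator_le_self _ _ _).trans_eq ?_)
    rw [hA]
    ring
  set a : ℕ × (Fin n → ℤ) → Rn n → ℂ := fun i => (stopCell μ π h l i).indicator u with ha
  have hSm := fun i => N.measurableSet_stopCell (h := h) l i
  have ham : ∀ i, Measurable (a i) := fun i => hum.indicator (hSm i)
  have hvol : ∑' i, μ (stopCell μ π h l i) = μ {x | l < cellMaximal μ π h x} := by
    rw [← iUnion_stopCell, measure_iUnion (pairwise_disjoint_stopCell l) hSm]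
  have hsum : ∑' i, ∫⁻ x, ‖a i x‖ₑ ≠ ⊤ := by
    have h1 : ∀ i, ∫⁻ x, ‖a i x‖ₑ ≤ A * μ (stopCell μ π h l i) := by
      intro i
      simp_rw [ha, enorm_indicator_eq_indicator_enorm]
      rw [lintegral_indicator (hSm i), ← setLIntegral_const]
      exact lintegral_mono_ae (ae_restrict_of_ae hubd)
    refine ((ENNReal.tsum_le_tsum h1).trans_lt ?_).ne
    rw [ENNReal.tsum_mul_left, hvol]
    exact ENNReal.mul_lt_top (lt_top_iff_ne_top.2 hAtop)
      (lt_top_iff_ne_top.2 (N.measure_lt_cellMaximal_ne_top hint.2.ne hl))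
  have hua : u = fun x => ∑' i, a i x := by
    ext x
    by_cases hx : ∃ i, x ∈ stopCell μ π h l i
    · obtain ⟨i, hi⟩ := hx
      rw [tsum_eq_single i, ha]
      · simp only
        rw [indicator_of_mem hi]
      · intro j hj
        exact indicator_of_notMem
          (Set.disjoint_left.1 (pairwise_disjoint_stopCell l hj.symm) hi) _
    · have hx' : cellMaximal μ π h x ≤ l := by
        rw [← not_lt]
        intro hcon
        have : x ∈ ⋃ i, stopCell μ π h l i := by
          rw [iUnion_stopCell]
          exact hcon
        exact hx (mem_iUnion.1 this)
      rw [hu, Pi.sub_apply, goodPart_sub_eq_zero hle hx']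
      refine ((tsum_congr fun i => ?_).trans tsum_zero).symm
      exact indicator_of_notMem (fun hi => hx ⟨i, hi⟩) _
  have hai : ∀ i, ∫⁻ x, grandMaximal P (a i) x
      ≤ C * (A * (ENNReal.ofReal ((n : ℝ) ^ n) * μ (stopCell μ π h l i))) := by
    intro i
    rcases eq_empty_or_nonempty (stopCell μ π h l i) with hemp | ⟨x, hx⟩
    · have h1 : a i = 0 := by
        rw [ha]
        simp only [hemp, indicator_empty]
        rfl
      rw [h1]
      simp [grandMaximal_zero]
    · have hQ := N.stopCell_eq hx
      set s : ℝ := 2 * R / 2 ^ i.1 with hs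
      have hs0 : 0 < s := by positivity
      have h1 := hatom (a i) x (n * s) A.toReal (by positivity) ENNReal.toReal_nonneg
        (ham i).aestronglyMeasurable ?_ ?_ ?_
      · refine h1.trans_eq ?_
        rw [ENNReal.ofReal_mul ENNReal.toReal_nonneg, ENNReal.ofReal_toReal hAtop, hQ,
          volume_cube hR, mul_pow, ENNReal.ofReal_mul (by positivity)]
      · filter_upwards [hubd] with y hy
        rw [← ENNReal.ofReal_le_iff_le_toReal hAtop, ofReal_norm]
        rw [ha]
        simp only
        rw [enorm_indicator_eq_indicator_enorm]
        exact (indicator_le_self _ _ _).trans hy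
      · intro y hy
        refine indicator_of_notMem (fun hyS => hy ?_) _
        rw [hQ] at hyS
        exact dist_le_of_cubeIndex_eq hR hyS
      · rw [ha]
        simp only
        rw [integral_indicator (hSm i)]
        exact N.setIntegral_stopCell_goodPart_sub hint hle hb hb' i
  calc ∫⁻ x, grandMaximal P u x ≤ ∫⁻ x, ∑' i, grandMaximal P (a i) x :=
        lintegral_mono (grandMaximal_tsum_le hn (fun i => (ham i).aestronglyMeasurable) hsum
          (Eventually.of_forall fun x => congrFun hua x))
    _ = ∑' i, ∫⁻ x, grandMaximal P (a i) x :=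
        lintegral_tsum fun i => (lowerSemicontinuous_grandMaximal P _).measurable.aemeasurable
    _ ≤ ∑' i, C * (A * (ENNReal.ofReal ((n : ℝ) ^ n) * μ (stopCell μ π h l i))) :=
        ENNReal.tsum_le_tsum hai
    _ = _ := by
        rw [ENNReal.tsum_mul_left, ENNReal.tsum_mul_left, ENNReal.tsum_mul_left, hvol, hA]
        ring

end HardyGoodPart

/-! ### The layer decomposition -/

section Decomposition

variable {n : ℕ}

theorem cubeIndex_zero_eq_of_mem_ball {R : ℝ} (hR : 0 < R) {x : Rn n}
    (hx : x ∈ Metric.ball (0 : Rn n) R) : cubeIndex R 0 x = 0 := by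
  have h1 : x ∈ cubeIndex R 0 ⁻¹' {0} := by
    rw [cubeIndex_preimage hR]
    intro i _
    have h2 := abs_lt.1 ((PiLp.norm_apply_le x i).trans_lt (mem_ball_zero_iff.1 hx))
    simp only [Pi.zero_apply, Int.cast_zero, mul_zero, pow_zero, div_one, mem_Ico]
    constructor <;> linarith
  exact h1

theorem dyadicLevel_rpow_sub_one_mul (k : ℤ) (a : ℝ) :
    dyadicLevel k ^ (a - 1) * dyadicLevel k = dyadicLevel k ^ a := by
  conv_lhs => rw [← ENNReal.rpow_one (dyadicLevel k), ← ENNReal.rpow_mul, one_mul]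
  rw [← ENNReal.rpow_add _ _ (dyadicLevel_pos k).ne' (dyadicLevel_ne_top k), sub_add_cancel]

theorem ENNReal.tsum_int_add_natCast_le (f : ℤ → ℝ≥0∞) (k : ℤ) :
    ∑' i : ℕ, f (k + i) ≤ ∑' j, f j :=
  ENNReal.tsum_comp_le_tsum_of_injective (f := fun i : ℕ => k + (i : ℤ))
    (fun a b hab => by simpa using hab) f

/-- The layers `u 0, …, u (N - 1)` at the dyadic heights `2 ^ (k₀ + i)`, weighted by the powers
`q - 1` and `q / p - 1` of their heights, are bounded by `C` in the endpoint spaces `H¹` and `L^p`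
respectively, and the sum of the layers differs from `h` by an error that is at most `ε` in both
spaces. In the `L^p` conditions it is the `p`-th power of the norm that is bounded. -/
structure IsLayerDecomposition (P : MaximalParams) (p q : ℝ) (C ε : ℝ≥0∞) (h : Rn n → ℂ) (k₀ : ℤ)
    (N : ℕ) (u : ℕ → Rn n → ℂ) : Prop where
  hardy_le : ∑ i ∈ Finset.range N, dyadicLevel (k₀ + i) ^ (q - 1) * ∫⁻ x, grandMaximal P (u i) x ≤ C
  lp_le : ∫⁻ x, (∑ i ∈ Finset.range N, dyadicLevel (k₀ + i) ^ (q / p - 1) * ‖u i x‖ₑ) ^ p ≤ C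
  error_hardy_le : ∫⁻ x, grandMaximal P (fun x => h x - ∑ i ∈ Finset.range N, u i x) x ≤ ε
  error_lp_le : ∫⁻ x, ‖h x - ∑ i ∈ Finset.range N, u i x‖ₑ ^ p ≤ ε

theorem lintegral_ne_top_of_rpow {X : Type*} [MeasurableSpace X] {μ : Measure X} {M : X → ℝ≥0∞}
    {Q : Set X} (hQm : MeasurableSet Q) (hQ : μ Q ≠ ⊤) (hM : ∀ x ∉ Q, M x = 0) {p : ℝ} (hp : 1 < p)
    (hMp : ∫⁻ x, M x ^ p ∂μ ≠ ⊤) : ∫⁻ x, M x ∂μ ≠ ⊤ := by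
  have h1 : ∫⁻ x, M x ∂μ ≤ ∫⁻ x, Q.indicator (fun _ => 1) x + M x ^ p ∂μ := by
    refine lintegral_mono fun x => ?_
    by_cases hx : x ∈ Q
    · rw [indicator_of_mem hx]
      rcases le_total (M x) 1 with h | h
      · exact h.trans le_self_add
      · refine le_trans ?_ le_add_self
        conv_lhs => rw [← ENNReal.rpow_one (M x)]
        exact ENNReal.rpow_le_rpow_of_exponent_le h hp.le
    · rw [hM x hx]
      exact zero_le
  refine (h1.trans_lt ?_).ne
  rw [lintegral_add_left (measurable_const.indicator hQm), lintegral_indicator_const hQm, one_mul]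
  exact ENNReal.add_lt_top.2 ⟨lt_top_iff_ne_top.2 hQ, lt_top_iff_ne_top.2 hMp⟩

/-- The Calderón–Zygmund layer decomposition of a compactly supported function with mean zero: the
layers are the differences of its good parts at consecutive dyadic heights. The layer at height
`2 ^ k` is bounded by a multiple of `2 ^ k` and lives where the maximal function `M` exceeds
`2 ^ k`, so that both weighted sums are dominated by geometric sums comparable to powers of `M`. -/
theorem exists_isLayerDecomposition (hn : 0 < n) (P : MaximalParams) {p q : ℝ} (hq : 1 < q)
    (hqp : q < p) : ∃ C : ℝ≥0∞, C ≠ ⊤ ∧ ∀ (h : Rn n → ℂ) (R : ℝ), 0 < R → Measurable h →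
      (∀ x ∉ Metric.ball (0 : Rn n) R, h x = 0) → ∫ x, h x = 0 → ∫⁻ x, ‖h x‖ₑ ^ p ≠ ⊤ →
      ∀ ε : ℝ≥0∞, 0 < ε → ∃ (k₀ : ℤ) (N : ℕ) (u : ℕ → Rn n → ℂ),
        IsLayerDecomposition P p q (C * ∫⁻ x, ‖h x‖ₑ ^ q) ε h k₀ N u ∧
        (∀ i, Measurable (u i)) ∧ (∀ i, ∃ B : ℝ, ∀ᵐ x, ‖u i x‖ ≤ B) ∧
        ∃ R' : ℝ, ∀ i, ∀ x ∉ Metric.closedBall (0 : Rn n) R', u i x = 0 := by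
  have hp : 1 < p := hq.trans hqp
  have hp0 : 0 < p := by linarith
  have hq0 : 0 < q := by linarith
  obtain ⟨C₁, hC₁, hH⟩ := exists_lintegral_grandMaximal_goodPart_sub_le hn P
  obtain ⟨Cq, hCq, hMq⟩ := exists_lintegral_cellMaximal_rpow_le (X := Rn n) (ι := Fin n → ℤ)
    (μ := volume) hq
  obtain ⟨Cp, hCp, hMp⟩ := exists_lintegral_cellMaximal_rpow_le (X := Rn n) (ι := Fin n → ℤ)
    (μ := volume) hp
  obtain ⟨S₁, hS₁, hS₁le⟩ := dyadicSum_le (s := q) hq0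
  obtain ⟨S₂, hS₂, hS₂le⟩ := dyadicSum_le (s := q / p) (by positivity)
  obtain ⟨S₃, hS₃, hS₃le⟩ := dyadicSum_le (s := 1) one_pos
  refine ⟨C₁ * S₁ * Cq + (2 ^ n * 3 * S₂) ^ p * Cq, ENNReal.add_ne_top.2
    ⟨ENNReal.mul_ne_top (ENNReal.mul_ne_top hC₁ hS₁) hCq, ENNReal.mul_ne_top
      (ENNReal.rpow_ne_top_of_nonneg hp0.le (ENNReal.mul_ne_top (by finiteness) hS₂)) hCq⟩,
    fun h R hR hm hsupp hmean hhp ε hε => ?_⟩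
  have NP := nestedPartition_cubeIndex n hR
  set μ : Measure (Rn n) := volume with hμ
  set π : ℕ → Rn n → Fin n → ℤ := cubeIndex R with hπ
  set Q : Set (Rn n) := π 0 ⁻¹' {0} with hQ
  have hQm : MeasurableSet Q := measurableSet_cube hR 0 0
  have h0Q : π 0 0 = 0 := cubeIndex_zero_eq_of_mem_ball hR (Metric.mem_ball_self hR)
  have hQfin : μ Q ≠ ⊤ := by
    have := NP.ne_top 0 0
    rwa [h0Q] at this
  have hsuppQ : ∀ x, π 0 x ≠ 0 → h x = 0 := fun x hx =>
    hsupp x fun hxb => hx (cubeIndex_zero_eq_of_mem_ball hR hxb)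
  have hint₁ : ∫⁻ x, ‖h x‖ₑ ∂μ ≠ ⊤ := lintegral_ne_top_of_rpow hQm hQfin
    (fun x hx => by simp [hsuppQ x hx]) hp hhp
  have hint : Integrable h μ := ⟨hm.aestronglyMeasurable, lt_top_iff_ne_top.2 hint₁⟩
  have hmeanQ : ∫ x in π 0 ⁻¹' {0}, h x ∂μ = 0 := by
    have h1 := setIntegral_eq_integral_of_forall_compl_eq_zero (μ := μ) (s := Q) (f := h)
      fun x hx => hsuppQ x hx
    rw [← hQ, h1, hmean]
  set M : Rn n → ℝ≥0∞ := cellMaximal μ π h with hM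
  have hMm : Measurable M := NP.measurable_cellMaximal
  have hM0 : ∀ x, π 0 x ≠ 0 → M x = 0 := fun x hx => NP.cellMaximal_eq_zero hsuppQ hx
  have hMpfin : ∫⁻ x, M x ^ p ∂μ ≠ ⊤ :=
    ((hMp π _ NP h hm hint₁).trans_lt (ENNReal.mul_lt_top (lt_top_iff_ne_top.2 hCp)
      (lt_top_iff_ne_top.2 hhp))).ne
  have hMfin : ∫⁻ x, M x ∂μ ≠ ⊤ := lintegral_ne_top_of_rpow hQm hQfin hM0 hp hMpfin
  have hhM : ∀ᵐ x ∂μ, ‖h x‖ₑ ≤ M x := ae_enorm_le_cellMaximal hn hR hint.locallyIntegrable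
  rcases eq_or_ne (cellAvg μ π h 0 0) 0 with hA0 | hA0
  · -- `h` vanishes almost everywhere
    have hh0 : h =ᵐ[volume] 0 := by
      have h1 : ∫⁻ x, ‖h x‖ₑ ∂μ = 0 := by
        rw [cellAvg, h0Q, ENNReal.div_eq_zero_iff] at hA0
        have h2 := hA0.resolve_right hQfin
        rwa [← lintegral_indicator hQm, indicator_eq_self.2] at h2
        intro x hx
        by_contra hxQ
        exact hx (by simp [hsuppQ x hxQ])
      have h2 := (lintegral_eq_zero_iff hm.enorm).1 h1
      filter_upwards [h2] with x hx
      simpa using hx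
    refine ⟨0, 0, 0, ⟨by simp, by simp [hp0], ?_, ?_⟩, fun i => measurable_const,
      fun i => ⟨0, by simp⟩, 0, by simp⟩
    · simp only [Finset.range_zero, Finset.sum_empty, sub_zero]
      rw [grandMaximal_congr P hh0]
      simp [grandMaximal_zero]
    · simp only [Finset.range_zero, Finset.sum_empty, sub_zero]
      rw [lintegral_congr_ae (g := fun _ => 0)]
      · simp
      · filter_upwards [hh0] with x hx
        simp [hx, hp0]
  have hAtop : cellAvg μ π h 0 0 ≠ ⊤ := by
    rw [cellAvg]
    exact ENNReal.div_ne_top ((setLIntegral_le_lintegral _ _).trans_lt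
      (lt_top_iff_ne_top.2 hint₁)).ne (NP.pos 0 0)
  -- Below the height of the average over the initial cube the good part is the mean of `h`, which
  -- is zero; this is where the sum over the heights starts.
  obtain ⟨k₀, hk₀, hk₀'⟩ := exists_dyadicLevel_lt_le hA0 hAtop
  have hD : (1 : ℝ≥0∞) ≤ 2 ^ n := one_le_pow₀ one_le_two
  set lev : ℕ → ℝ≥0∞ := fun i => dyadicLevel (k₀ + i) with hlev
  have hlev_pos : ∀ i, lev i ≠ 0 := fun i => (dyadicLevel_pos _).ne'
  have hlev_top : ∀ i, lev i ≠ ⊤ := fun i => dyadicLevel_ne_top _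
  have hlev_succ : ∀ i, lev (i + 1) = 2 * lev i := fun i => by
    rw [hlev]
    simp only
    rw [← dyadicLevel_succ, Nat.cast_succ, add_assoc]
  have hlev_mul : ∀ i (a : ℝ), lev i ^ (a - 1) * lev i = lev i ^ a := fun i a =>
    dyadicLevel_rpow_sub_one_mul _ a
  have hlev_mono : Monotone lev := fun i j hij => dyadicLevel_mono (by simpa using hij)
  have h0lev : ∀ i x, cellAvg μ π h 0 x ≤ 2 ^ n * lev i := by
    intro i x
    by_cases hx : π 0 x = 0
    · rw [cellAvg_congr (hx.trans h0Q.symm)]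
      refine hk₀'.trans ?_
      rw [dyadicLevel_succ]
      refine mul_le_mul' ?_ (dyadicLevel_mono (by simp))
      conv_lhs => rw [← pow_one (2 : ℝ≥0∞)]
      exact pow_le_pow_right₀ one_le_two hn
    · exact (le_iSup (fun m => cellAvg μ π h m x) 0).trans ((hM0 x hx).trans_le zero_le)
  set g : ℕ → Rn n → ℂ := fun i => goodPart μ π h (lev i) with hg
  have hgm : ∀ i, Measurable (g i) := fun i => NP.measurable_goodPart hm _
  have hg0 : ∀ x, g 0 x = 0 := fun x => NP.goodPart_eq_zero hsuppQ hmeanQ (fun y hy => by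
    rw [cellAvg_congr (hy.trans h0Q.symm)]
    simpa [hlev] using hk₀) x
  set u : ℕ → Rn n → ℂ := fun i => g (i + 1) - g i with hu
  have hum : ∀ i, Measurable (u i) := fun i => (hgm _).sub (hgm _)
  have hsumu : ∀ N x, ∑ i ∈ Finset.range N, u i x = g N x := fun N x => by
    simp_rw [hu, Pi.sub_apply]
    rw [Finset.sum_range_sub (fun i => g i x), hg0, sub_zero]
  have hubd : ∀ᵐ x ∂μ, ∀ i, ‖u i x‖ₑ
      ≤ 2 ^ n * 3 * (Iio (M x)).indicator (fun a => a) (lev i) := by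
    filter_upwards [hhM] with x hx i
    have h1 := NP.enorm_goodPart_sub_le hD (le_mul_of_one_le_left zero_le one_le_two)
      (h0lev i) hx (l' := 2 * lev i)
    rw [← hlev_succ] at h1
    refine h1.trans ?_
    by_cases hxi : lev i < M x
    · rw [indicator_of_mem (by exact hxi), indicator_of_mem (mem_Iio.2 hxi), hlev_succ]
      exact le_of_eq (by ring)
    · rw [indicator_of_notMem (by exact hxi)]
      exact zero_le
  have hHardy : ∀ i, ∫⁻ x, grandMaximal P (u i) x ≤ C₁ * (lev i * μ {x | lev i < M x}) := by
    intro i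
    have h1 := hH R h (lev i) hR hm hint (hlev_pos i) (hlev_top i) (h0lev i)
    rwa [← hlev_succ] at h1
  -- The sum over the layers is a dyadic sum, so that its tails provide a small error in `H¹`.
  have hsum1 : ∑' i, lev i * μ {x | lev i < M x} ≠ ⊤ := by
    have h1 := lintegral_dyadicSum (μ := μ) hMm 1
    simp only [ENNReal.rpow_one] at h1
    have h2 := ENNReal.tsum_int_add_natCast_le
      (fun k => dyadicLevel k * μ {x | dyadicLevel k < M x}) k₀
    rw [← h1] at h2
    refine (h2.trans_lt ((lintegral_mono fun x => hS₃le (M x)).trans_lt ?_)).ne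
    simp only [ENNReal.rpow_one]
    rw [lintegral_const_mul' _ _ hS₃]
    exact ENNReal.mul_lt_top (lt_top_iff_ne_top.2 hS₃) (lt_top_iff_ne_top.2 hMfin)
  have hsumL1 : ∀ N, ∑' i, ∫⁻ x, ‖u (i + N) x‖ₑ ∂μ ≠ ⊤ := by
    intro N
    have h1 : ∀ i, ∫⁻ x, ‖u i x‖ₑ ∂μ ≤ 2 ^ n * 3 * (lev i * μ {x | lev i < M x}) := by
      intro i
      calc ∫⁻ x, ‖u i x‖ₑ ∂μ
          ≤ ∫⁻ x, 2 ^ n * 3 * {x | lev i < M x}.indicator (fun _ => lev i) x ∂μ :=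
            lintegral_mono_ae (hubd.mono fun x hx => hx i)
        _ = _ := by
            rw [lintegral_const_mul' _ _ (by finiteness), lintegral_indicator_const
              (measurableSet_lt measurable_const hMm)]
    refine (((ENNReal.tsum_le_tsum fun i => h1 (i + N)).trans
      (ENNReal.tsum_comp_le_tsum_of_injective (add_left_injective N)
        (fun i => 2 ^ n * 3 * (lev i * μ {x | lev i < M x})))).trans_lt ?_).ne
    rw [ENNReal.tsum_mul_left]
    exact ENNReal.mul_lt_top (by finiteness) (lt_top_iff_ne_top.2 hsum1)
  have herr : ∀ᵐ x ∂μ, ∀ N, h x - g N x = ∑' i, u (i + N) x := by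
    filter_upwards [ae_lt_top hMm hMfin] with x hx N
    obtain ⟨L, hL⟩ := exists_lt_dyadicLevel k₀ hx.ne
    have h1 : ∀ i, L ≤ i → g i x = h x := fun i hi =>
      goodPart_of_le (hL.le.trans (hlev_mono hi))
    rw [tsum_eq_sum (s := Finset.range L)]
    · have h2 := Finset.sum_range_sub (fun i => g (i + N) x) L
      simp only [zero_add] at h2
      rw [← h1 (L + N) (by simp), ← h2]
      refine Finset.sum_congr rfl fun i _ => ?_
      rw [add_right_comm]
      rfl
    · intro i hi
      have hi' : L ≤ i := by simpa using hi
      change g (i + N + 1) x - g (i + N) x = 0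
      rw [h1 _ (by omega), h1 _ (by omega), sub_self]
  have herrH : Tendsto (fun N => C₁ * ∑' i, lev (i + N) * μ {x | lev (i + N) < M x}) atTop
      (𝓝 0) := by
    have h1 := ENNReal.Tendsto.const_mul (a := C₁) (ENNReal.tendsto_sum_nat_add _ hsum1)
      (Or.inr hC₁)
    rwa [mul_zero] at h1
  -- In `L^p` the error lives on the set where `M` is large and is dominated by a multiple of `M`.
  have herrP : Tendsto (fun N => ∫⁻ x, {x | lev N < M x}.indicator
      (fun x => ((1 + 2 ^ n) * M x) ^ p) x ∂μ) atTop (𝓝 0) := by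
    have h1 := tendsto_lintegral_of_dominated_convergence (μ := μ) (f := fun _ => 0)
      (F := fun N x => {x | lev N < M x}.indicator (fun x => ((1 + 2 ^ n) * M x) ^ p) x)
      (fun x => ((1 + 2 ^ n) * M x) ^ p)
      (fun N => ((hMm.const_mul _).pow_const p).indicator (measurableSet_lt measurable_const hMm))
      (fun N => Eventually.of_forall fun x => indicator_le_self _ _ _) ?_ ?_
    · simpa using h1
    · simp_rw [ENNReal.mul_rpow_of_nonneg _ _ hp0.le]
      rw [lintegral_const_mul' _ _ (ENNReal.rpow_ne_top_of_nonneg hp0.le (by finiteness))]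
      exact ENNReal.mul_ne_top (ENNReal.rpow_ne_top_of_nonneg hp0.le (by finiteness)) hMpfin
    · filter_upwards [ae_lt_top hMm hMfin] with x hx
      obtain ⟨L, hL⟩ := exists_lt_dyadicLevel k₀ hx.ne
      refine tendsto_const_nhds.congr' ?_
      filter_upwards [eventually_ge_atTop L] with N hN
      rw [indicator_of_notMem]
      exact not_lt.2 (hL.le.trans (hlev_mono hN))
  obtain ⟨N, hN₁, hN₂⟩ := ((herrH.eventually_lt_const hε).and
    (herrP.eventually_lt_const hε)).exists
  refine ⟨k₀, N, u, ⟨?_, ?_, ?_, ?_⟩, hum, fun i => ?_, n * (2 * R), fun i x hx => ?_⟩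
  · calc ∑ i ∈ Finset.range N, lev i ^ (q - 1) * ∫⁻ x, grandMaximal P (u i) x
        ≤ ∑ i ∈ Finset.range N, C₁ * (lev i ^ q * μ {x | lev i < M x}) := by
          refine Finset.sum_le_sum fun i _ => ?_
          rw [← hlev_mul i q]
          calc _ ≤ lev i ^ (q - 1) * (C₁ * (lev i * μ {x | lev i < M x})) :=
                mul_le_mul' le_rfl (hHardy i)
            _ = _ := by ring
      _ ≤ ∑' i : ℕ, C₁ * (lev i ^ q * μ {x | lev i < M x}) := ENNReal.sum_le_tsum _
      _ ≤ C₁ * ∫⁻ x, dyadicSum q (M x) ∂μ := by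
          rw [ENNReal.tsum_mul_left, lintegral_dyadicSum hMm]
          exact mul_le_mul' le_rfl (ENNReal.tsum_int_add_natCast_le
            (fun k => dyadicLevel k ^ q * μ {x | dyadicLevel k < M x}) k₀)
      _ ≤ C₁ * (S₁ * (Cq * ∫⁻ x, ‖h x‖ₑ ^ q ∂μ)) := by
          refine mul_le_mul' le_rfl ((lintegral_mono fun x => hS₁le (M x)).trans ?_)
          rw [lintegral_const_mul' _ _ hS₁]
          exact mul_le_mul' le_rfl (hMq π _ NP h hm hint₁)
      _ ≤ _ := by
          rw [add_mul]
          exact le_trans (le_of_eq (by ring)) le_self_add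
  · have hpt : ∀ᵐ x ∂μ, (∑ i ∈ Finset.range N, lev i ^ (q / p - 1) * ‖u i x‖ₑ) ^ p
        ≤ (2 ^ n * 3 * S₂) ^ p * M x ^ q := by
      filter_upwards [hubd] with x hx
      have h1 : ∑ i ∈ Finset.range N, lev i ^ (q / p - 1) * ‖u i x‖ₑ
          ≤ 2 ^ n * 3 * (S₂ * M x ^ (q / p)) := by
        calc _ ≤ ∑ i ∈ Finset.range N,
              2 ^ n * 3 * (Iio (M x)).indicator (fun a => a ^ (q / p)) (lev i) := by
              refine Finset.sum_le_sum fun i _ => ?_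
              refine (mul_le_mul' le_rfl (hx i)).trans ?_
              by_cases hxi : lev i < M x
              · rw [indicator_of_mem (mem_Iio.2 hxi), indicator_of_mem (mem_Iio.2 hxi),
                  ← hlev_mul i (q / p)]
                exact le_of_eq (by ring)
              · simp [indicator_of_notMem (notMem_Iio.2 (not_lt.1 hxi))]
          _ ≤ ∑' i : ℕ, 2 ^ n * 3 * (Iio (M x)).indicator (fun a => a ^ (q / p)) (lev i) :=
              ENNReal.sum_le_tsum _
          _ ≤ 2 ^ n * 3 * dyadicSum (q / p) (M x) := by
              rw [ENNReal.tsum_mul_left]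
              exact mul_le_mul' le_rfl (ENNReal.tsum_int_add_natCast_le
                (fun k => (Iio (M x)).indicator (fun a => a ^ (q / p)) (dyadicLevel k)) k₀)
          _ ≤ _ := mul_le_mul' le_rfl (hS₂le _)
      calc _ ≤ (2 ^ n * 3 * (S₂ * M x ^ (q / p))) ^ p := ENNReal.rpow_le_rpow h1 hp0.le
        _ = _ := by
          rw [← mul_assoc, ENNReal.mul_rpow_of_nonneg _ _ hp0.le, ← ENNReal.rpow_mul,
            div_mul_cancel₀ _ hp0.ne']
    refine (lintegral_mono_ae hpt).trans ?_
    rw [lintegral_const_mul' _ _ (ENNReal.rpow_ne_top_of_nonneg hp0.le (by finiteness)), add_mul]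
    refine (mul_le_mul' le_rfl (hMq π _ NP h hm hint₁)).trans ?_
    rw [← mul_assoc]
    exact le_add_self
  · simp_rw [hsumu]
    refine le_trans ?_ hN₁.le
    calc _ ≤ ∫⁻ x, ∑' i, grandMaximal P (u (i + N)) x :=
          lintegral_mono (grandMaximal_tsum_le hn (fun i => (hum _).aestronglyMeasurable)
            (hsumL1 N) (herr.mono fun x hx => hx N))
      _ = ∑' i, ∫⁻ x, grandMaximal P (u (i + N)) x :=
          lintegral_tsum fun i => (lowerSemicontinuous_grandMaximal P _).measurable.aemeasurable
      _ ≤ _ := by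
          rw [← ENNReal.tsum_mul_left]
          exact ENNReal.tsum_le_tsum fun i => hHardy _
  · simp_rw [hsumu]
    refine (lintegral_mono_ae ?_).trans hN₂.le
    filter_upwards [hhM] with x hx
    by_cases hxN : lev N < M x
    · rw [indicator_of_mem (by exact hxN)]
      refine ENNReal.rpow_le_rpow (enorm_sub_le.trans ?_) hp0.le
      rw [add_mul, one_mul]
      refine add_le_add hx ((NP.enorm_goodPart_le (h0lev N) hxN).trans ?_)
      gcongr
    · rw [hg]
      simp only
      rw [goodPart_of_le (not_lt.1 hxN), sub_self, enorm_zero, ENNReal.zero_rpow_of_pos hp0]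
      exact zero_le
  · refine ⟨(2 ^ n * 3 * lev i).toReal, ?_⟩
    filter_upwards [hubd] with x hx
    have h1 : 2 ^ n * 3 * lev i ≠ ⊤ := ENNReal.mul_ne_top (by finiteness) (hlev_top i)
    rw [← ENNReal.ofReal_le_iff_le_toReal h1, ofReal_norm]
    exact (hx i).trans (mul_le_mul' le_rfl (indicator_le_self _ _ _))
  · refine goodPart_sub_eq_zero (hlev_mono (Nat.le_succ i)) ?_
    rw [show cellMaximal μ π h x = 0 from hM0 x fun hxQ => hx ?_]
    · exact zero_le
    · have h1 := dist_le_of_cubeIndex_eq hR (m := 0) (hxQ.trans h0Q.symm)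
      simpa using h1

end Decomposition

/-! ### Mollification -/

section Mollification

variable {n : ℕ}

/-- A mollifying kernel: a smooth compactly supported function whose absolute value is a probability
density. No sign is imposed, since the norm estimates do not depend on it. -/
structure IsMollifier (η : Rn n → ℝ) : Prop where
  contDiff : ContDiff ℝ ∞ η
  hasCompactSupport : HasCompactSupport η
  lintegral_enorm : ∫⁻ s, ‖η s‖ₑ = 1

/-- The mollification `η ⋆ u`. -/
noncomputable def mollify (η : Rn n → ℝ) (u : Rn n → ℂ) : Rn n → ℂ :=
  convolution η u (ContinuousLinearMap.lsmul ℝ ℝ) volume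

theorem mollify_apply (η : Rn n → ℝ) (u : Rn n → ℂ) (x : Rn n) :
    mollify η u x = ∫ s, η s • u (x - s) := rfl

variable {η : Rn n → ℝ}

theorem IsMollifier.contDiff_mollify (h : IsMollifier η) {u : Rn n → ℂ}
    (hu : LocallyIntegrable u) : ContDiff ℝ ∞ (mollify η u) :=
  h.hasCompactSupport.contDiff_convolution_left _ h.contDiff hu

/-- Mollification commutes with convolution by test functions. -/
theorem IsMollifier.convDilate_mollify (h : IsMollifier η) {P : MaximalParams} {u φ : Rn n → ℂ}
    (hu : LocallyIntegrable u) (hφ : φ ∈ testFunctions n P) {t : ℝ} (ht : 0 < t) (y : Rn n) :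
    convDilate (mollify η u) φ t y = ∫ s, η s • convDilate u φ t (y - s) := by
  have hd := hasCompactSupport_dilate (testFunctions_compact hφ) ht
  have hdc := continuous_dilate hφ.1.continuous t
  have hun : LocallyIntegrable fun x => ‖u x‖ := fun x => (hu x).norm
  refine convolution_assoc (ContinuousLinearMap.lsmul ℝ ℝ) (ContinuousLinearMap.mul ℝ ℂ)
    (ContinuousLinearMap.lsmul ℝ ℝ) (ContinuousLinearMap.mul ℝ ℂ) (fun x y z => ?_)
    h.contDiff.continuous.aestronglyMeasurable hu.aestronglyMeasurable hdc.aestronglyMeasurable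
    (Eventually.of_forall fun x => h.hasCompactSupport.convolutionExists_left _
      h.contDiff.continuous hu x)
    (Eventually.of_forall fun x => hd.norm.convolutionExists_right _ hun hdc.norm x) ?_
  · simp [mul_assoc]
  · exact h.hasCompactSupport.norm.convolutionExists_left _ h.contDiff.continuous.norm
      (hd.norm.continuous_convolution_right _ hun hdc.norm).locallyIntegrable y

theorem IsMollifier.grandMaximal_mollify_le (h : IsMollifier η) {P : MaximalParams} {u : Rn n → ℂ}
    (hu : LocallyIntegrable u) (x : Rn n) :
    grandMaximal P (mollify η u) x ≤ ∫⁻ s, ‖η s‖ₑ * grandMaximal P u (x - s) := by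
  refine grandMaximal_le fun φ hφ t ht y hy => ?_
  rw [h.convDilate_mollify hu hφ ht]
  refine (enorm_integral_le_lintegral_enorm _).trans (lintegral_mono fun s => ?_)
  rw [enorm_smul]
  gcongr
  exact le_grandMaximal u hφ ht (by rwa [dist_sub_right])

/-- Convolution with `|η|` preserves integrals. -/
theorem IsMollifier.lintegral_lintegral (h : IsMollifier η) {G : Rn n → ℝ≥0∞}
    (hG : Measurable G) : ∫⁻ x, ∫⁻ s, ‖η s‖ₑ * G (x - s) = ∫⁻ x, G x := by
  have hη := h.contDiff.continuous.measurable
  rw [lintegral_lintegral_swap (by fun_prop)]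
  calc _ = ∫⁻ s, ‖η s‖ₑ * ∫⁻ x, G x := by
        refine lintegral_congr fun s => ?_
        rw [lintegral_const_mul _ (by fun_prop), lintegral_sub_right_eq_self]
    _ = _ := by rw [lintegral_mul_const _ (by fun_prop), h.lintegral_enorm, one_mul]

theorem IsMollifier.lintegral_grandMaximal_le (h : IsMollifier η) (P : MaximalParams)
    {u : Rn n → ℂ} (hu : LocallyIntegrable u) :
    ∫⁻ x, grandMaximal P (mollify η u) x ≤ ∫⁻ x, grandMaximal P u x :=
  (lintegral_mono (h.grandMaximal_mollify_le hu)).trans_eq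
    (h.lintegral_lintegral (lowerSemicontinuous_grandMaximal P u).measurable)

/-- Jensen's inequality for the probability density `|η|`. -/
theorem IsMollifier.lintegral_rpow_le (h : IsMollifier η) {G : Rn n → ℝ≥0∞}
    (hG : Measurable G) {p : ℝ} (hp : 1 ≤ p) :
    (∫⁻ s, ‖η s‖ₑ * G s) ^ p ≤ ∫⁻ s, ‖η s‖ₑ * G s ^ p := by
  have hη : Measurable fun s => ‖η s‖ₑ := h.contDiff.continuous.measurable.enorm
  have h1 : IsProbabilityMeasure (volume.withDensity fun s => ‖η s‖ₑ) :=
    ⟨by rw [withDensity_apply _ MeasurableSet.univ, Measure.restrict_univ, h.lintegral_enorm]⟩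
  have h2 := eLpNorm'_le_eLpNorm'_of_exponent_le one_pos hp
    (volume.withDensity fun s => ‖η s‖ₑ) hG.aestronglyMeasurable
  simp only [eLpNorm', ENNReal.rpow_one, ne_eq, one_ne_zero, not_false_eq_true, div_self,
    enorm_eq_self] at h2
  rw [lintegral_withDensity_eq_lintegral_mul _ hη hG,
    lintegral_withDensity_eq_lintegral_mul _ hη (hG.pow_const p)] at h2
  have h3 := ENNReal.rpow_le_rpow h2 (zero_le_one.trans hp)
  rw [← ENNReal.rpow_mul, one_div, inv_mul_cancel₀ (by positivity), ENNReal.rpow_one] at h3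
  exact h3

/-- Young's inequality for mollification, for weighted sums of absolute values. -/
theorem IsMollifier.lintegral_sum_rpow_le (h : IsMollifier η) {ι : Type*} (S : Finset ι)
    (a : ι → ℝ≥0∞) {u : ι → Rn n → ℂ} (hu : ∀ i, Measurable (u i)) {p : ℝ} (hp : 1 ≤ p) :
    ∫⁻ x, (∑ i ∈ S, a i * ‖mollify η (u i) x‖ₑ) ^ p ≤ ∫⁻ x, (∑ i ∈ S, a i * ‖u i x‖ₑ) ^ p := by
  have hη := h.contDiff.continuous.measurable
  have hG : Measurable fun x => ∑ i ∈ S, a i * ‖u i x‖ₑ := by fun_prop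
  rw [← h.lintegral_lintegral (hG.pow_const p)]
  refine lintegral_mono fun x => ?_
  refine le_trans (ENNReal.rpow_le_rpow ?_ (zero_le_one.trans hp))
    (h.lintegral_rpow_le (G := fun s => ∑ i ∈ S, a i * ‖u i (x - s)‖ₑ) (by fun_prop) hp)
  simp_rw [Finset.mul_sum]
  rw [lintegral_finsetSum _ fun i _ => by fun_prop]
  refine Finset.sum_le_sum fun i _ => ?_
  calc _ ≤ a i * ∫⁻ s, ‖η s‖ₑ * ‖u i (x - s)‖ₑ := by
        gcongr
        refine (enorm_integral_le_lintegral_enorm _).trans_eq ?_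
        exact lintegral_congr fun s => enorm_smul (η s) (u i (x - s))
    _ = _ := by
        rw [← lintegral_const_mul _ (by fun_prop)]
        exact lintegral_congr fun s => mul_left_comm _ _ _

theorem exists_isMollifier_norm_sub_le {h : Rn n → ℂ} (hc : Continuous h)
    (hs : HasCompactSupport h) {δ : ℝ} (hδ : 0 < δ) :
    ∃ η : Rn n → ℝ, IsMollifier η ∧ Function.support η ⊆ Metric.ball 0 1 ∧
      ∀ x, ‖h x - mollify η h x‖ ≤ δ := by
  obtain ⟨r, hr, hr'⟩ := 
    Metric.uniformContinuous_iff.1 (hs.uniformContinuous_of_continuous hc) δ hδ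
  have hm : 0 < min r 1 := lt_min hr one_pos
  let φ : ContDiffBump (0 : Rn n) := ⟨min r 1 / 2, min r 1, half_pos hm, half_lt_self hm⟩
  refine ⟨φ.normed volume, ⟨φ.contDiff_normed, φ.hasCompactSupport_normed, ?_⟩, ?_, fun x => ?_⟩
  · have h1 := ofReal_integral_eq_lintegral_ofReal (φ.integrable_normed (μ := volume))
      (Eventually.of_forall φ.nonneg_normed)
    rw [φ.integral_normed, ENNReal.ofReal_one] at h1
    rw [h1]
    exact lintegral_congr fun s => Real.enorm_of_nonneg (φ.nonneg_normed s)
  · rw [φ.support_normed_eq]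
    exact Metric.ball_subset_ball (min_le_right _ _)
  · rw [← dist_eq_norm, dist_comm]
    refine φ.dist_normed_convolution_le hc.aestronglyMeasurable fun y hy => (hr' ?_).le
    exact (Metric.mem_ball.1 hy).trans_le (min_le_left _ _)

theorem IsMollifier.mollify_sub_sum {η : Rn n → ℝ} (h : IsMollifier η) {ι : Type*} (S : Finset ι)
    {f : Rn n → ℂ} (hf : LocallyIntegrable f) {u : ι → Rn n → ℂ}
    (hu : ∀ i, LocallyIntegrable (u i)) (x : Rn n) :
    mollify η (fun y => f y - ∑ i ∈ S, u i y) x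
      = mollify η f x - ∑ i ∈ S, mollify η (u i) x := by
  have hint : ∀ g : Rn n → ℂ, LocallyIntegrable g → Integrable fun s => η s • g (x - s) :=
    fun g hg => h.hasCompactSupport.convolutionExists_left (ContinuousLinearMap.lsmul ℝ ℝ)
      h.contDiff.continuous hg x
  simp only [mollify_apply, smul_sub, Finset.smul_sum]
  rw [integral_sub (hint f hf) (integrable_finsetSum _ fun i _ => hint _ (hu i)),
    integral_finsetSum _ fun i _ => hint _ (hu i)]

theorem mollify_eq_zero {u : Rn n → ℂ} {R : ℝ} (hη : Function.support η ⊆ Metric.ball 0 1)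
    (hu : ∀ x ∉ Metric.closedBall 0 R, u x = 0) {x : Rn n} (hx : x ∉ Metric.closedBall 0 (R + 1)) :
    mollify η u x = 0 := by
  rw [mollify_apply]
  refine integral_eq_zero_of_ae (Eventually.of_forall fun s => ?_)
  by_cases h1 : s ∈ Function.support η
  · have h2 := mem_ball_zero_iff.1 (hη h1)
    rw [mem_closedBall_zero_iff, not_le] at hx
    have h3 := norm_sub_norm_le x s
    simp only [hu (x - s) (by rw [mem_closedBall_zero_iff, not_le]; linarith), smul_zero,
      Pi.zero_apply]
  · simp [Function.notMem_support.1 h1]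

/-- Mollifying a continuous compactly supported function of mean zero changes it little, in `H¹` as
well as in `L^p`: the difference is a small atom. -/
theorem exists_isMollifier_error_le (hn : 0 < n) (P : MaximalParams) {p : ℝ} (hp : 0 < p)
    {h : Rn n → ℂ} {R : ℝ} (hR : 0 < R) (hc : Continuous h)
    (hs : ∀ x ∉ Metric.closedBall 0 R, h x = 0) (h0 : ∫ x, h x = 0) {ε : ℝ≥0∞} (hε : 0 < ε) :
    ∃ η : Rn n → ℝ, IsMollifier η ∧ Function.support η ⊆ Metric.ball 0 1 ∧
      ∫⁻ x, grandMaximal P (h - mollify η h) x ≤ ε ∧ ∫⁻ x, ‖h x - mollify η h x‖ₑ ^ p ≤ ε := by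
  obtain ⟨C, hC, hatom⟩ := exists_lintegral_grandMaximal_atom_le hn P
  have hcs : HasCompactSupport h := HasCompactSupport.intro (isCompact_closedBall (0 : Rn n) R) hs
  set B := Metric.closedBall (0 : Rn n) (R + 1) with hB
  have hBt : volume B ≠ ⊤ := measure_closedBall_lt_top.ne
  have hlim₁ : Tendsto (fun δ : ℝ => C * ENNReal.ofReal (δ * (R + 1) ^ n)) (𝓝[>] 0) (𝓝 0) := by
    have h1 : Tendsto (fun δ : ℝ => ENNReal.ofReal (δ * (R + 1) ^ n)) (𝓝 0) (𝓝 0) := by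
      have : Continuous fun δ : ℝ => ENNReal.ofReal (δ * (R + 1) ^ n) :=
        ENNReal.continuous_ofReal.comp (by fun_prop)
      simpa using this.tendsto 0
    simpa using (ENNReal.Tendsto.const_mul h1 (Or.inr hC)).mono_left nhdsWithin_le_nhds
  have hlim₂ : Tendsto (fun δ : ℝ => ENNReal.ofReal δ ^ p * volume B) (𝓝[>] 0) (𝓝 0) := by
    have h1 : Tendsto (fun δ : ℝ => ENNReal.ofReal δ ^ p) (𝓝 0) (𝓝 0) := by
      have : Continuous fun δ : ℝ => ENNReal.ofReal δ ^ p :=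
        (ENNReal.continuous_rpow_const).comp ENNReal.continuous_ofReal
      simpa [hp] using this.tendsto 0
    simpa using (ENNReal.Tendsto.mul_const h1 (Or.inr hBt)).mono_left nhdsWithin_le_nhds
  obtain ⟨δ, ⟨hδ₁, hδ₂⟩, hδ⟩ := (((hlim₁.eventually_le_const hε).and
    (hlim₂.eventually_le_const hε)).and self_mem_nhdsWithin).exists
  have hδ : 0 < δ := hδ
  obtain ⟨η, hη, hηs, hηδ⟩ := exists_isMollifier_norm_sub_le hc hcs hδ
  have hz : ∀ x ∉ B, h x - mollify η h x = 0 := by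
    intro x hx
    rw [mollify_eq_zero hηs hs hx, hs x fun h1 => hx (Metric.closedBall_subset_closedBall
      (by linarith) h1), sub_zero]
  have hmc : Continuous (mollify η h) := (hη.contDiff_mollify hc.locallyIntegrable).continuous
  have hηi : Integrable η := hη.contDiff.continuous.integrable_of_hasCompactSupport
    hη.hasCompactSupport
  have hhi : Integrable h := hc.integrable_of_hasCompactSupport hcs
  refine ⟨η, hη, hηs, ?_, ?_⟩
  · refine (hatom _ 0 (R + 1) δ (by positivity) hδ.le (hc.sub hmc).aestronglyMeasurable
      (Eventually.of_forall hηδ) hz ?_).trans hδ₁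
    have h2 : ∫ x, mollify η h x = 0 := by
      unfold mollify
      rw [integral_convolution _ hηi hhi, h0, map_zero]
    have h3 : Integrable (mollify η h) := hηi.integrable_convolution _ hhi
    simp only [Pi.sub_apply]
    rw [integral_sub hhi h3, h0, h2, sub_zero]
  · refine le_trans ?_ hδ₂
    rw [← lintegral_indicator_const Metric.isClosed_closedBall.measurableSet]
    refine lintegral_mono fun x => ?_
    by_cases hx : x ∈ B
    · rw [indicator_of_mem hx, ← ofReal_norm]
      gcongr
      exact hηδ x
    · rw [hz x hx, enorm_zero, ENNReal.zero_rpow_of_pos hp]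
      exact zero_le

/-- The layers of a continuous function can be chosen smooth: mollification increases neither the
`H¹` norm of the layers nor the `L^p` norm of their weighted sum, and changes `h` itself little. -/
theorem exists_contDiff_isLayerDecomposition (hn : 0 < n) (P : MaximalParams) {p q : ℝ} (hq : 1 < q)
    (hqp : q < p) : ∃ C : ℝ≥0∞, C ≠ ⊤ ∧ ∀ (h : Rn n → ℂ) (R : ℝ), 0 < R → Continuous h →
      (∀ x ∉ Metric.ball 0 R, h x = 0) → ∫ x, h x = 0 → ∀ ε : ℝ≥0∞, 0 < ε →
      ∃ (k₀ : ℤ) (N : ℕ) (u : ℕ → Rn n → ℂ),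
        IsLayerDecomposition P p q (C * ∫⁻ x, ‖h x‖ₑ ^ q) ε h k₀ N u ∧
        (∀ i, ContDiff ℝ ∞ (u i)) ∧ ∀ i, HasCompactSupport (u i) := by
  have hp : 1 < p := hq.trans hqp
  have hp0 : 0 < p := one_pos.trans hp
  obtain ⟨C, hC, hdec⟩ := exists_isLayerDecomposition hn P hq hqp
  refine ⟨C, hC, fun h R hR hc hs h0 ε hε => ?_⟩
  have hs' : ∀ x ∉ Metric.closedBall 0 R, h x = 0 := fun x hx => hs x fun h1 =>
    hx (Metric.ball_subset_closedBall h1)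
  have hcs : HasCompactSupport h := HasCompactSupport.intro (isCompact_closedBall (0 : Rn n) R) hs'
  have hhi : Integrable h := hc.integrable_of_hasCompactSupport hcs
  have hLp : ∫⁻ x, ‖h x‖ₑ ^ p ≠ ⊤ := by
    have h1 := (hc.memLp_of_hasCompactSupport (μ := volume) (p := ENNReal.ofReal p) hcs).2
    have h2 := lintegral_rpow_enorm_lt_top_of_eLpNorm_lt_top (by simpa) ENNReal.ofReal_ne_top h1
    rw [ENNReal.toReal_ofReal hp0.le] at h2
    exact h2.ne
  -- The error in `L^p` is a sum of two terms, and `(a + b) ^ p ≤ 2 ^ (p - 1) * (a ^ p + b ^ p)`.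
  set ε' : ℝ≥0∞ := min (ε / 2) (ε / 2 ^ p) with hε'
  have hε'0 : 0 < ε' := lt_min (ENNReal.div_pos hε.ne' (by simp))
    (ENNReal.div_pos hε.ne' (by finiteness))
  obtain ⟨k₀, N, u, hu, hum, hub, R', hus⟩ := hdec h R hR hc.measurable hs h0 hLp ε' hε'0
  obtain ⟨η, hη, hηs, hη₁, hη₂⟩ := exists_isMollifier_error_le hn P hp0 hR hc hs' h0 hε'0
  have hui : ∀ i, LocallyIntegrable (u i) := by
    intro i
    obtain ⟨B, hB⟩ := hub i
    have h1 : IntegrableOn (u i) (Metric.closedBall 0 R') :=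
      Measure.integrableOn_of_bounded measure_closedBall_lt_top.ne
        (hum i).aestronglyMeasurable (ae_restrict_of_ae hB)
    refine ((integrableOn_iff_integrable_of_support_subset fun x hx => ?_).1 h1).locallyIntegrable
    by_contra hx'
    exact hx (hus i x hx')
  have hhl := hc.locallyIntegrable (μ := volume)
  have hrem : LocallyIntegrable fun x => h x - ∑ i ∈ Finset.range N, u i x :=
    hhl.sub (locallyIntegrable_finsetSum _ fun i _ => hui i)
  have hdiff : (fun x => h x - ∑ i ∈ Finset.range N, mollify η (u i) x)
      = (h - mollify η h) + mollify η (fun x => h x - ∑ i ∈ Finset.range N, u i x) := by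
    funext x
    simp only [Pi.add_apply, Pi.sub_apply, hη.mollify_sub_sum _ hhl hui]
    ring
  have hmh := (hη.contDiff_mollify hhl).continuous
  have hmr := (hη.contDiff_mollify hrem).continuous
  refine ⟨k₀, N, fun i => mollify η (u i), ⟨?_, ?_, ?_, ?_⟩, fun i => hη.contDiff_mollify (hui i),
    fun i => HasCompactSupport.convolution _ hη.hasCompactSupport
      (HasCompactSupport.intro (isCompact_closedBall 0 R') (hus i))⟩
  · refine le_trans (Finset.sum_le_sum fun i _ => ?_) hu.hardy_le
    exact mul_le_mul' le_rfl (hη.lintegral_grandMaximal_le P (hui i))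
  · exact (hη.lintegral_sum_rpow_le _ _ hum hp.le).trans hu.lp_le
  · rw [hdiff]
    refine (lintegral_mono (grandMaximal_add_le P (hc.sub hmh).locallyIntegrable
      hmr.locallyIntegrable)).trans ?_
    rw [lintegral_add_left (lowerSemicontinuous_grandMaximal P _).measurable]
    refine (add_le_add hη₁ ((hη.lintegral_grandMaximal_le P hrem).trans hu.error_hardy_le)).trans ?_
    calc ε' + ε' ≤ ε / 2 + ε / 2 := add_le_add (min_le_left _ _) (min_le_left _ _)
      _ = ε := ENNReal.add_halves ε
  · have hy := hη.lintegral_sum_rpow_le (ι := Unit) {()} 1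
      (u := fun _ x => h x - ∑ i ∈ Finset.range N, u i x)
      (fun _ => hc.measurable.sub (Finset.measurable_fun_sum _ fun i _ => hum i)) hp.le
    simp only [Finset.sum_singleton, Pi.one_apply, one_mul] at hy
    calc _ ≤ ∫⁻ x, 2 ^ (p - 1) * (‖h x - mollify η h x‖ₑ ^ p
            + ‖mollify η (fun x => h x - ∑ i ∈ Finset.range N, u i x) x‖ₑ ^ p) := by
          refine lintegral_mono fun x => ?_
          refine le_trans ?_ (ENNReal.rpow_add_le_mul_rpow_add_rpow _ _ hp.le)
          refine ENNReal.rpow_le_rpow ?_ hp0.le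
          rw [congrFun hdiff x]
          exact enorm_add_le _ _
      _ ≤ 2 ^ (p - 1) * (ε' + ε') := by
          rw [lintegral_const_mul' _ _ (by finiteness), lintegral_add_left (by fun_prop)]
          gcongr
          exact hy.trans hu.error_lp_le
      _ = 2 ^ p * ε' := by
          rw [← mul_two, ← mul_assoc, mul_comm _ ε', mul_assoc]
          nth_rewrite 2 [← ENNReal.rpow_one 2]
          rw [← ENNReal.rpow_add _ _ (by simp) (by simp), sub_add_cancel, mul_comm]
      _ ≤ 2 ^ p * (ε / 2 ^ p) := by
          gcongr
          exact min_le_right _ _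
      _ ≤ ε := ENNReal.mul_div_le

end Mollification

/-! ### Layer decomposition of general functions -/

section FullDecomposition

variable {n : ℕ} {P : MaximalParams}

/-- A layer decomposition of `h` with small error is a layer decomposition of every function close
to `h` in both endpoint spaces. -/
theorem IsLayerDecomposition.of_sub_le {p q : ℝ} {C : ℝ≥0∞} {f h : Rn n → ℂ} {k₀ : ℤ}
    {N : ℕ} {u : ℕ → Rn n → ℂ} (hd : IsLayerDecomposition P p q C (2⁻¹ ^ p) h k₀ N u) (hp : 1 ≤ p)
    (hf : LocallyIntegrable f) (hh : LocallyIntegrable h) (hu : ∀ i, LocallyIntegrable (u i))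
    (h₁ : ∫⁻ x, grandMaximal P (f - h) x ≤ 2⁻¹)
    (h₂ : eLpNorm (f - h) (ENNReal.ofReal p) volume ≤ 2⁻¹) :
    IsLayerDecomposition P p q C 1 f k₀ N u := by
  have hp0 : 0 < p := one_pos.trans_le hp
  set r : Rn n → ℂ := fun x => h x - ∑ i ∈ Finset.range N, u i x with hr
  have hrl : LocallyIntegrable r := hh.sub (locallyIntegrable_finsetSum _ fun i _ => hu i)
  have hfh : LocallyIntegrable (f - h) := hf.sub hh
  have hsum : (fun x => f x - ∑ i ∈ Finset.range N, u i x) = (f - h) + r := by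
    funext x
    simp [hr]
  have hnorm : ∀ g : Rn n → ℂ,
      eLpNorm g (ENNReal.ofReal p) volume = (∫⁻ x, ‖g x‖ₑ ^ p) ^ (1 / p) := by
    intro g
    rw [eLpNorm_eq_lintegral_rpow_enorm_toReal (by simpa) ENNReal.ofReal_ne_top,
      ENNReal.toReal_ofReal hp0.le]
  refine ⟨hd.hardy_le, hd.lp_le, ?_, ?_⟩
  · rw [hsum]
    refine (lintegral_mono (grandMaximal_add_le P hfh hrl)).trans ?_
    rw [lintegral_add_left (lowerSemicontinuous_grandMaximal P _).measurable,
      ← ENNReal.inv_two_add_inv_two]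
    refine add_le_add h₁ (hd.error_hardy_le.trans ?_)
    exact (ENNReal.rpow_le_rpow_of_exponent_ge (ENNReal.inv_le_one.2 one_le_two) hp).trans_eq
      (ENNReal.rpow_one _)
  · have h3 : eLpNorm r (ENNReal.ofReal p) volume ≤ 2⁻¹ := by
      rw [hnorm]
      refine (ENNReal.rpow_le_rpow hd.error_lp_le (by positivity)).trans_eq ?_
      rw [← ENNReal.rpow_mul, mul_one_div_cancel hp0.ne', ENNReal.rpow_one]
    have h4 := (eLpNorm_add_le hfh.aestronglyMeasurable hrl.aestronglyMeasurable
      (p := ENNReal.ofReal p) (by simpa)).trans (add_le_add h₂ h3)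
    rw [ENNReal.inv_two_add_inv_two, ← hsum, hnorm] at h4
    have h5 := ENNReal.rpow_le_rpow h4 hp0.le
    rwa [← ENNReal.rpow_mul, one_div_mul_cancel hp0.ne', ENNReal.rpow_one, ENNReal.one_rpow] at h5

theorem memLp_of_ae_bound_of_closedBall {u : Rn n → ℂ} (hm : AEStronglyMeasurable u volume)
    {B R : ℝ} (hB : ∀ᵐ x, ‖u x‖ ≤ B) (hs : ∀ x ∉ Metric.closedBall 0 R, u x = 0) (r : ℝ≥0∞) :
    MemLp u r volume := by
  have h1 : IsFiniteMeasure (volume.restrict (Metric.closedBall (0 : Rn n) R)) :=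
    ⟨by rw [Measure.restrict_apply_univ]; exact measure_closedBall_lt_top⟩
  have h2 : MemLp u r (volume.restrict (Metric.closedBall (0 : Rn n) R)) :=
    MemLp.of_bound hm.restrict B (ae_restrict_of_ae hB)
  rw [← memLp_indicator_iff_restrict Metric.isClosed_closedBall.measurableSet,
    indicator_eq_self.2 fun x hx => by_contra fun hx' => hx (hs x hx')] at h2
  exact h2

/-- Truncation to a mean-zero function on a large ball, which changes `f` little in `H¹`, `L^p`
and `L^q` at once. -/
theorem exists_truncate (hn : 0 < n) (P : MaximalParams) {p q : ℝ≥0∞} (hq : 1 ≤ q) (hq' : q ≠ ⊤)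
    (hp : 1 ≤ p) (hp' : p ≠ ⊤) {f : Rn n → ℂ} (hf : LocallyIntegrable f)
    (hfin : ∫⁻ x, grandMaximal P f x ≠ ⊤) (hfp : MemLp f p) (hfq : eLpNorm f q volume = 1) :
    ∃ K R χ, 0 < R ∧ IsCutoff K R χ ∧ ∫⁻ x, grandMaximal P (f - truncate χ f) x ≤ 2⁻¹ ∧
      eLpNorm (f - truncate χ f) p volume ≤ 2⁻¹ ∧
      ∫⁻ x, ‖truncate χ f x‖ₑ ^ q.toReal ≤ 2 ^ q.toReal := by
  obtain ⟨K, hK, hcut⟩ := exists_isCutoff n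
  have h2 : (0 : ℝ≥0∞) < 2⁻¹ := by simp
  have hfq' : MemLp f q := ⟨hf.aestronglyMeasurable, by simp [hfq]⟩
  obtain ⟨R, ⟨⟨h₁, h₂⟩, h₃⟩, hR⟩ :=
    (((eventually_lintegral_grandMaximal_sub_truncate_le hn hK hf hfin h2).and
      (eventually_eLpNorm_sub_truncate_le hn hK hp hp' hfp hfin h2)).and
      (eventually_eLpNorm_sub_truncate_le hn hK hq hq' hfq' hfin one_pos)).and
      (eventually_gt_atTop (0 : ℝ)) |>.exists
  obtain ⟨χ, hχ⟩ := hcut R hR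
  refine ⟨K, R, χ, hR, hχ, h₁ χ hχ, h₂ χ hχ, ?_⟩
  have hq0 : 0 < q.toReal := ENNReal.toReal_pos (one_pos.trans_le hq).ne' hq'
  have htm : AEStronglyMeasurable (truncate χ f) volume :=
    hχ.contDiff_ofReal.continuous.aestronglyMeasurable.mul
      (hf.aestronglyMeasurable.sub aestronglyMeasurable_const)
  have h4 : eLpNorm (truncate χ f) q volume ≤ 2 := by
    have := (eLpNorm_sub_le hf.aestronglyMeasurable (hf.aestronglyMeasurable.sub htm) hq).trans
      (add_le_add hfq.le (h₃ χ hχ))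
    rwa [sub_sub_cancel, one_add_one_eq_two] at this
  rw [eLpNorm_eq_lintegral_rpow_enorm_toReal (one_pos.trans_le hq).ne' hq'] at h4
  have h5 := ENNReal.rpow_le_rpow h4 hq0.le
  rwa [← ENNReal.rpow_mul, one_div_mul_cancel hq0.ne', ENNReal.rpow_one] at h5

/-- The layer decomposition of a function in `H¹ ∩ L^p` normalized in `L^q`. -/
theorem exists_isLayerDecomposition_of_memLp (hn : 0 < n) (P : MaximalParams) {p q : ℝ≥0∞}
    (hq : 1 < q) (hqp : q < p) (hp' : p ≠ ⊤) : ∃ C : ℝ≥0∞, C ≠ ⊤ ∧ ∀ f : Rn n → ℂ, Measurable f →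
      LocallyIntegrable f → ∫⁻ x, grandMaximal P f x ≠ ⊤ → MemLp f p → eLpNorm f q volume = 1 →
      ∃ (k₀ : ℤ) (N : ℕ) (u : ℕ → Rn n → ℂ),
        IsLayerDecomposition P p.toReal q.toReal C 1 f k₀ N u ∧
        (∀ i, LocallyIntegrable (u i)) ∧ (∀ i, MemLp (u i) p) := by
  have hq' : q ≠ ⊤ := hqp.ne_top
  have hp : 1 < p := hq.trans hqp
  have hqr : 1 < q.toReal := by simpa using (ENNReal.toReal_lt_toReal ENNReal.one_ne_top hq').2 hq
  have hqpr : q.toReal < p.toReal := (ENNReal.toReal_lt_toReal hq' hp').2 hqp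
  have hp0 : 0 < p.toReal := by linarith
  obtain ⟨C, hC, hdec⟩ := exists_isLayerDecomposition hn P hqr hqpr
  refine ⟨C * 2 ^ q.toReal, by finiteness, fun f hfm hf hfin hfp hfq => ?_⟩
  obtain ⟨K, R, χ, hR, hχ, h₁, h₂, h₃⟩ := exists_truncate hn P hq.le hq' hp.le hp' hf hfin hfp hfq
  have htm : Measurable (truncate χ f) :=
    hχ.contDiff_ofReal.continuous.measurable.mul (hfm.sub measurable_const)
  have htp : MemLp (truncate χ f) p := by
    have := hfp.sub (g := f - truncate χ f) ⟨(hfm.sub htm).aestronglyMeasurable,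
      h₂.trans_lt (by simp)⟩
    rwa [sub_sub_cancel] at this
  have hLp := lintegral_rpow_enorm_lt_top_of_eLpNorm_lt_top (one_pos.trans hp).ne' hp' htp.2
  obtain ⟨k₀, N, u, hu, hum, hub, R', hus⟩ := hdec (truncate χ f) R hR htm
    (fun x hx => by simp [truncate, hχ.eq_zero hx]) (hχ.integral_truncate hR hf) hLp.ne
    (2⁻¹ ^ p.toReal) (ENNReal.rpow_pos (by simp) (by simp))
  have hur : ∀ (r : ℝ≥0∞) i, MemLp (u i) r := fun r i => by
    obtain ⟨B, hB⟩ := hub i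
    exact memLp_of_ae_bound_of_closedBall (hum i).aestronglyMeasurable hB (hus i) r
  have hul : ∀ i, LocallyIntegrable (u i) := fun i => (hur 1 i).locallyIntegrable le_rfl
  have htl : LocallyIntegrable (truncate χ f) := htp.locallyIntegrable hp.le
  refine ⟨k₀, N, u, ?_, hul, hur p⟩
  have h4 := hu.of_sub_le (by linarith) hf htl hul h₁ (by rwa [ENNReal.ofReal_toReal hp'])
  exact ⟨h4.hardy_le.trans (by gcongr), h4.lp_le.trans (by gcongr), h4.error_hardy_le,
    h4.error_lp_le⟩

/-- For smooth functions the layers can be chosen smooth and compactly supported. -/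
theorem exists_contDiff_isLayerDecomposition_of_memLp (hn : 0 < n) (P : MaximalParams)
    {p q : ℝ≥0∞} (hq : 1 < q) (hqp : q < p) (hp' : p ≠ ⊤) : ∃ C : ℝ≥0∞, C ≠ ⊤ ∧
      ∀ f : Rn n → ℂ, ContDiff ℝ ∞ f → ∫⁻ x, grandMaximal P f x ≠ ⊤ → MemLp f p →
      eLpNorm f q volume = 1 → ∃ (k₀ : ℤ) (N : ℕ) (u : ℕ → Rn n → ℂ),
        IsLayerDecomposition P p.toReal q.toReal C 1 f k₀ N u ∧
        (∀ i, ContDiff ℝ ∞ (u i)) ∧ ∀ i, HasCompactSupport (u i) := by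
  have hq' : q ≠ ⊤ := hqp.ne_top
  have hp : 1 < p := hq.trans hqp
  have hqr : 1 < q.toReal := by simpa using (ENNReal.toReal_lt_toReal ENNReal.one_ne_top hq').2 hq
  have hqpr : q.toReal < p.toReal := (ENNReal.toReal_lt_toReal hq' hp').2 hqp
  obtain ⟨C, hC, hdec⟩ := exists_contDiff_isLayerDecomposition hn P hqr hqpr
  refine ⟨C * 2 ^ q.toReal, by finiteness, fun f hfc hfin hfp hfq => ?_⟩
  have hf := hfc.continuous.locallyIntegrable (μ := volume)
  obtain ⟨K, R, χ, hR, hχ, h₁, h₂, h₃⟩ := exists_truncate hn P hq.le hq' hp.le hp' hf hfin hfp hfq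
  have htc : Continuous (truncate χ f) :=
    hχ.contDiff_ofReal.continuous.mul (hfc.continuous.sub continuous_const)
  obtain ⟨k₀, N, u, hu, huc, hus⟩ := hdec (truncate χ f) R hR htc
    (fun x hx => by simp [truncate, hχ.eq_zero hx]) (hχ.integral_truncate hR hf)
    (2⁻¹ ^ p.toReal) (ENNReal.rpow_pos (by simp) (by simp))
  refine ⟨k₀, N, u, ?_, huc, hus⟩
  have h4 := hu.of_sub_le (by linarith) hf htc.locallyIntegrable
    (fun i => (huc i).continuous.locallyIntegrable) h₁ (by rwa [ENNReal.ofReal_toReal hp'])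
  exact ⟨h4.hardy_le.trans (by gcongr), h4.lp_le.trans (by gcongr), h4.error_hardy_le,
    h4.error_lp_le⟩

end FullDecomposition

/-! ### Weights on the strip -/

section StripWeight

/-- The entire function `exp ((1 - z) a₀ + z a₁)`, which has modulus `exp a₀` on `Re z = 0` and
`exp a₁` on `Re z = 1`, multiplied by the Gaussian factor `exp (z² - θ²)`, which equals one at `θ`
and makes the product vanish at infinity in the strip. -/
noncomputable def stripWeight (θ a₀ a₁ : ℝ) (z : ℂ) : ℂ :=
  Complex.exp (z ^ 2 - θ ^ 2 + (1 - z) * a₀ + z * a₁)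

variable {θ a₀ a₁ : ℝ}

theorem norm_stripWeight (x y : ℝ) : ‖stripWeight θ a₀ a₁ (x + y * Complex.I)‖
    = Real.exp (x ^ 2 - θ ^ 2 + (1 - x) * a₀ + x * a₁) * Real.exp (-y ^ 2) := by
  rw [stripWeight, Complex.norm_exp, ← Real.exp_add]
  congr 1
  simp [pow_two]
  ring

theorem differentiable_stripWeight : Differentiable ℂ (stripWeight θ a₀ a₁) := by
  unfold stripWeight
  fun_prop

theorem stripWeight_self (h : (1 - θ) * a₀ + θ * a₁ = 0) : stripWeight θ a₀ a₁ θ = 1 := by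
  have h1 : ((θ : ℂ) ^ 2 - θ ^ 2 + (1 - θ) * a₀ + θ * a₁) = ((1 - θ) * a₀ + θ * a₁ : ℝ) := by
    push_cast
    ring
  rw [stripWeight, h1, h, Complex.ofReal_zero, Complex.exp_zero]

theorem norm_stripWeight_le {z : ℂ} (hz : z ∈ closedStrip) :
    ‖stripWeight θ a₀ a₁ z‖ ≤ Real.exp (1 + |a₀| + |a₁|) := by
  obtain ⟨h0, h1⟩ := hz
  rw [← Complex.re_add_im z, norm_stripWeight, ← Real.exp_add]
  refine Real.exp_le_exp.2 ?_
  have h2 : (1 - z.re) * a₀ ≤ |a₀| := (mul_le_mul_of_nonneg_left (le_abs_self _)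
    (by linarith)).trans (mul_le_of_le_one_left (abs_nonneg _) (by linarith))
  have h3 : z.re * a₁ ≤ |a₁| := (mul_le_mul_of_nonneg_left (le_abs_self _)
    h0).trans (mul_le_of_le_one_left (abs_nonneg _) h1)
  nlinarith [sq_nonneg θ, sq_nonneg z.im]

theorem tendsto_stripWeight (x : ℝ) :
    Tendsto (fun y : ℝ => stripWeight θ a₀ a₁ (x + y * Complex.I)) (cocompact ℝ) (𝓝 0) := by
  rw [tendsto_zero_iff_norm_tendsto_zero]
  simp_rw [norm_stripWeight]
  have h1 : Tendsto (fun y : ℝ => Real.exp (-y ^ 2)) (cocompact ℝ) (𝓝 0) := by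
    have h2 := Real.tendsto_exp_neg_atTop_nhds_zero.comp
      ((tendsto_pow_atTop two_ne_zero).comp (tendsto_norm_cocompact_atTop (E := ℝ)))
    refine h2.congr fun y => ?_
    simp
  simpa using h1.const_mul _

theorem enorm_stripWeight_zero_le (y : ℝ) :
    ‖stripWeight θ a₀ a₁ (y * Complex.I)‖ₑ ≤ ENNReal.ofReal (Real.exp 1) *
      ENNReal.ofReal (Real.exp a₀) := by
  rw [← ENNReal.ofReal_mul (by positivity), ← ofReal_norm]
  refine ENNReal.ofReal_le_ofReal ?_
  have := norm_stripWeight (θ := θ) (a₀ := a₀) (a₁ := a₁) 0 y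
  rw [Complex.ofReal_zero, zero_add] at this
  rw [this, ← Real.exp_add, ← Real.exp_add]
  refine Real.exp_le_exp.2 ?_
  nlinarith [sq_nonneg θ, sq_nonneg y]

theorem enorm_stripWeight_one_le (y : ℝ) :
    ‖stripWeight θ a₀ a₁ (1 + y * Complex.I)‖ₑ ≤ ENNReal.ofReal (Real.exp 1) *
      ENNReal.ofReal (Real.exp a₁) := by
  rw [← ENNReal.ofReal_mul (by positivity), ← ofReal_norm]
  refine ENNReal.ofReal_le_ofReal ?_
  have := norm_stripWeight (θ := θ) (a₀ := a₀) (a₁ := a₁) 1 y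
  rw [Complex.ofReal_one] at this
  rw [this, ← Real.exp_add, ← Real.exp_add]
  refine Real.exp_le_exp.2 ?_
  nlinarith [sq_nonneg θ, sq_nonneg y]

theorem dyadicLevel_rpow_eq (k : ℤ) (s : ℝ) :
    dyadicLevel k ^ s = ENNReal.ofReal (Real.exp (k * s * Real.log 2)) := by
  rw [dyadicLevel, ← ENNReal.rpow_mul, mul_comm _ (Real.log 2), ← Real.rpow_def_of_pos two_pos,
    ← ENNReal.ofReal_rpow_of_pos two_pos]
  simp

end StripWeight

/-! ### The analytic family -/

section Extension

variable {n : ℕ} {P : MaximalParams}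

theorem HardySpace.enorm_eq (f : HardySpace n P) :
    ‖f‖ₑ = ∫⁻ x, grandMaximal P (hardyIncl n P f) x := by
  rw [← ofReal_norm]
  exact ENNReal.ofReal_toReal f.2.2.ne

theorem norm_zeroAtInfty_le {X : Type*} [NormedAddCommGroup X] {f : C₀(ℝ, X)} {B : ℝ≥0∞}
    (hB : B ≠ ⊤) (h : ∀ y, ‖f y‖ₑ ≤ B) : ‖f‖ ≤ B.toReal := by
  rw [← ZeroAtInftyContinuousMap.norm_toBCF_eq_norm]
  refine (BoundedContinuousFunction.norm_le ENNReal.toReal_nonneg).2 fun y => ?_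
  have h1 := ENNReal.toReal_mono hB (h y)
  rwa [toReal_enorm] at h1

/-- The analytic family attached to a layer decomposition of `f`, where `e` and `d i` represent `f`
and its layers in `D`. The layer at height `2 ^ k` is multiplied by an entire function of modulus at
most a constant times `2 ^ (k (q - 1))` on `Re z = 0` and `2 ^ (k (q / p - 1))` on `Re z = 1`; the
relation between `p`, `q` and `θ` makes these functions equal to one at `θ`. -/
theorem exists_calderonFun_of_isLayerDecomposition {D : Type*} [AddCommGroup D] [Module ℂ D]
    [TopologicalSpace D] [IsTopologicalAddGroup D] [ContinuousSMul ℂ D] (j : D →ₗ[ℂ] FunRn n)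
    {p : ℝ≥0∞} [Fact (1 ≤ p)] (hp : p ≠ ⊤) {q θ : ℝ}
    (hθ : (1 - θ) * (q - 1) + θ * (q / p.toReal - 1) = 0) {C : ℝ≥0∞} (hC : C ≠ ⊤)
    {f : Rn n → ℂ} {k₀ : ℤ} {N : ℕ} {u : ℕ → Rn n → ℂ}
    (h : IsLayerDecomposition P p.toReal q C 1 f k₀ N u) (e : D) (d : Fin N → D)
    (he : j e =ᵐ[volume] f) (hd : ∀ i, j (d i) =ᵐ[volume] u i)
    (he₀ : j e ∈ hardySubmodule n P) (he₁ : j e ∈ Lp ℂ p (volume : Measure (Rn n)))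
    (hd₀ : ∀ i, j (d i) ∈ hardySubmodule n P)
    (hd₁ : ∀ i, j (d i) ∈ Lp ℂ p (volume : Measure (Rn n))) :
    ∃ F : CalderonFun (hardyIncl n P) (lpIncl n p) j, F.toFun θ = e ∧
      F.norm ≤ (ENNReal.ofReal (Real.exp 1) * (C + C ^ (1 / p.toReal) + 1)).toReal := by
  set r : D := e - ∑ i, d i with hr_def
  have hjr : j r = j e - ∑ i, j (d i) := by rw [hr_def, map_sub, map_sum]
  have hr : j r =ᵐ[volume] fun x => f x - ∑ i ∈ Finset.range N, u i x := by
    have h3 : ∀ᵐ x, ∀ i, j (d i) x = u i x := ae_all_iff.2 hd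
    rw [hjr]
    filter_upwards [AEEqFun.coeFn_sub (j e) (∑ i, j (d i)),
      AEEqFun.coeFn_finsetSum Finset.univ fun i => j (d i), he, h3] with x h4 h5 h6 h7
    rw [h4, Pi.sub_apply, h5, h6, Finset.sum_range, Finset.sum_apply]
    exact congrArg _ (Finset.sum_congr rfl fun i _ => h7 i)
  have hr₀ : j r ∈ hardySubmodule n P := by
    rw [hjr]
    exact sub_mem he₀ (sum_mem fun i _ => hd₀ i)
  have hr₁ : j r ∈ Lp ℂ p (volume : Measure (Rn n)) := by
    rw [hjr]
    exact sub_mem he₁ (sum_mem fun i _ => hd₁ i)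
  have hp1 : 1 ≤ p := Fact.out
  have hp0 : 0 < p.toReal := ENNReal.toReal_pos (one_pos.trans_le hp1).ne' hp
  have hCp : C ^ (1 / p.toReal) ≠ ⊤ := ENNReal.rpow_ne_top_of_nonneg (by positivity) hC
  have hnorm : ∀ g : Rn n → ℂ,
      eLpNorm g p volume = (∫⁻ x, ‖g x‖ₑ ^ p.toReal) ^ (1 / p.toReal) :=
    fun g => eLpNorm_eq_lintegral_rpow_enorm_toReal (one_pos.trans_le hp1).ne' hp
  set E := ENNReal.ofReal (Real.exp 1) with hE
  set a : ℝ → ℕ → ℝ := fun s i => ((k₀ + i : ℤ) : ℝ) * s * Real.log 2 with ha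
  -- The label `none` stands for the error `r`, whose weight has no dyadic factor.
  let δ : Option (Fin N) → D := fun o => o.elim r fun i => d i
  let b : ℝ → Option (Fin N) → ℝ := fun s o => o.elim 0 fun i => a s i
  have hδ₀ : ∀ o, j (δ o) ∈ hardySubmodule n P := fun o => by cases o with
    | none => exact hr₀
    | some i => exact hd₀ i
  have hδ₁ : ∀ o, j (δ o) ∈ Lp ℂ p (volume : Measure (Rn n)) := fun o => by cases o with
    | none => exact hr₁
    | some i => exact hd₁ i
  let x₀ : Option (Fin N) → HardySpace n P := fun o => ⟨j (δ o), hδ₀ o⟩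
  let x₁ : Option (Fin N) → Lp ℂ p (volume : Measure (Rn n)) := fun o => ⟨j (δ o), hδ₁ o⟩
  let s : Option (Fin N) → ℂ → ℂ := fun o => stripWeight θ (b (q - 1) o) (b (q / p.toReal - 1) o)
  have hs₀ : ∀ o, Tendsto (fun y : ℝ => s o (y * Complex.I)) (cocompact ℝ) (𝓝 0) := fun o => by
    simpa [s] using tendsto_stripWeight (θ := θ) (a₀ := b (q - 1) o)
      (a₁ := b (q / p.toReal - 1) o) 0
  have hs₁ : ∀ o, Tendsto (fun y : ℝ => s o (1 + y * Complex.I)) (cocompact ℝ) (𝓝 0) := fun o => by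
    simpa [s] using tendsto_stripWeight (θ := θ) (a₀ := b (q - 1) o)
      (a₁ := b (q / p.toReal - 1) o) 1
  obtain ⟨F, hF, hF₀, hF₁⟩ := exists_calderonFun_of_sum (hardyIncl n P) (lpIncl n p) j s
    (fun o => differentiable_stripWeight) (fun o => ⟨_, fun z hz => norm_stripWeight_le hz⟩)
    hs₀ hs₁ δ x₀ x₁ (fun _ => rfl) (fun _ => rfl)
  have hx₀ : ∀ i : Fin N, ‖x₀ (some i)‖ₑ = ∫⁻ x, grandMaximal P (u i) x := fun i => by
    rw [HardySpace.enorm_eq]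
    exact congrArg (fun g : Rn n → ℝ≥0∞ => ∫⁻ x, g x) (grandMaximal_congr P (hd i))
  have hx₀' : ‖x₀ none‖ₑ ≤ 1 := by
    rw [HardySpace.enorm_eq]
    exact (congrArg (fun g : Rn n → ℝ≥0∞ => ∫⁻ x, g x) (grandMaximal_congr P hr)).trans_le
      h.error_hardy_le
  have hx₁' : ‖x₁ none‖ₑ ≤ 1 := by
    rw [Lp.enorm_def]
    refine (eLpNorm_congr_ae hr).trans_le ?_
    rw [hnorm]
    exact (ENNReal.rpow_le_rpow h.error_lp_le (by positivity)).trans_eq (ENNReal.one_rpow _)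
  refine ⟨F, ?_, max_le (norm_zeroAtInfty_le (by finiteness) fun y => ?_)
    (norm_zeroAtInfty_le (by finiteness) fun y => ?_)⟩
  · have hs : ∀ o, s o θ = 1 := by
      intro o
      refine stripWeight_self ?_
      cases o with
      | none => simp [b]
      | some i =>
        simp only [b, a, Option.elim_some]
        linear_combination ((k₀ + (i : ℕ) : ℤ) : ℝ) * Real.log 2 * hθ
    rw [hF, Fintype.sum_option]
    simp only [hs, one_smul, δ, Option.elim_none, Option.elim_some]
    exact sub_add_cancel _ _
  · rw [hF₀, Fintype.sum_option]
    refine (enorm_add_le _ _).trans ?_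
    have h1 : ‖s none (y * Complex.I) • x₀ none‖ₑ ≤ E * 1 := by
      rw [enorm_smul]
      refine mul_le_mul' ((enorm_stripWeight_zero_le y).trans ?_) hx₀'
      simp [b, E]
    have h2 : ‖∑ i : Fin N, s (some i) (y * Complex.I) • x₀ (some i)‖ₑ ≤ E * C := by
      refine (enorm_sum_le _ _).trans (le_trans ?_ (mul_le_mul' le_rfl h.hardy_le))
      rw [Finset.sum_range, Finset.mul_sum]
      refine Finset.sum_le_sum fun i _ => ?_
      rw [enorm_smul, hx₀ i, ← mul_assoc]
      refine mul_le_mul' ((enorm_stripWeight_zero_le y).trans_eq ?_) le_rfl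
      rw [dyadicLevel_rpow_eq]
      rfl
    calc _ ≤ E * 1 + E * C := add_le_add h1 h2
      _ = E * (C + 1) := by ring
      _ ≤ _ := by
        gcongr
        exact le_self_add
  · rw [hF₁, Fintype.sum_option]
    refine (enorm_add_le _ _).trans ?_
    have h1 : ‖s none (1 + y * Complex.I) • x₁ none‖ₑ ≤ E * 1 := by
      rw [enorm_smul]
      refine mul_le_mul' ((enorm_stripWeight_one_le y).trans ?_) hx₁'
      simp [b, E]
    have h2 : ‖∑ i : Fin N, s (some i) (1 + y * Complex.I) • x₁ (some i)‖ₑ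
        ≤ E * C ^ (1 / p.toReal) := by
      have hae : (∑ i : Fin N, s (some i) (1 + y * Complex.I) • x₁ (some i) :
          Lp ℂ p (volume : Measure (Rn n))) =ᵐ[volume]
          fun x => ∑ i : Fin N, s (some i) (1 + y * Complex.I) • u i x := by
        have h3 : ∀ᵐ x, ∀ i : Fin N, (s (some i) (1 + y * Complex.I) • x₁ (some i) :
            Lp ℂ p (volume : Measure (Rn n))) x = s (some i) (1 + y * Complex.I) • u i x := by
          refine ae_all_iff.2 fun i => ?_
          filter_upwards [Lp.coeFn_smul (s (some i) (1 + y * Complex.I)) (x₁ (some i)), hd i]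
            with x h4 h5
          rw [h4, Pi.smul_apply]
          exact congrArg _ h5
        refine (Lp.coeFn_finsetSum _ _).trans ?_
        filter_upwards [h3] with x hx
        rw [Finset.sum_apply]
        exact Finset.sum_congr rfl fun i _ => hx i
      rw [Lp.enorm_def, eLpNorm_congr_ae hae, hnorm]
      calc _ ≤ (∫⁻ x, (E * ∑ i ∈ Finset.range N, dyadicLevel (k₀ + i) ^ (q / p.toReal - 1)
              * ‖u i x‖ₑ) ^ p.toReal) ^ (1 / p.toReal) := by
            refine ENNReal.rpow_le_rpow (lintegral_mono fun x => ?_) (by positivity)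
            refine ENNReal.rpow_le_rpow ((enorm_sum_le _ _).trans ?_) hp0.le
            rw [Finset.sum_range, Finset.mul_sum]
            refine Finset.sum_le_sum fun i _ => ?_
            rw [enorm_smul, ← mul_assoc]
            refine mul_le_mul' ((enorm_stripWeight_one_le y).trans_eq ?_) le_rfl
            rw [dyadicLevel_rpow_eq]
            rfl
        _ ≤ (E ^ p.toReal * C) ^ (1 / p.toReal) := by
            refine ENNReal.rpow_le_rpow ?_ (by positivity)
            simp_rw [ENNReal.mul_rpow_of_nonneg _ _ hp0.le]
            rw [lintegral_const_mul' _ _ (by finiteness)]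
            exact mul_le_mul' le_rfl h.lp_le
        _ = _ := by
            rw [ENNReal.mul_rpow_of_nonneg _ _ (by positivity), ← ENNReal.rpow_mul,
              mul_one_div_cancel hp0.ne', ENNReal.rpow_one]
    calc _ ≤ E * 1 + E * C ^ (1 / p.toReal) := add_le_add h1 h2
      _ = E * (C ^ (1 / p.toReal) + 1) := by ring
      _ ≤ _ := by
        gcongr
        exact le_add_self

theorem IsLayerDecomposition.lintegral_grandMaximal_lt_top {p q : ℝ} {C ε : ℝ≥0∞} {f : Rn n → ℂ}
    {k₀ : ℤ} {N : ℕ} {u : ℕ → Rn n → ℂ} (h : IsLayerDecomposition P p q C ε f k₀ N u) (hC : C ≠ ⊤)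
    (i : Fin N) : ∫⁻ x, grandMaximal P (u i) x < ⊤ := by
  have h1 := (Finset.single_le_sum (fun _ _ => zero_le) (Finset.mem_range.2 i.2)).trans h.hardy_le
  have h2 : dyadicLevel (k₀ + (i : ℕ)) ^ (q - 1) ≠ 0 :=
    (ENNReal.rpow_pos (dyadicLevel_pos _) (dyadicLevel_ne_top _)).ne'
  by_contra h3
  rw [not_lt_top_iff.1 h3, ENNReal.mul_top h2] at h1
  exact hC (top_le_iff.1 h1)

/-- Elements of `H¹` define elements of `H¹ + L^p`. -/
theorem exists_sumIncl_eq (p : ℝ≥0∞) [Fact (1 ≤ p)] {g : FunRn n} (hg : g ∈ hardySubmodule n P) :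
    ∃ d, sumIncl (hardyIncl n P) (lpIncl n p) d = g := by
  refine ⟨Submodule.Quotient.mk (WithLp.toLp 1 ((⟨g, hg⟩ : hardySubmodule n P), 0)), ?_⟩
  change hardyIncl n P ⟨g, hg⟩ + lpIncl n p 0 = g
  rw [map_zero, add_zero]
  rfl

/-- Membership of a class of functions in `H¹` may be tested on any representative. -/
theorem mem_hardySubmodule_of_ae_eq {g : FunRn n} {v : Rn n → ℂ} (hg : g =ᵐ[volume] v)
    (hv : LocallyIntegrable v) (hM : ∫⁻ x, grandMaximal P v x < ⊤) : g ∈ hardySubmodule n P :=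
  ⟨hv.congr hg.symm, by rwa [grandMaximal_congr P hg]⟩

theorem mem_Lp_of_ae_eq {p : ℝ≥0∞} {g : FunRn n} {v : Rn n → ℂ} (hg : g =ᵐ[volume] v)
    (hv : MemLp v p) : g ∈ Lp ℂ p (volume : Measure (Rn n)) :=
  Lp.mem_Lp_iff_memLp.2 (hv.ae_eq hg.symm)

/-- The elementary relations between the three exponents. -/
theorem exponent_relations {p q : ℝ≥0∞} {θ : ℝ} (hp : 1 < p) (hp' : p < ⊤) (hθ : 0 < θ)
    (hθ' : θ < 1) (h : q⁻¹ = ENNReal.ofReal (1 - θ) + ENNReal.ofReal θ / p) :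
    1 < q ∧ q < p ∧ (1 - θ) * (q.toReal - 1) + θ * (q.toReal / p.toReal - 1) = 0 := by
  have hr : 1 < p.toReal := by
    simpa using (ENNReal.toReal_lt_toReal ENNReal.one_ne_top hp'.ne).2 hp
  have hr0 : 0 < p.toReal := by linarith
  have h1 : q⁻¹ = ENNReal.ofReal (1 - θ + θ / p.toReal) := by
    rw [h, ENNReal.ofReal_add (by linarith) (by positivity), ENNReal.ofReal_div_of_pos hr0,
      ENNReal.ofReal_toReal hp'.ne]
  set a : ℝ := 1 - θ + θ / p.toReal with ha
  have h2 : θ / p.toReal < θ := div_lt_self hθ hr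
  have h3 : 0 < θ / p.toReal := by positivity
  have ha0 : 0 < a := by linarith
  have hq : q = ENNReal.ofReal a⁻¹ := by
    rw [ENNReal.ofReal_inv_of_pos ha0, ← h1, inv_inv]
  refine ⟨?_, ?_, ?_⟩
  · rw [hq, ENNReal.one_lt_ofReal]
    exact (one_lt_inv₀ ha0).2 (by linarith)
  · rw [hq, ENNReal.ofReal_lt_iff_lt_toReal (by positivity) hp'.ne, inv_lt_comm₀ ha0 hr0, ha]
    have h4 : p.toReal⁻¹ < 1 := inv_lt_one_of_one_lt₀ hr
    rw [div_eq_mul_inv]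
    nlinarith
  · rw [hq, ENNReal.toReal_ofReal (by positivity)]
    have : a⁻¹ * a = 1 := inv_mul_cancel₀ ha0.ne'
    calc _ = a⁻¹ * a - 1 := by rw [ha]; ring
      _ = 0 := by rw [this, sub_self]

end Extension

/-! ### The interpolation theorem -/

theorem proposition6p37 (n : ℕ) (hn : 0 < n) (P : MaximalParams)
    (p pθ : ℝ≥0∞) [Fact (1 ≤ p)] (hp : 1 < p) (hp' : p < ⊤)
    (θ : ℝ) (hθ : 0 < θ) (hθ' : θ < 1)
    (hpθ : pθ⁻¹ = ENNReal.ofReal (1 - θ) + ENNReal.ofReal θ / p) :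
    ∃ C : ℝ, ∀ f : FunRn n,
      f ∈ hardySubmodule n P → f ∈ Lp ℂ p (volume : Measure (Rn n)) →
      eLpNorm f pθ volume = 1 →
      (∃ F : CalderonHardyLp n P p,
        sumIncl (hardyIncl n P) (lpIncl n p) (F.toFun θ) = f ∧ F.norm ≤ C) ∧
      ((∃ g : 𝓢(Rn n, ℂ), schwartzIncl n g = f) →
        ∃ F : CalderonHardyLpSchwartz n P p,
          schwartzHardyIncl n P (F.toFun θ) = f ∧ F.norm ≤ C) := by
  obtain ⟨hq, hqp, hrel⟩ := exponent_relations hp hp' hθ hθ' hpθ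
  obtain ⟨C₁, hC₁, h₁⟩ := exists_isLayerDecomposition_of_memLp hn P hq hqp hp'.ne
  obtain ⟨C₂, hC₂, h₂⟩ := exists_contDiff_isLayerDecomposition_of_memLp hn P hq hqp hp'.ne
  refine ⟨max (ENNReal.ofReal (Real.exp 1) * (C₁ + C₁ ^ (1 / p.toReal) + 1)).toReal
    (ENNReal.ofReal (Real.exp 1) * (C₂ + C₂ ^ (1 / p.toReal) + 1)).toReal,
    fun f hf hfp hfq => ⟨?_, ?_⟩⟩
  · obtain ⟨k₀, N, u, hu, hul, hup⟩ := h₁ f f.measurable hf.1 hf.2.ne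
      (Lp.mem_Lp_iff_memLp.1 hfp) hfq
    have hae : ∀ i, (AEEqFun.mk (u i) (hul i).aestronglyMeasurable : FunRn n) =ᵐ[volume] u i :=
      fun i => AEEqFun.coeFn_mk _ _
    have hmem := fun i : Fin N => mem_hardySubmodule_of_ae_eq (hae i) (hul i)
      (hu.lintegral_grandMaximal_lt_top hC₁ i)
    obtain ⟨e, he⟩ := exists_sumIncl_eq p hf
    choose d hd using fun i => exists_sumIncl_eq p (hmem i)
    obtain ⟨F, hF, hFC⟩ := exists_calderonFun_of_isLayerDecomposition
      (sumIncl (hardyIncl n P) (lpIncl n p)) hp'.ne hrel hC₁ hu e d (by rw [he])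
      (fun i => by rw [hd]; exact hae i) (by rwa [he]) (by rwa [he])
      (fun i => by rw [hd]; exact hmem i)
      (fun i => by rw [hd]; exact mem_Lp_of_ae_eq (hae i) (hup i))
    exact ⟨F, by rw [hF, he], hFC.trans (le_max_left _ _)⟩
  · rintro ⟨g, rfl⟩
    have hg : schwartzIncl n g =ᵐ[volume] g := AEEqFun.coeFn_mk _ _
    obtain ⟨k₀, N, u, hu, huc, hus⟩ := h₂ g g.smooth'
      (by rw [← grandMaximal_congr P hg]; exact hf.2.ne)
      ((Lp.mem_Lp_iff_memLp.1 hfp).ae_eq hg) (by rw [← eLpNorm_congr_ae hg, hfq])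
    have hae : ∀ i, schwartzIncl n ((hus i).toSchwartzMap (huc i)) =ᵐ[volume] u i :=
      fun i => AEEqFun.coeFn_mk _ _
    have hmem := fun i : Fin N => mem_hardySubmodule_of_ae_eq (hae i)
      (huc i).continuous.locallyIntegrable (hu.lintegral_grandMaximal_lt_top hC₂ i)
    obtain ⟨F, hF, hFC⟩ := exists_calderonFun_of_isLayerDecomposition
      (schwartzHardyIncl n P) hp'.ne hrel hC₂ hu ⟨g, hf⟩
      (fun i => ⟨(hus i).toSchwartzMap (huc i), hmem i⟩) hg (fun i => hae i) hf hfp hmem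
      (fun i => mem_Lp_of_ae_eq (hae i)
        ((huc i).continuous.memLp_of_hasCompactSupport (hus i)))
    exact ⟨F, by rw [hF]; rfl, hFC.trans (le_max_right _ _)⟩
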